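/- **Setting.** Fix integers $n\ge 1$, $m\ge 0$, $\kappa\ge 0$ and constants $\sigma, A, B>0$, $C_0,\dots,C_m$. For an open set $U\subset\mathbb R^n$ and an integer $k\ge 0$ let $\|u\|_{H^k(U)}^2=\sum_{|\alpha|\le k}\|\partial^\alpha u\|_{L^2(U)}^2$ (weak derivatives, complex-valued functions), and for $u\in L^2(U)$ let $\|u\|_{H^{-k}(U)}=\sup\{|(u,\varphi)_{L^2(U)}|/\|\varphi\|_{H^k(U)} : 0\ne\varphi\in H^k(U)\}$ be the norm of $u$ in the dual of $H^k(U)$. Let $\Omega\subset\mathbb R^n$ be a bounded open set and $h>0$. Suppose we are given open sets $\omega_1,\dots,\omega_N$ covering $\Omega$, open balls $\omega_j^*$, functions $\phi_j$, and linear subspaces $\Psi_j\subset H^m(\omega_j)$ such that: * (A) each $\omega_j$ is convex, of diameter $d_j\le h\le 1$; the ball $\omega_j^*$ has diameter $\ge\sigma h$ and $\overline{\omega_j^*}\subset\omega_j$; and $\omega_j^*\subset\Omega$ unless $\phi_j\equiv 0$ on $\Omega$; * (B) no $\kappa+1$ of the sets $\omega_j$ have a common point; the $\phi_j\ge 0$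 are Lipschitz on $\Omega$, $\sum_j\phi_j=1$ on $\Omega$, $\operatorname{supp}\phi_j\subset\omega_j$ (support relative to $\Omega$), $\|\partial^\alpha\phi_j\|_{L^\infty(\Omega)}\le C_{|\alpha|}\,d_j^{-|\alpha|}$ for $|\alpha|\le m$, and $\phi_j=1$ on $\omega_j^*\cap\Omega$; * (C) $\Psi_j$ contains all polynomials of degree $\le 1$, and $\|v\|_{H^l(\omega_j)}\le A\|v\|_{H^l(\omega_j^*)}$ for all $v\in\Psi_j$, $0\le l\le m$; * (D) $\|v\|_{H^t(\omega_j)}\le B\,d_j^{\,s-t}\|v\|_{H^s(\omega_j)}$ for all $v\in\Psi_j$ and integers $0\le s\le t\le m$. Let $S=\{\sum_j\phi_jv_j : v_j\in\Psi_j\}$ be the resulting GFEM space of functions on $\Omega$. **Theorem.** 1. There is $C>0$, depending only on $n,m,\kappa,\sigma,A,B,C_0,\dots,C_m$ (not on $\Omega$, $h$, $N$ or the other data), such that every $w\in S$ lies in $H^m(\Omega)$ and, for every integer $0\le j\le m$, $$\|w\|_{H^j(\Omega)}\le C h^{-j}\|w\|_{L^2(\Omega)},\qquad \|w\|_{L^2(\Omega)}\le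 C h^{-j}\|w\|_{H^{-j}(\Omega)} .$$ 2. If the bounded open set $\Omega$ has Lipschitz boundary (near each boundary point, $\Omega$ is, in suitable Cartesian coordinates, the region strictly on one side of the graph of a Lipschitz function), then there is $C>0$, depending only on $\Omega$ and $n,m,\kappa,\sigma,A,B,C_0,\dots,C_m$ (not on $h$, $N$ or the other data), such that for every $w\in S$ and all integers $0\le i\le j\le m$, $$\|w\|_{H^j(\Omega)}\le C h^{i-j}\|w\|_{H^i(\Omega)},\qquad \|w\|_{H^{-i}(\Omega)}\le C h^{i-j}\|w\|_{H^{-j}(\Omega)} .$$ -/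

import Mathlib

open MeasureTheory Set
open scoped ENNReal ComplexConjugate

noncomputable section

namespace GFEM

/-- `ℝⁿ` with its Euclidean norm. -/
abbrev E (n : ℕ) : Type := EuclideanSpace ℝ (Fin n)

/-- The classical partial derivative `∂ᵢ f`. -/
def partialDeriv {n : ℕ} (i : Fin n) (f : E n → ℂ) : E n → ℂ :=
  fun x => fderiv ℝ f x (EuclideanSpace.single i (1 : ℝ))

/-- The classical derivative `∂^α f = ∂₁^{α₁} ⋯ ∂ₙ^{αₙ} f` for a multi-index `α`. -/
def multiDeriv {n : ℕ} (α : Fin n → ℕ) (f : E n → ℂ) : E n → ℂ :=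
  (List.finRange n).foldr (fun i g => (partialDeriv i)^[α i] g) f

/-- The multi-indices `α` with `|α| ≤ k`. -/
def multiIndices (n k : ℕ) : Finset (Fin n → ℕ) :=
  (Fintype.piFinset fun _ => Finset.range (k + 1)).filter fun α => ∑ i, α i ≤ k

/-- `ψ ∈ C_c^∞(Ω)`. -/
def IsTestFunction {n : ℕ} (Ω : Set (E n)) (ψ : E n → ℂ) : Prop :=
  ContDiff ℝ ((⊤ : ℕ∞) : WithTop ℕ∞) ψ ∧ HasCompactSupport ψ ∧ tsupport ψ ⊆ Ω

/-- `v` is the weak derivative `∂^α u` on the open set `Ω`. -/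
def HasWeakDeriv {n : ℕ} (α : Fin n → ℕ) (Ω : Set (E n)) (u v : E n → ℂ) : Prop :=
  LocallyIntegrableOn u Ω volume ∧ LocallyIntegrableOn v Ω volume ∧
    ∀ ψ : E n → ℂ, IsTestFunction Ω ψ →
      ∫ x in Ω, u x * multiDeriv α ψ x = (-1) ^ (∑ i, α i) * ∫ x in Ω, v x * ψ x

/-- `‖∂^α u‖_{L^p(Ω)}` in the weak sense.  Weak derivatives are unique almost everywhere, so the
infimum ranges over one number; it is `∞` if `u` has no weak derivative `∂^α u` on `Ω`. -/
def weakDerivNorm {n : ℕ} (p : ℝ≥0∞) (α : Fin n → ℕ) (Ω : Set (E n)) (u : E n → ℂ) : ℝ≥0∞ :=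
  ⨅ (v : E n → ℂ) (_ : HasWeakDeriv α Ω u v), eLpNorm v p (volume.restrict Ω)

/-- The Sobolev norm `‖u‖_{H^k(Ω)} = (∑_{|α| ≤ k} ‖∂^α u‖²_{L²(Ω)})^{1/2}`, equal to `∞` if
`u ∉ H^k(Ω)`. -/
def sobolevNorm {n : ℕ} (k : ℕ) (Ω : Set (E n)) (u : E n → ℂ) : ℝ≥0∞ :=
  (∑ α ∈ multiIndices n k, weakDerivNorm 2 α Ω u ^ 2) ^ (1 / 2 : ℝ)

/-- `u ∈ H^k(Ω)`. -/
def MemSobolev {n : ℕ} (k : ℕ) (Ω : Set (E n)) (u : E n → ℂ) : Prop :=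
  sobolevNorm k Ω u < ∞

/-- The norm `‖u‖_{H^{-k}(Ω)} = sup |(u, φ)| / ‖φ‖_{H^k(Ω)}` of `u ∈ L²(Ω)` as an element of the
dual of `H^k(Ω)`, the supremum being over all `0 ≠ φ ∈ H^k(Ω)`. -/
def sobolevDualNorm {n : ℕ} (k : ℕ) (Ω : Set (E n)) (u : E n → ℂ) : ℝ≥0∞ :=
  ⨆ (φ : E n → ℂ) (_ : MemSobolev k Ω φ) (_ : sobolevNorm k Ω φ ≠ 0),
    ‖∫ x in Ω, u x * conj (φ x)‖ₑ / sobolevNorm k Ω φ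

/-- `Ω` has Lipschitz boundary: near each boundary point, `Ω` is the region strictly above the
graph of a Lipschitz function over the hyperplane orthogonal to some unit vector `e`.  That
function is written as a function `g` on `ℝⁿ` that is constant in the direction `e`. -/
def HasLipschitzBoundary {n : ℕ} (Ω : Set (E n)) : Prop :=
  ∀ x ∈ frontier Ω, ∃ (e : E n) (g : E n → ℝ) (K : NNReal) (r : ℝ),
    ‖e‖ = 1 ∧ LipschitzWith K g ∧ (∀ (y : E n) (t : ℝ), g (y + t • e) = g y) ∧ 0 < r ∧
      ∀ y ∈ Metric.ball x r, y ∈ Ω ↔ g y < inner ℝ e y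

/-- The data of a generalized finite element space on `ℝⁿ`: patches `ω_j`, balls `ω_j^*` (given by
their centers and radii), functions `φ_j` (the field `pou`) and local approximation spaces `Ψ_j`
(the field `locSpace`), `j = 1, …, N`.  The conditions on them are stated separately below.  Only the values of `φ_j` on `Ω` and of elements of `Ψ_j` on `ω_j` are ever used. -/
structure Family (n : ℕ) where
  N : ℕ
  patch : Fin N → Set (E n)
  center : Fin N → E n
  radius : Fin N → ℝ
  pou : Fin N → E n → ℝ
  locSpace : Fin N → Submodule ℂ (E n → ℂ)

namespace Family

variable {n : ℕ} (G : Family n)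

/-- The open ball `ω_j^*`. -/
def star (j : Fin G.N) : Set (E n) := Metric.ball (G.center j) (G.radius j)

/-- `{ω_j}` is an open cover of `Ω` such that no `κ + 1` of the sets `ω_j` meet, and `{φ_j}` is a
subordinated partition of unity on `Ω` consisting of Lipschitz functions with
`‖∂^α φ_j‖_{L^∞(Ω)} ≤ C_k / (diam ω_j)^k` for `k = |α| ≤ m`. -/
structure IsPartition (Ω : Set (E n)) (m κ : ℕ) (Cφ : ℕ → ℝ) : Prop where
  isOpen : ∀ j, IsOpen (G.patch j)
  cover : Ω ⊆ ⋃ j, G.patch j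
  overlap : ∀ x, {j | x ∈ G.patch j}.encard ≤ κ
  lipschitz : ∀ j, ∃ K, LipschitzOnWith K (G.pou j) Ω
  nonneg : ∀ j, ∀ x ∈ Ω, 0 ≤ G.pou j x
  sum_eq_one : ∀ x ∈ Ω, ∑ j, G.pou j x = 1
  support : ∀ j, closure {x ∈ Ω | G.pou j x ≠ 0} ∩ Ω ⊆ G.patch j
  deriv_le : ∀ j, ∀ α ∈ multiIndices n m,
    weakDerivNorm ∞ α Ω (fun x => (G.pou j x : ℂ)) ≤
      ENNReal.ofReal (Cφ (∑ i, α i) / Metric.diam (G.patch j) ^ (∑ i, α i))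

/-- The sets `ω_j` are convex with diameter at most `h ≤ 1`, the ball `ω_j^*` has diameter at least
`σ h` and its closure lies in `ω_j`; moreover `ω_j^* ⊆ Ω` unless `φ_j` vanishes identically
on `Ω`. -/
structure AssumptionA (Ω : Set (E n)) (σ h : ℝ) : Prop where
  h_le_one : h ≤ 1
  convex : ∀ j, Convex ℝ (G.patch j)
  bounded : ∀ j, Bornology.IsBounded (G.patch j)
  diam_le : ∀ j, Metric.diam (G.patch j) ≤ h
  le_diam_star : ∀ j, σ * h ≤ 2 * G.radius j
  closure_star : ∀ j, closure (G.star j) ⊆ G.patch j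
  star_subset : ∀ j, (∃ x ∈ Ω, G.pou j x ≠ 0) → G.star j ⊆ Ω

/-- `{φ_j}` is a `(κ, C_0, …, C_m)` partition of unity and `φ_j = 1` on `ω_j^*`. -/
structure AssumptionB (Ω : Set (E n)) (m κ : ℕ) (Cφ : ℕ → ℝ) : Prop where
  partition : G.IsPartition Ω m κ Cφ
  eq_one : ∀ j, ∀ x ∈ G.star j ∩ Ω, G.pou j x = 1

/-- `Ψ_j ⊆ H^m(ω_j)` contains all polynomials of degree at most one, and
`‖w‖_{H^l(ω_j)} ≤ A ‖w‖_{H^l(ω_j^*)}` for `w ∈ Ψ_j` and `0 ≤ l ≤ m`. -/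
structure AssumptionC (m : ℕ) (A : ℝ) : Prop where
  memSobolev : ∀ j, ∀ w ∈ G.locSpace j, MemSobolev m (G.patch j) w
  affine_mem : ∀ j (a : ℂ) (b : Fin n → ℂ), ∃ w ∈ G.locSpace j,
    ∀ᵐ x ∂(volume.restrict (G.patch j)), w x = a + ∑ i, b i * (x i : ℂ)
  norm_le : ∀ j, ∀ w ∈ G.locSpace j, ∀ l ≤ m,
    sobolevNorm l (G.patch j) w ≤ ENNReal.ofReal A * sobolevNorm l (G.star j) w

/-- `‖w‖_{H^t(ω_j)} ≤ B (diam ω_j)^{s-t} ‖w‖_{H^s(ω_j)}` for `w ∈ Ψ_j` and `0 ≤ s ≤ t ≤ m`. -/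
def AssumptionD (m : ℕ) (B : ℝ) : Prop :=
  ∀ j, ∀ w ∈ G.locSpace j, ∀ s t : ℕ, s ≤ t → t ≤ m →
    sobolevNorm t (G.patch j) w ≤
      ENNReal.ofReal (B * Metric.diam (G.patch j) ^ ((s : ℤ) - (t : ℤ))) * sobolevNorm s (G.patch j) w

/-- The GFEM space `S = {∑_j φ_j v_j : v_j ∈ Ψ_j}`, as a set of functions on `Ω` (identified when
they agree almost everywhere on `Ω`). -/
def space (Ω : Set (E n)) : Set (E n → ℂ) :=
  {w | ∃ v : Fin G.N → E n → ℂ, (∀ j, v j ∈ G.locSpace j) ∧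
    ∀ᵐ x ∂(volume.restrict Ω), w x = ∑ j, (G.pou j x : ℂ) * v j x}

/-- All assumptions A, B, C, D on the domain `Ω` with the given parameters. -/
structure SatisfiesABCD (Ω : Set (E n)) (m κ : ℕ) (σ A B : ℝ) (Cφ : ℕ → ℝ) (h : ℝ) : Prop where
  assumptionA : G.AssumptionA Ω σ h
  assumptionB : G.AssumptionB Ω m κ Cφ
  assumptionC : G.AssumptionC m A
  assumptionD : G.AssumptionD m B

end Family

end GFEM

end

/-! On an active ball ω_j^* one has φ_j = 1, and because the φ_l are nonnegative with sum 1 all the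
others vanish there. So w = ∑ φ_l v_l coincides with v_j on ω_j^*, and norms of the v_j can be read
off from w.

For estimates relative to L², (D) bounds h^|γ| ‖∂^γ v_j‖ on ω_j by ‖v_j‖ on ω_j (d_j is comparable
to h, since ω_j contains a ball of diameter at least σh), and (C) moves that norm to ω_j^*, where
v_j = w. The Leibniz rule, the bounds on h^|β| ∂^β φ_j and the bounded overlap then sum the local
estimates with no dependence on Ω or N (`Family.exists_glue`). The dual estimate follows from ‖w‖² =
(w, w) ≤ ‖w‖_{-j} ‖w‖_j.

Relative to H^i with i > 0 this argument loses: derivatives that fall on φ_j leave derivatives of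
v_j of order below i, which are not small like h^i. The remedy is to subtract a smooth approximation
g of w at scale h and to write w - g = ∑ φ_l (v_l - g). On a patch, derivatives of v_l - g of order
at least i are controlled by (D) and by the smoothness of g. Lower ones are controlled by an
iterated Poincaré inequality on the convex patch (`exists_poincare_iterate`), starting from ω_l^*,
where v_l - g = w - g is already O(h^i). This is `Family.exists_wsq_patch_sub_le`. Patches may stick
out of Ω, so g has to live on a 2h-neighbourhood of Ω. For the dual norms the test function is split
as φ = (φ - g) + g.

The approximation comes from `exists_smoothing`. Near each point of its closure a Lipschitz domain
agrees with a set V invariant under a cone of translations. On V one mollifies with kernels whose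
supports point so that only values inside V are used. A combination of the scales h, 2h, ..., ih
makes the error an average of i-th differences, hence O(h^i), and surplus derivatives fall on the
kernel. Cut-off functions join the charts. This needs h ≤ h₀(Ω); for larger h the estimate relative
to L² suffices.

Throughout, a Sobolev function is replaced by a `Jet`, the family of measurable representatives of
its weak derivatives, and `wsq` is the square norm scaled so that the powers of h balance. -/

namespace GFEM

open Filter Topology

variable {n : ℕ}

/-! ### Multi-indices and classical derivatives -/

/-- The order `|α|` of a multi-index. -/
def deg (α : Fin n → ℕ) : ℕ := ∑ i, α i

@[simp] theorem deg_zero : deg (0 : Fin n → ℕ) = 0 := by simp [deg]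

theorem deg_add (α β : Fin n → ℕ) : deg (α + β) = deg α + deg β := by
  simp [deg, Finset.sum_add_distrib]

@[simp] theorem deg_single (i : Fin n) : deg (Pi.single i 1 : Fin n → ℕ) = 1 := by
  simp [deg, Pi.single_apply]

theorem deg_add_single (α : Fin n → ℕ) (i : Fin n) :
    deg (α + Pi.single i 1) = deg α + 1 := by
  rw [deg_add, deg_single]

theorem deg_eq_zero {α : Fin n → ℕ} (h : deg α = 0) : α = 0 := by
  funext i
  simpa using (Finset.sum_eq_zero_iff.1 h) i (Finset.mem_univ i)

theorem mem_multiIndices {α : Fin n → ℕ} {k : ℕ} : α ∈ multiIndices n k ↔ deg α ≤ k := by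
  simp only [multiIndices, Finset.mem_filter, Fintype.mem_piFinset, Finset.mem_range, deg,
    and_iff_right_iff_imp]
  intro h i
  exact Nat.lt_succ_of_le ((Finset.single_le_sum (fun j _ => Nat.zero_le (α j))
    (Finset.mem_univ i)).trans h)

theorem exists_eq_add_single {α : Fin n → ℕ} (h : α ≠ 0) :
    ∃ (β : Fin n → ℕ) (i : Fin n), α = β + Pi.single i 1 := by
  obtain ⟨i, hi⟩ : ∃ i, α i ≠ 0 := by
    by_contra! hc
    exact h (funext hc)
  refine ⟨α - Pi.single i 1, i, ?_⟩
  funext j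
  by_cases hj : j = i
  · subst hj
    simp
    omega
  · simp [hj]

/-- Induction on multi-indices, adding one derivative at a time. -/
theorem multiIndex_induction {P : (Fin n → ℕ) → Prop} (h0 : P 0)
    (hs : ∀ α i, P α → P (α + Pi.single i 1)) (α : Fin n → ℕ) : P α := by
  induction hm : deg α generalizing α with
  | zero => rw [deg_eq_zero hm]; exact h0
  | succ m ih =>
    have : α ≠ 0 := by rintro rfl; simp at hm
    obtain ⟨β, i, rfl⟩ := exists_eq_add_single this
    rw [deg_add_single] at hm
    exact hs _ _ (ih _ (by omega))

/-- `f` is smooth on `ℝⁿ`. -/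
abbrev Smooth (f : E n → ℂ) : Prop := ContDiff ℝ ((⊤ : ℕ∞) : WithTop ℕ∞) f

theorem Smooth.partialDeriv {f : E n → ℂ} (hf : Smooth f) (i : Fin n) :
    Smooth (partialDeriv i f) := by
  have : Smooth f := hf
  unfold GFEM.partialDeriv
  exact (hf.fderiv_right (m := ((⊤ : ℕ∞) : WithTop ℕ∞)) (by simp)).clm_apply contDiff_const

theorem Smooth.differentiable {f : E n → ℂ} (hf : Smooth f) : Differentiable ℝ f :=
  ContDiff.differentiable hf (by simp)

theorem partialDeriv_comm {f : E n → ℂ} (hf : Smooth f) (i j : Fin n) :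
    partialDeriv i (partialDeriv j f) = partialDeriv j (partialDeriv i f) := by
  funext x
  have two_le : (2 : WithTop ℕ∞) ≤ ((⊤ : ℕ∞) : WithTop ℕ∞) :=
    WithTop.coe_le_coe.2 (le_top : (2 : ℕ∞) ≤ ⊤)
  have hd : DifferentiableAt ℝ (fderiv ℝ f) x :=
    (hf.fderiv_right (m := 1) (by rw [one_add_one_eq_two]; exact two_le)).differentiable
      (by simp) x
  have hsym : IsSymmSndFDerivAt ℝ f x :=
    ContDiffAt.isSymmSndFDerivAt hf.contDiffAt (by simpa using two_le)
  have key : ∀ u v : E n, fderiv ℝ (fun y => fderiv ℝ f y u) x v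
      = fderiv ℝ (fderiv ℝ f) x v u := by
    intro u v
    rw [fderiv_clm_apply hd (differentiableAt_const u)]
    simp
  unfold partialDeriv
  rw [key, key]
  exact hsym.eq _ _

theorem Smooth.iterate_partialDeriv {f : E n → ℂ} (hf : Smooth f) (i : Fin n) (k : ℕ) :
    Smooth ((GFEM.partialDeriv i)^[k] f) := by
  induction k generalizing f with
  | zero => exact hf
  | succ k ih => exact ih (hf.partialDeriv i)

theorem iterate_partialDeriv_comm {f : E n → ℂ} (hf : Smooth f) (i j : Fin n) (k : ℕ) :
    (partialDeriv j)^[k] (partialDeriv i f) = partialDeriv i ((partialDeriv j)^[k] f) := by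
  induction k generalizing f with
  | zero => rfl
  | succ k ih =>
    rw [Function.iterate_succ_apply, Function.iterate_succ_apply, partialDeriv_comm hf,
      ih (hf.partialDeriv j)]

theorem smooth_foldr (l : List (Fin n)) (α : Fin n → ℕ) {f : E n → ℂ} (hf : Smooth f) :
    Smooth (l.foldr (fun i g => (partialDeriv i)^[α i] g) f) := by
  induction l with
  | nil => exact hf
  | cons a l ih => exact ih.iterate_partialDeriv _ _

theorem foldr_partialDeriv (l : List (Fin n)) (α : Fin n → ℕ) (i : Fin n) {f : E n → ℂ}
    (hf : Smooth f) :
    l.foldr (fun i g => (partialDeriv i)^[α i] g) (partialDeriv i f)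
      = partialDeriv i (l.foldr (fun i g => (partialDeriv i)^[α i] g) f) := by
  induction l with
  | nil => rfl
  | cons a l ih =>
    simp only [List.foldr_cons]
    rw [ih, iterate_partialDeriv_comm (smooth_foldr l α hf)]

/-- The extra derivative enters at the slot of `i` and is commuted outwards past the slots before
it. The `if` is there for the induction, in which the tail of the list may not contain `i`. -/
theorem foldr_add_single (l : List (Fin n)) (hl : l.Nodup) (α : Fin n → ℕ) (i : Fin n)
    {f : E n → ℂ} (hf : Smooth f) :
    l.foldr (fun j g => (partialDeriv j)^[(α + Pi.single i 1 : Fin n → ℕ) j] g) f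
      = if i ∈ l then partialDeriv i (l.foldr (fun i g => (partialDeriv i)^[α i] g) f)
        else l.foldr (fun i g => (partialDeriv i)^[α i] g) f := by
  induction l with
  | nil => simp
  | cons a l ih =>
    rw [List.nodup_cons] at hl
    simp only [List.foldr_cons]
    rw [ih hl.2]
    by_cases ha : i = a
    · subst ha
      simp only [hl.1, if_false, List.mem_cons_self, if_true, Pi.add_apply, Pi.single_eq_same]
      rw [Function.iterate_succ_apply']
    · have : (α + Pi.single i 1 : Fin n → ℕ) a = α a := by simp [Ne.symm ha]
      rw [this]
      by_cases hi : i ∈ l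
      · simp only [hi, if_true, List.mem_cons, or_true]
        rw [iterate_partialDeriv_comm (smooth_foldr l α hf)]
      · simp [hi, ha]

theorem Smooth.multiDeriv {f : E n → ℂ} (hf : Smooth f) (α : Fin n → ℕ) :
    Smooth (multiDeriv α f) := smooth_foldr _ _ hf

theorem multiDeriv_partialDeriv {f : E n → ℂ} (hf : Smooth f) (α : Fin n → ℕ) (i : Fin n) :
    multiDeriv α (partialDeriv i f) = partialDeriv i (multiDeriv α f) :=
  foldr_partialDeriv _ _ _ hf

theorem multiDeriv_add_single {f : E n → ℂ} (hf : Smooth f) (α : Fin n → ℕ) (i : Fin n) :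
    multiDeriv (α + Pi.single i 1) f = partialDeriv i (multiDeriv α f) := by
  unfold multiDeriv
  rw [foldr_add_single _ (List.nodup_finRange n) α i hf]
  simp

@[simp] theorem multiDeriv_zero (f : E n → ℂ) : multiDeriv 0 f = f := by
  unfold multiDeriv
  induction List.finRange n with
  | nil => rfl
  | cons a l ih => simp only [List.foldr_cons]; rw [ih]; rfl

/-! ### Test functions -/

theorem tsupport_partialDeriv_subset (i : Fin n) (f : E n → ℂ) :
    tsupport (partialDeriv i f) ⊆ tsupport f := by
  refine closure_minimal ?_ (isClosed_tsupport f)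
  intro x hx
  by_contra hc
  apply hx
  have : fderiv ℝ f x = 0 := by
    by_contra h
    exact hc (support_fderiv_subset ℝ (f := f) h)
  simp [partialDeriv, this]

namespace IsTestFunction

variable {Ω Ω' : Set (E n)} {ψ : E n → ℂ}

theorem smooth (h : IsTestFunction Ω ψ) : Smooth ψ := h.1

theorem continuous (h : IsTestFunction Ω ψ) : Continuous ψ := h.1.continuous

theorem hasCompactSupport (h : IsTestFunction Ω ψ) : HasCompactSupport ψ := h.2.1

theorem eq_zero (h : IsTestFunction Ω ψ) {x : E n} (hx : x ∉ Ω) : ψ x = 0 :=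
  image_eq_zero_of_notMem_tsupport fun hc => hx (h.2.2 hc)

theorem mono (h : IsTestFunction Ω ψ) (hΩ : Ω ⊆ Ω') : IsTestFunction Ω' ψ :=
  ⟨h.1, h.2.1, h.2.2.trans hΩ⟩

theorem partialDeriv (h : IsTestFunction Ω ψ) (i : Fin n) :
    IsTestFunction Ω (partialDeriv i ψ) :=
  ⟨Smooth.partialDeriv h.1 i, h.2.1.of_isClosed_subset (isClosed_tsupport _)
    (tsupport_partialDeriv_subset i ψ), (tsupport_partialDeriv_subset i ψ).trans h.2.2⟩

theorem multiDeriv (h : IsTestFunction Ω ψ) (α : Fin n → ℕ) :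
    IsTestFunction Ω (multiDeriv α ψ) := by
  induction α using multiIndex_induction with
  | h0 => simpa using h
  | hs α i ih => rw [multiDeriv_add_single h.1]; exact ih.partialDeriv i

/-- The product of a test function with a smooth function. -/
theorem smooth_mul (h : IsTestFunction Ω ψ) {f : E n → ℂ} (hf : Smooth f) :
    IsTestFunction Ω (fun x => f x * ψ x) :=
  ⟨hf.mul h.1, h.2.1.mul_left, (tsupport_mul_subset_right).trans h.2.2⟩

theorem smooth_mul_of_subset {f : E n → ℂ} (hf : Smooth f) (hψ : Smooth ψ)
    (hc : HasCompactSupport ψ) (hs : tsupport f ∩ tsupport ψ ⊆ Ω) :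
    IsTestFunction Ω (fun x => f x * ψ x) :=
  ⟨hf.mul hψ, hc.mul_left,
    (subset_inter tsupport_mul_subset_left tsupport_mul_subset_right).trans hs⟩

theorem bounded (h : IsTestFunction Ω ψ) : ∃ C, 0 ≤ C ∧ ∀ x, ‖ψ x‖ ≤ C := by
  obtain ⟨C, hC⟩ := h.hasCompactSupport.exists_bound_of_continuous h.continuous
  exact ⟨C, (norm_nonneg _).trans (hC 0), hC⟩

theorem memLp (h : IsTestFunction Ω ψ) (p : ℝ≥0∞) : MemLp ψ p volume :=
  h.continuous.memLp_of_hasCompactSupport h.hasCompactSupport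

/-- Integrability against a test function supported in a set of local integrability. -/
theorem integrable_mul (h : IsTestFunction Ω ψ) {f : E n → ℂ}
    (hf : LocallyIntegrableOn f Ω volume) : Integrable (fun x => f x * ψ x) := by
  have h1 : IntegrableOn f (tsupport ψ) volume :=
    hf.integrableOn_compact_subset h.2.2 h.hasCompactSupport
  have h2 : IntegrableOn (fun x => f x * ψ x) (tsupport ψ) volume := by
    obtain ⟨C, -, hC⟩ := h.bounded
    exact h1.mul_bdd h.continuous.aestronglyMeasurable (Eventually.of_forall hC)
  refine (integrableOn_iff_integrable_of_support_subset ?_).1 h2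
  intro x hx
  exact subset_tsupport ψ (right_ne_zero_of_mul hx)

end IsTestFunction

theorem partialDeriv_mul {f g : E n → ℂ} (hf : Smooth f) (hg : Smooth g) (i : Fin n) (x : E n) :
    partialDeriv i (fun y => f y * g y) x
      = partialDeriv i f x * g x + f x * partialDeriv i g x := by
  unfold partialDeriv
  rw [fderiv_fun_mul (hf.differentiable x) (hg.differentiable x)]
  simp
  ring

theorem partialDeriv_congr {f g : E n → ℂ} {x : E n} (h : f =ᶠ[𝓝 x] g) (i : Fin n) :
    partialDeriv i f x = partialDeriv i g x := by
  unfold partialDeriv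
  rw [h.fderiv_eq]

/-- Smooth cut-off functions for a compact subset of an open set. -/
theorem exists_cutoff {K U : Set (E n)} (hK : IsCompact K) (hU : IsOpen U) (hKU : K ⊆ U) :
    ∃ χ : E n → ℂ, IsTestFunction U χ ∧ (∀ᶠ x in 𝓝ˢ K, χ x = 1) ∧ ∀ x, ‖χ x‖ ≤ 1 := by
  obtain ⟨L, hL, hKL, hLU⟩ := exists_compact_between hK hU hKU
  obtain ⟨f, hf1, hf2, hf3⟩ := exists_contMDiffMap_one_nhds_of_subset_interior
    (n := (⊤ : ℕ∞)) (modelWithCornersSelf ℝ (E n)) hK.isClosed hKL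
  refine ⟨fun x => ((f x : ℝ) : ℂ), ⟨?_, ?_, ?_⟩, ?_, ?_⟩
  · exact Complex.ofRealCLM.contDiff.comp f.contMDiff.contDiff
  · refine HasCompactSupport.intro hL fun x hx => by simp [hf2 x hx]
  · refine (closure_minimal ?_ hL.isClosed).trans hLU
    intro x hx
    by_contra hc
    exact hx (by simp [hf2 x hc])
  · filter_upwards [hf1] with x hx
    simp [hx]
  · intro x
    have := hf3 x
    simp only [Complex.norm_real, Real.norm_eq_abs]
    rw [abs_of_nonneg this.1]
    exact this.2

/-! ### Squared `L²` norms -/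

/-- `‖f‖²_{L²(V)}`. -/
noncomputable def sqNorm (V : Set (E n)) (f : E n → ℂ) : ℝ≥0∞ := ∫⁻ x in V, ‖f x‖ₑ ^ 2

theorem sq_lt_top_iff {x : ℝ≥0∞} : x ^ 2 < ∞ ↔ x < ∞ := by simp [ENNReal.pow_lt_top_iff]

theorem sqNorm_eq_eLpNorm (V : Set (E n)) (f : E n → ℂ) :
    eLpNorm f 2 (volume.restrict V) ^ 2 = sqNorm V f := by
  rw [eLpNorm_eq_lintegral_rpow_enorm_toReal (by simp) (by simp), sqNorm]
  simp only [ENNReal.toReal_ofNat, ENNReal.rpow_ofNat]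
  rw [← ENNReal.rpow_natCast, ← ENNReal.rpow_mul]
  norm_num

theorem sqNorm_mono_set {U V : Set (E n)} (h : U ⊆ V) (f : E n → ℂ) :
    sqNorm U f ≤ sqNorm V f := lintegral_mono_set h

theorem sqNorm_congr {V : Set (E n)} {f g : E n → ℂ} (h : f =ᵐ[volume.restrict V] g) :
    sqNorm V f = sqNorm V g :=
  lintegral_congr_ae (h.mono fun x hx => by simp only [hx])

theorem sqNorm_congr_on {V : Set (E n)} (hV : MeasurableSet V) {f g : E n → ℂ}
    (h : ∀ x ∈ V, f x = g x) : sqNorm V f = sqNorm V g :=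
  setLIntegral_congr_fun hV fun x hx => by simp only [h x hx]

theorem sqNorm_finset_sum_le {ι : Type*} (s : Finset ι) (V : Set (E n)) (f : ι → E n → ℂ)
    (hf : ∀ i ∈ s, AEMeasurable (f i) (volume.restrict V)) :
    sqNorm V (fun x => ∑ i ∈ s, f i x) ≤ s.card * ∑ i ∈ s, sqNorm V (f i) := by
  unfold sqNorm
  rw [← lintegral_finsetSum' _ (fun i hi => ((hf i hi).enorm.pow_const 2)),
    ← lintegral_const_mul' _ _ (by simp)]
  refine lintegral_mono fun x => ?_
  calc ‖∑ i ∈ s, f i x‖ₑ ^ 2 ≤ (∑ i ∈ s, ‖f i x‖ₑ) ^ 2 := by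
        gcongr; exact enorm_sum_le _ _
    _ ≤ s.card * ∑ i ∈ s, ‖f i x‖ₑ ^ 2 := by
        simp only [enorm_eq_nnnorm]
        exact_mod_cast sq_sum_le_card_mul_sum_sq (s := s) (f := fun i => ‖f i x‖₊)

theorem enorm_add_sq_le (a b : ℂ) : ‖a + b‖ₑ ^ 2 ≤ 2 * (‖a‖ₑ ^ 2 + ‖b‖ₑ ^ 2) := by
  have h1 : ‖a + b‖ ^ 2 ≤ 2 * (‖a‖ ^ 2 + ‖b‖ ^ 2) := by
    nlinarith [norm_add_le a b, norm_nonneg (a + b), norm_nonneg a, norm_nonneg b,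
      sq_nonneg (‖a‖ - ‖b‖)]
  simp only [enorm_eq_nnnorm]
  have h2 : ‖a + b‖₊ ^ 2 ≤ 2 * (‖a‖₊ ^ 2 + ‖b‖₊ ^ 2) := by exact_mod_cast h1
  exact_mod_cast h2

theorem sqNorm_add_le {V : Set (E n)} {f g : E n → ℂ} (hf : Measurable f) :
    sqNorm V (fun x => f x + g x) ≤ 2 * (sqNorm V f + sqNorm V g) := by
  unfold sqNorm
  rw [← lintegral_add_left (hf.enorm.pow_const 2), ← lintegral_const_mul' _ _ (by simp)]
  exact lintegral_mono fun x => enorm_add_sq_le _ _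

theorem sqNorm_neg (V : Set (E n)) (f : E n → ℂ) :
    sqNorm V (fun x => - f x) = sqNorm V f := by simp [sqNorm]

theorem sqNorm_sub_le {V : Set (E n)} {f g : E n → ℂ} (hf : Measurable f) :
    sqNorm V (fun x => f x - g x) ≤ 2 * (sqNorm V f + sqNorm V g) := by
  simp only [sub_eq_add_neg]
  rw [← sqNorm_neg V g]
  exact sqNorm_add_le hf

theorem sqNorm_const_mul (V : Set (E n)) (c : ℂ) (f : E n → ℂ) :
    sqNorm V (fun x => c * f x) = ‖c‖ₑ ^ 2 * sqNorm V f := by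
  unfold sqNorm
  rw [← lintegral_const_mul' _ _ (by simp)]
  simp [enorm_mul, mul_pow]

theorem sqNorm_lt_top {V : Set (E n)} {f : E n → ℂ} (hf : MemLp f 2 (volume.restrict V)) :
    sqNorm V f < ∞ := by
  rw [← sqNorm_eq_eLpNorm]
  exact ENNReal.pow_lt_top hf.2

theorem sqNorm_indicator {U V : Set (E n)} (hU : MeasurableSet U) (hUV : U ⊆ V) (f : E n → ℂ) :
    sqNorm V (U.indicator f) = sqNorm U f := by
  unfold sqNorm
  have : ∀ x, ‖U.indicator f x‖ₑ ^ 2 = U.indicator (fun x => ‖f x‖ₑ ^ 2) x := by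
    intro x
    by_cases hx : x ∈ U <;> simp [hx]
  simp only [this]
  rw [lintegral_indicator hU, Measure.restrict_restrict_of_subset hUV]

theorem sqNorm_univ_of_zero {V : Set (E n)} (hV : MeasurableSet V) {f : E n → ℂ}
    (hf : ∀ x, x ∉ V → f x = 0) : sqNorm univ f = sqNorm V f := by
  have : f = V.indicator f := by
    funext x
    by_cases hx : x ∈ V
    · simp [hx]
    · simp [hx, hf x hx]
  rw [this, sqNorm_indicator hV (subset_univ V), ← this]

/-! ### Weak derivatives -/

theorem locallyIntegrableOn_congr {V : Set (E n)} {f g : E n → ℂ}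
    (hf : LocallyIntegrableOn f V volume) (h : f =ᵐ[volume.restrict V] g) :
    LocallyIntegrableOn g V volume := by
  intro x hx
  obtain ⟨s, hs, hfs⟩ := hf x hx
  refine ⟨s ∩ V, inter_mem hs self_mem_nhdsWithin, ?_⟩
  refine (hfs.mono_set inter_subset_left).congr_fun_ae ?_
  exact ae_restrict_of_ae_restrict_of_subset inter_subset_right h

/-- A locally integrable function is determined by its integrals against test functions. -/
theorem ae_eq_of_forall_test {V : Set (E n)} (hV : IsOpen V) {f g : E n → ℂ}
    (hf : LocallyIntegrableOn f V volume) (hg : LocallyIntegrableOn g V volume)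
    (h : ∀ ψ, IsTestFunction V ψ → ∫ x, f x * ψ x = ∫ x, g x * ψ x) :
    f =ᵐ[volume.restrict V] g := by
  have := hV.ae_eq_zero_of_integral_contDiff_smul_eq_zero (hf.sub hg) (μ := volume) ?_
  · rw [Filter.EventuallyEq, ae_restrict_iff' hV.measurableSet]
    filter_upwards [this] with x hx hxV
    exact sub_eq_zero.1 (hx hxV)
  · intro φ h1 h2 h3
    have hψ : IsTestFunction V (fun x => (φ x : ℂ)) := by
      refine ⟨Complex.ofRealCLM.contDiff.comp h1, h2.comp_left Complex.ofReal_zero, ?_⟩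
      refine (closure_mono ?_).trans h3
      intro x hx hc
      exact hx (by simp [hc])
    have h4 := h _ hψ
    have h5 : ∀ x, φ x • (f - g) x = f x * (φ x : ℂ) - g x * (φ x : ℂ) := by
      intro x
      simp only [Pi.sub_apply, Complex.real_smul]
      ring
    simp only [h5]
    rw [integral_sub (hψ.integrable_mul hf) (hψ.integrable_mul hg), h4, sub_self]

theorem IsTestFunction.setIntegral_eq {V : Set (E n)} {ψ : E n → ℂ} (h : IsTestFunction V ψ)
    (f : E n → ℂ) : ∫ x in V, f x * ψ x = ∫ x, f x * ψ x :=
  setIntegral_eq_integral_of_forall_compl_eq_zero fun x hx => by rw [h.eq_zero hx, mul_zero]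

/-- `g` is the weak partial derivative `∂ᵢ f` on `V`, integrability aside. -/
def WD (i : Fin n) (V : Set (E n)) (f g : E n → ℂ) : Prop :=
  ∀ ψ, IsTestFunction V ψ → ∫ x, f x * partialDeriv i ψ x = - ∫ x, g x * ψ x

theorem WD.mono {i : Fin n} {U V : Set (E n)} {f g : E n → ℂ} (h : WD i V f g) (hUV : U ⊆ V) :
    WD i U f g := fun ψ hψ => h ψ (hψ.mono hUV)

theorem IsTestFunction.integral_congr {V : Set (E n)} {ψ : E n → ℂ}
    (h : IsTestFunction V ψ) {f g : E n → ℂ} (hfg : f =ᵐ[volume.restrict V] g) :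
    ∫ x, f x * ψ x = ∫ x, g x * ψ x := by
  rw [← h.setIntegral_eq, ← h.setIntegral_eq]
  exact integral_congr_ae (hfg.mono fun x hx => by simp only [hx])

theorem WD.congr {i : Fin n} {V : Set (E n)} {f g f' g' : E n → ℂ}
    (h : WD i V f g) (hf : f =ᵐ[volume.restrict V] f') (hg : g =ᵐ[volume.restrict V] g') :
    WD i V f' g' := by
  intro ψ hψ
  rw [← hψ.integral_congr hg, ← (hψ.partialDeriv i).integral_congr hf]
  exact h ψ hψ

theorem smooth_WD {f : E n → ℂ} (hf : Smooth f) (i : Fin n) (V : Set (E n)) :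
    WD i V f (partialDeriv i f) := by
  intro ψ hψ
  have hf' := hf.partialDeriv i
  have hψ' := hψ.partialDeriv i
  exact integral_mul_fderiv_eq_neg_fderiv_mul_of_integrable
    ((hψ.integrable_mul (hf'.continuous.locallyIntegrable.locallyIntegrableOn _)))
    ((hψ'.integrable_mul (hf.continuous.locallyIntegrable.locallyIntegrableOn _)))
    ((hψ.integrable_mul (hf.continuous.locallyIntegrable.locallyIntegrableOn _)))
    (fun x _ => hf.differentiable x) (fun x _ => hψ.smooth.differentiable x)

theorem HasWeakDeriv.congr {α : Fin n → ℕ} {V : Set (E n)}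
    {u v u' v' : E n → ℂ} (h : HasWeakDeriv α V u v) (hu : u =ᵐ[volume.restrict V] u')
    (hv : v =ᵐ[volume.restrict V] v') : HasWeakDeriv α V u' v' := by
  refine ⟨locallyIntegrableOn_congr h.1 hu, locallyIntegrableOn_congr h.2.1 hv, ?_⟩
  intro ψ hψ
  have := h.2.2 ψ hψ
  rw [(hψ.multiDeriv α).setIntegral_eq, hψ.setIntegral_eq] at this ⊢
  rw [← hψ.integral_congr hv, ← (hψ.multiDeriv α).integral_congr hu]
  exact this

theorem HasWeakDeriv.integral_eq {α : Fin n → ℕ} {V : Set (E n)} {u v : E n → ℂ}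
    (h : HasWeakDeriv α V u v) {ψ : E n → ℂ} (hψ : IsTestFunction V ψ) :
    ∫ x, u x * multiDeriv α ψ x = (-1) ^ deg α * ∫ x, v x * ψ x := by
  rw [← (hψ.multiDeriv α).setIntegral_eq, ← hψ.setIntegral_eq]
  exact h.2.2 ψ hψ

theorem HasWeakDeriv.unique {α : Fin n → ℕ} {V : Set (E n)} (hV : IsOpen V)
    {u v v' : E n → ℂ} (h : HasWeakDeriv α V u v) (h' : HasWeakDeriv α V u v') :
    v =ᵐ[volume.restrict V] v' := by
  refine ae_eq_of_forall_test hV h.2.1 h'.2.1 fun ψ hψ => ?_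
  have h1 := h.integral_eq hψ
  rw [h'.integral_eq hψ] at h1
  exact (mul_left_cancel₀ (pow_ne_zero _ (by norm_num)) h1).symm

theorem HasWeakDeriv.eq_of_zero {V : Set (E n)} (hV : IsOpen V)
    {u v : E n → ℂ} (h : HasWeakDeriv 0 V u v) : v =ᵐ[volume.restrict V] u := by
  refine h.unique hV ⟨h.1, h.1, fun ψ _ => by simp⟩

/-- Uniqueness of weak derivatives makes the infimum run over a single value. -/
theorem weakDerivNorm_eq {p : ℝ≥0∞} {α : Fin n → ℕ} {V : Set (E n)} (hV : IsOpen V)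
    {u v : E n → ℂ} (h : HasWeakDeriv α V u v) :
    weakDerivNorm p α V u = eLpNorm v p (volume.restrict V) := by
  refine le_antisymm (iInf₂_le v h) (le_iInf₂ fun v' h' => ?_)
  rw [eLpNorm_congr_ae (h.unique hV h')]

theorem exists_of_weakDerivNorm_lt_top {p : ℝ≥0∞} {α : Fin n → ℕ} {V : Set (E n)}
    {u : E n → ℂ} (h : weakDerivNorm p α V u < ∞) :
    ∃ v, HasWeakDeriv α V u v ∧ eLpNorm v p (volume.restrict V) < ∞ := by
  obtain ⟨v, hv⟩ := iInf_lt_iff.1 h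
  obtain ⟨hv1, hv2⟩ := iInf_lt_iff.1 hv
  exact ⟨v, hv1, hv2⟩

/-- A weak derivative of a weak derivative. -/
theorem HasWeakDeriv.wd {α : Fin n → ℕ} {i : Fin n} {V : Set (E n)} {u v v' : E n → ℂ}
    (h : HasWeakDeriv α V u v) (h' : HasWeakDeriv (α + Pi.single i 1) V u v') : WD i V v v' := by
  intro ψ hψ
  have h1 := h.integral_eq (hψ.partialDeriv i)
  have h2 := h'.integral_eq hψ
  rw [multiDeriv_add_single hψ.smooth, ← multiDeriv_partialDeriv hψ.smooth, h1,
    deg_add_single, pow_succ, mul_assoc] at h2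
  have := mul_left_cancel₀ (pow_ne_zero _ (by norm_num)) h2
  rw [this]
  ring

/-- Here the first-order derivative is taken last; this is the step that turns the first-order
relations inside a jet into weak derivatives of all its orders. -/
theorem HasWeakDeriv.of_wd {α : Fin n → ℕ} {i : Fin n} {V : Set (E n)} {u v v' : E n → ℂ}
    (h : HasWeakDeriv α V u v) (h' : WD i V v v') (hv' : LocallyIntegrableOn v' V volume) :
    HasWeakDeriv (α + Pi.single i 1) V u v' := by
  refine ⟨h.1, hv', fun ψ hψ => ?_⟩
  rw [(hψ.multiDeriv _).setIntegral_eq, hψ.setIntegral_eq, multiDeriv_add_single hψ.smooth,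
    ← multiDeriv_partialDeriv hψ.smooth, h.integral_eq (hψ.partialDeriv i), h' ψ hψ]
  change _ = (-1) ^ deg (α + Pi.single i 1) * _
  rw [deg_add_single, pow_succ]
  ring

/-- Composition of weak derivatives, with a first-order derivative first. -/
theorem HasWeakDeriv.comp {α : Fin n → ℕ} {i : Fin n} {V : Set (E n)} {u v v' : E n → ℂ}
    (hu : LocallyIntegrableOn u V volume) (h : WD i V u v) (h' : HasWeakDeriv α V v v') :
    HasWeakDeriv (α + Pi.single i 1) V u v' := by
  refine ⟨hu, h'.2.1, fun ψ hψ => ?_⟩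
  rw [(hψ.multiDeriv _).setIntegral_eq, hψ.setIntegral_eq, multiDeriv_add_single hψ.smooth,
    h _ (hψ.multiDeriv α), h'.integral_eq hψ]
  change _ = (-1) ^ deg (α + Pi.single i 1) * _
  rw [deg_add_single, pow_succ]
  ring

/-! ### Jets -/

/-- `f α`, for `|α| ≤ k`, are the weak derivatives `∂^α (f 0) ∈ L²(V)`, extended by zero. -/
structure Jet (k : ℕ) (V : Set (E n)) (f : (Fin n → ℕ) → E n → ℂ) : Prop where
  meas : ∀ α, Measurable (f α)
  zero : ∀ α x, x ∉ V → f α x = 0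
  memLp : ∀ α, deg α ≤ k → MemLp (f α) 2 volume
  deriv : ∀ α i, deg α < k → WD i V (f α) (f (α + Pi.single i 1))

namespace Jet

variable {k : ℕ} {U V : Set (E n)} {f g : (Fin n → ℕ) → E n → ℂ}

theorem locallyIntegrable (h : Jet k V f) {α : Fin n → ℕ} (hα : deg α ≤ k) :
    LocallyIntegrable (f α) volume :=
  (h.memLp α hα).locallyIntegrable (by norm_num)

theorem locallyIntegrableOn (h : Jet k V f) {α : Fin n → ℕ} (hα : deg α ≤ k) (U : Set (E n)) :
    LocallyIntegrableOn (f α) U volume := (h.locallyIntegrable hα).locallyIntegrableOn U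

theorem mono_order (h : Jet k V f) {l : ℕ} (hl : l ≤ k) : Jet l V f :=
  ⟨h.meas, h.zero, fun α hα => h.memLp α (hα.trans hl), fun α i hα => h.deriv α i (by omega)⟩

theorem shift (h : Jet (k + 1) V f) (i : Fin n) : Jet k V (fun α => f (α + Pi.single i 1)) := by
  refine ⟨fun α => h.meas _, fun α => h.zero _, fun α hα => h.memLp _ ?_, fun α j hα => ?_⟩
  · rw [deg_add_single]; omega
  · have := h.deriv (α + Pi.single i 1) j (by rw [deg_add_single]; omega)
    rwa [add_right_comm] at this

theorem hasWeakDeriv (h : Jet k V f) {α : Fin n → ℕ} (hα : deg α ≤ k) :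
    HasWeakDeriv α V (f 0) (f α) := by
  induction α using multiIndex_induction with
  | h0 =>
    exact ⟨h.locallyIntegrableOn (by simp) V, h.locallyIntegrableOn (by simp) V,
      fun ψ _ => by simp⟩
  | hs α i ih =>
    have hα' := hα
    rw [deg_add_single] at hα
    exact (ih (by omega)).of_wd (h.deriv α i (by omega)) (h.locallyIntegrableOn hα' V)

/-- Entry `0` determines the others almost everywhere, so later identities between jets need to be
checked for function values only. -/
theorem unique (hV : IsOpen V) (hf : Jet k V f) (hg : Jet k V g)
    (h0 : f 0 =ᵐ[volume.restrict V] g 0) {α : Fin n → ℕ} (hα : deg α ≤ k) :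
    f α =ᵐ[volume.restrict V] g α :=
  ((hf.hasWeakDeriv hα).congr h0 (ae_eq_refl _)).unique hV (hg.hasWeakDeriv hα)

theorem restrict (hf : Jet k V f) (hU : IsOpen U) (hUV : U ⊆ V) :
    Jet k U (fun α => U.indicator (f α)) := by
  refine ⟨fun α => (hf.meas α).indicator hU.measurableSet, fun α x hx => by simp [hx],
    fun α hα => (hf.memLp α hα).indicator hU.measurableSet, fun α i hα => ?_⟩
  refine ((hf.deriv α i hα).mono hUV).congr ?_ ?_ <;>
  · exact (indicator_ae_eq_restrict hU.measurableSet).symm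

theorem zero_jet (k : ℕ) (V : Set (E n)) : Jet k V (fun _ _ => 0) :=
  ⟨fun _ => measurable_const, fun _ _ _ => rfl, fun _ _ => MemLp.zero, fun _ _ _ ψ _ => by simp⟩

theorem add (hf : Jet k V f) (hg : Jet k V g) : Jet k V (fun α x => f α x + g α x) := by
  refine ⟨fun α => (hf.meas α).add (hg.meas α), fun α x hx => by
    simp [hf.zero α x hx, hg.zero α x hx],
    fun α hα => (hf.memLp α hα).add (hg.memLp α hα), fun α i hα ψ hψ => ?_⟩
  have hα' : deg (α + Pi.single i 1) ≤ k := by rw [deg_add_single]; omega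
  simp only [add_mul]
  rw [integral_add ((hψ.partialDeriv i).integrable_mul (hf.locallyIntegrableOn hα.le V))
      ((hψ.partialDeriv i).integrable_mul (hg.locallyIntegrableOn hα.le V)),
    integral_add (hψ.integrable_mul (hf.locallyIntegrableOn hα' V))
      (hψ.integrable_mul (hg.locallyIntegrableOn hα' V)), hf.deriv α i hα ψ hψ,
    hg.deriv α i hα ψ hψ]
  ring

theorem const_mul (hf : Jet k V f) (c : ℂ) : Jet k V (fun α x => c * f α x) := by
  refine ⟨fun α => (hf.meas α).const_mul c, fun α x hx => by simp [hf.zero α x hx],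
    fun α hα => (hf.memLp α hα).const_mul c, fun α i hα ψ hψ => ?_⟩
  simp only [mul_assoc]
  rw [integral_const_mul, integral_const_mul, hf.deriv α i hα ψ hψ]
  ring

theorem sub (hf : Jet k V f) (hg : Jet k V g) : Jet k V (fun α x => f α x - g α x) := by
  simpa [sub_eq_add_neg] using hf.add (hg.const_mul (-1))

theorem sum {ι : Type*} (s : Finset ι) {F : ι → (Fin n → ℕ) → E n → ℂ}
    (hF : ∀ i ∈ s, Jet k V (F i)) : Jet k V (fun α x => ∑ i ∈ s, F i α x) := by
  classical
  induction s using Finset.induction_on with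
  | empty => simpa using zero_jet k V
  | insert a s ha ih =>
    simp only [Finset.sum_insert ha]
    exact (hF a (by simp)).add (ih fun i hi => hF i (by simp [hi]))

theorem sqNorm_lt_top (hf : Jet k V f) {α : Fin n → ℕ} (hα : deg α ≤ k) (U : Set (E n)) :
    sqNorm U (f α) < ∞ :=
  GFEM.sqNorm_lt_top ((hf.memLp α hα).mono_measure Measure.restrict_le_self)

theorem weakDerivNorm_sq (hV : IsOpen V) (hf : Jet k V f) {u : E n → ℂ}
    (hu : f 0 =ᵐ[volume.restrict V] u) {α : Fin n → ℕ} (hα : deg α ≤ k) :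
    weakDerivNorm 2 α V u ^ 2 = sqNorm V (f α) := by
  rw [weakDerivNorm_eq hV ((hf.hasWeakDeriv hα).congr hu (ae_eq_refl _)),
    sqNorm_eq_eLpNorm]

/-- The bridge between the infimum-based Sobolev norm of the statement and plain integrals. -/
theorem sobolevNorm_sq (hV : IsOpen V) (hf : Jet k V f) {u : E n → ℂ}
    (hu : f 0 =ᵐ[volume.restrict V] u) {j : ℕ} (hj : j ≤ k) :
    sobolevNorm j V u ^ 2 = ∑ α ∈ multiIndices n j, sqNorm V (f α) := by
  unfold sobolevNorm
  rw [← ENNReal.rpow_natCast, ← ENNReal.rpow_mul]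
  norm_num
  exact Finset.sum_congr rfl fun α hα =>
    hf.weakDerivNorm_sq hV hu ((mem_multiIndices.1 hα).trans hj)

theorem memSobolev (hV : IsOpen V) (hf : Jet k V f) {u : E n → ℂ}
    (hu : f 0 =ᵐ[volume.restrict V] u) {j : ℕ} (hj : j ≤ k) : MemSobolev j V u := by
  unfold MemSobolev
  rw [← sq_lt_top_iff, hf.sobolevNorm_sq hV hu hj,
    ENNReal.sum_lt_top]
  exact fun α hα => hf.sqNorm_lt_top ((mem_multiIndices.1 hα).trans hj) V

end Jet

/-- A function with all weak derivatives of order at most `k` in `L²` comes from a jet. -/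
theorem exists_jet_of_hasWeakDeriv {k : ℕ} {V : Set (E n)} (hV : IsOpen V) {u : E n → ℂ}
    (v : (Fin n → ℕ) → E n → ℂ) (hv : ∀ α, deg α ≤ k → HasWeakDeriv α V u (v α))
    (hv2 : ∀ α, deg α ≤ k → eLpNorm (v α) 2 (volume.restrict V) < ∞) :
    ∃ f, Jet k V f ∧ f 0 =ᵐ[volume.restrict V] u ∧
      ∀ α, deg α ≤ k → f α =ᵐ[volume.restrict V] v α := by
  classical
  have hm : ∀ α, deg α ≤ k → AEStronglyMeasurable (v α) (volume.restrict V) := fun α hα =>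
    (hv α hα).2.1.aestronglyMeasurable
  -- Measurable representatives, cut off to V. Beyond order `k` a jet carries no information, and
  -- the default is 0.
  let f : (Fin n → ℕ) → E n → ℂ := fun α =>
    if h : deg α ≤ k then V.indicator ((hm α h).mk (v α)) else 0
  have hfm : ∀ α, Measurable (f α) := by
    intro α
    by_cases h : deg α ≤ k
    · simp only [f, h, dif_pos]
      exact (hm α h).stronglyMeasurable_mk.measurable.indicator hV.measurableSet
    · simp only [f, h, dif_neg, not_false_eq_true]
      exact measurable_zero
  have hfv : ∀ α, deg α ≤ k → f α =ᵐ[volume.restrict V] v α := by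
    intro α h
    simp only [f, h, dif_pos]
    exact (indicator_ae_eq_restrict hV.measurableSet).trans (hm α h).ae_eq_mk.symm
  have hfz : ∀ α x, x ∉ V → f α x = 0 := by
    intro α x hx
    by_cases h : deg α ≤ k <;> simp [f, h, hx]
  refine ⟨f, ⟨hfm, hfz, ?_, ?_⟩, ?_, hfv⟩
  · intro α h
    have : f α = V.indicator (f α) := by
      funext x
      by_cases hx : x ∈ V
      · simp [hx]
      · simp [hx, hfz α x hx]
    rw [this, memLp_indicator_iff_restrict hV.measurableSet]
    exact ⟨(hfm α).aestronglyMeasurable, by rw [eLpNorm_congr_ae (hfv α h)]; exact hv2 α h⟩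
  · intro α i h
    have h' : deg (α + Pi.single i 1) ≤ k := by rw [deg_add_single]; omega
    exact ((hv α h.le).wd (hv _ h')).congr (hfv α h.le).symm (hfv _ h').symm
  · exact (hfv 0 (by simp)).trans ((hv 0 (by simp)).eq_of_zero hV)

theorem MemSobolev.exists_jet {k : ℕ} {V : Set (E n)} (hV : IsOpen V) {u : E n → ℂ}
    (hu : MemSobolev k V u) : ∃ f, Jet k V f ∧ f 0 =ᵐ[volume.restrict V] u := by
  have h1 : ∀ α, deg α ≤ k → weakDerivNorm 2 α V u < ∞ := by
    intro α hα
    unfold MemSobolev sobolevNorm at hu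
    have h2 := (ENNReal.rpow_lt_top_iff_of_pos (by norm_num)).1 hu
    have h3 := (ENNReal.sum_lt_top.1 h2) α (mem_multiIndices.2 hα)
    exact sq_lt_top_iff.1 h3
  choose! v hv hv2 using fun α (hα : deg α ≤ k) => exists_of_weakDerivNorm_lt_top (h1 α hα)
  obtain ⟨f, hf, hf0, -⟩ := exists_jet_of_hasWeakDeriv hV v hv hv2
  exact ⟨f, hf, hf0⟩

/-! ### Convolution with smooth kernels -/

/-- The convolution of `F` with the kernel `k`. -/
noncomputable def cv (F k : E n → ℂ) (y : E n) : ℂ := ∫ t, F t * k (y - t)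

theorem cv_eq_convolution (F k : E n → ℂ) :
    cv F k = convolution F k (ContinuousLinearMap.mul ℝ ℂ) volume := rfl

theorem cv_smooth {F k : E n → ℂ} (hF : LocallyIntegrable F volume) (hk : Smooth k)
    (hc : HasCompactSupport k) : Smooth (cv F k) := by
  rw [cv_eq_convolution]
  exact hc.contDiff_convolution_right _ hF hk

theorem partialDeriv_cv {F k : E n → ℂ} (hF : LocallyIntegrable F volume) (hk : Smooth k)
    (hc : HasCompactSupport k) (i : Fin n) :
    partialDeriv i (cv F k) = cv F (partialDeriv i k) := by
  funext y
  have h := hc.hasFDerivAt_convolution_right (ContinuousLinearMap.mul ℝ ℂ) hF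
    (hk.of_le (by exact_mod_cast le_top)) y
  have hk' : Smooth k := hk
  rw [← cv_eq_convolution] at h
  unfold partialDeriv
  rw [h.fderiv, convolution_precompR_apply]
  · rfl
  · exact hF
  · exact hc.fderiv ℝ
  · exact hk.continuous_fderiv (by simp)

/-- The value `cv F k y` is the pairing of F with t ↦ k (y - t). If y - supp k stays inside V, this
is a test function on V, and a weak derivative valid only on V can be used. -/
theorem isTestFunction_reflect {k : E n → ℂ} (hk : Smooth k)
    (hc : HasCompactSupport k) {V : Set (E n)} {y : E n}
    (hV : ∀ x ∈ tsupport k, y - x ∈ V) : IsTestFunction V (fun t => k (y - t)) := by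
  refine ⟨hk.comp (contDiff_const.sub contDiff_id),
    hc.comp_homeomorph (Homeomorph.subLeft y), ?_⟩
  intro t ht
  have : t ∈ (fun t => y - t) ⁻¹' tsupport k := by
    refine closure_minimal ?_ ((isClosed_tsupport k).preimage (by fun_prop)) ht
    intro s hs
    exact subset_tsupport k hs
  simpa using hV _ this

theorem partialDeriv_reflect {k : E n → ℂ} (hk : Smooth k) (i : Fin n) (y t : E n) :
    partialDeriv i (fun t => k (y - t)) t = - partialDeriv i k (y - t) := by
  unfold partialDeriv
  have h1 : HasFDerivAt (fun t : E n => y - t) (-ContinuousLinearMap.id ℝ (E n)) t := by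
    simpa using (hasFDerivAt_id t).const_sub y
  have h2 := ((hk.differentiable (y - t)).hasFDerivAt).comp t h1
  rw [show (fun t => k (y - t)) = k ∘ fun t => y - t from rfl, h2.fderiv]
  simp

/-- A weak derivative may be moved from the kernel to the function. -/
theorem WD.cv_eq {i : Fin n} {V : Set (E n)} {F F' k : E n → ℂ} (h : WD i V F F')
    (hk : Smooth k) {y : E n} (hy : IsTestFunction V (fun t => k (y - t))) :
    cv F (partialDeriv i k) y = cv F' k y := by
  have := h _ hy
  simp only [partialDeriv_reflect hk, mul_neg, integral_neg, neg_inj] at this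
  exact this

theorem norm_cv_le {F k : E n → ℂ} {M : ℝ} (hF : ∀ᵐ x ∂(volume : Measure (E n)), ‖F x‖ ≤ M)
    (hk : Integrable k) (y : E n) : ‖cv F k y‖ ≤ M * ∫ x, ‖k x‖ := by
  have h1 : ∫ t, M * ‖k (y - t)‖ = M * ∫ x, ‖k x‖ := by
    rw [integral_const_mul, integral_sub_left_eq_self (fun x => ‖k x‖)]
  rw [← h1]
  refine norm_integral_le_of_norm_le ((hk.comp_sub_left y).norm.const_mul M) ?_
  filter_upwards [hF] with t ht
  rw [norm_mul]
  gcongr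

/-- The complex-valued kernel of a normalized bump function. -/
noncomputable def bumpKernel (φ : ContDiffBump (0 : E n)) (x : E n) : ℂ := (φ.normed volume x : ℂ)

theorem bumpKernel_smooth (φ : ContDiffBump (0 : E n)) : Smooth (bumpKernel φ) :=
  Complex.ofRealCLM.contDiff.comp φ.contDiff_normed

theorem bumpKernel_hasCompactSupport (φ : ContDiffBump (0 : E n)) :
    HasCompactSupport (bumpKernel φ) :=
  φ.hasCompactSupport_normed.comp_left Complex.ofReal_zero

theorem tsupport_bumpKernel (φ : ContDiffBump (0 : E n)) :
    tsupport (bumpKernel φ) ⊆ Metric.closedBall 0 φ.rOut := by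
  rw [← φ.tsupport_normed_eq (μ := volume)]
  refine closure_mono fun x hx hc => hx ?_
  simp [bumpKernel, hc]

theorem integral_norm_bumpKernel (φ : ContDiffBump (0 : E n)) :
    ∫ x, ‖bumpKernel φ x‖ = 1 := by
  rw [← φ.integral_normed (μ := (volume : Measure (E n)))]
  congr 1
  funext x
  simp [bumpKernel, abs_of_nonneg (φ.nonneg_normed x)]

theorem cv_bumpKernel (φ : ContDiffBump (0 : E n)) (F : E n → ℂ) :
    cv F (bumpKernel φ) = convolution (φ.normed volume) F (ContinuousLinearMap.lsmul ℝ ℝ) volume := by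
  funext y
  rw [convolution_eq_swap]
  simp [cv, bumpKernel, mul_comm]

/-- A sequence of bump functions shrinking to the origin. -/
noncomputable def bumpSeq (n : ℕ) (m : ℕ) : ContDiffBump (0 : E n) :=
  ⟨1 / (m + 1 : ℝ), 2 / (m + 1 : ℝ), by positivity, by gcongr; norm_num⟩

theorem bumpSeq_rOut_tendsto : Tendsto (fun m => (bumpSeq n m).rOut) atTop (𝓝 0) := by
  have := (tendsto_one_div_add_atTop_nhds_zero_nat (𝕜 := ℝ)).const_mul 2
  simpa [bumpSeq, div_eq_mul_inv] using this

theorem ae_tendsto_cv_bumpSeq {F : E n → ℂ} (hF : LocallyIntegrable F volume) :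
    ∀ᵐ x, Tendsto (fun m => cv F (bumpKernel (bumpSeq n m)) x) atTop (𝓝 (F x)) := by
  simp only [cv_bumpKernel]
  -- The outer radius is twice the inner one for every `m`; the Lebesgue differentiation argument
  -- needs such a uniform ratio.
  refine ContDiffBump.ae_convolution_tendsto_right_of_locallyIntegrable (K := 2)
    bumpSeq_rOut_tendsto (Eventually.of_forall fun m => ?_) hF
  simp only [bumpSeq]
  apply le_of_eq
  ring

/-! ### The product rule -/

/-- The bounded factor f is mollified; f_m ψ is then an admissible test function for g. Kernels of
mass one preserve the bound M, so dominated convergence applies although g and g' are only locally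
integrable. -/
theorem wd_mul_of_test {X Y : Set (E n)} (hX : IsOpen X) {f f' g g' : E n → ℂ} {i : Fin n}
    {M : ℝ} (hf : LocallyIntegrable f volume) (hf' : LocallyIntegrable f' volume)
    (hg : LocallyIntegrable g volume) (hg' : LocallyIntegrable g' volume)
    (hfM : ∀ᵐ x ∂(volume : Measure (E n)), ‖f x‖ ≤ M)
    (hfM' : ∀ᵐ x ∂(volume : Measure (E n)), ‖f' x‖ ≤ M)
    (hWf : WD i X f f') (hWg : WD i Y g g') {ψ : E n → ℂ} (hψ : IsTestFunction (X ∩ Y) ψ) :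
    ∫ x, (f x * g x) * partialDeriv i ψ x = - ∫ x, (f' x * g x + f x * g' x) * ψ x := by
  set ρ : ℕ → E n → ℂ := fun m => bumpKernel (bumpSeq n m) with hρ
  have hρs : ∀ m, Smooth (ρ m) := fun m => bumpKernel_smooth _
  have hρc : ∀ m, HasCompactSupport (ρ m) := fun m => bumpKernel_hasCompactSupport _
  have hρi : ∀ m, Integrable (ρ m) := fun m =>
    (hρs m).continuous.integrable_of_hasCompactSupport (hρc m)
  have hbd : ∀ {F : E n → ℂ}, (∀ᵐ x ∂(volume : Measure (E n)), ‖F x‖ ≤ M) → ∀ m y,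
      ‖cv F (ρ m) y‖ ≤ M := by
    intro F hF m y
    have := norm_cv_le hF (hρi m) y
    rwa [integral_norm_bumpKernel, mul_one] at this
  have hψ' := hψ.partialDeriv i
  -- the identity for the mollified function
  have hev : ∀ᶠ m in atTop,
      ∫ x, cv f (ρ m) x * (g x * partialDeriv i ψ x)
        = - ∫ x, (cv f' (ρ m) x * (g x * ψ x) + cv f (ρ m) x * (g' x * ψ x)) := by
    -- Once the mollification radius is below δ, the points of supp ψ see f only inside X, where f'
    -- is its weak derivative.
    obtain ⟨δ, hδ, hδX⟩ := IsCompact.exists_thickening_subset_open hψ.hasCompactSupport hX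
      (hψ.2.2.trans inter_subset_left)
    filter_upwards [bumpSeq_rOut_tendsto.eventually (gt_mem_nhds hδ)] with m hm
    have hs := cv_smooth hf (hρs m) (hρc m)
    have hs' := cv_smooth hf' (hρs m) (hρc m)
    have h1 := hWg _ ((hψ.mono inter_subset_right).smooth_mul hs)
    have h2 : ∀ x, partialDeriv i (fun y => cv f (ρ m) y * ψ y) x
        = cv f' (ρ m) x * ψ x + cv f (ρ m) x * partialDeriv i ψ x := by
      intro x
      rw [partialDeriv_mul hs hψ.smooth]
      by_cases hx : x ∈ tsupport ψ
      · rw [partialDeriv_cv hf (hρs m) (hρc m), hWf.cv_eq (hρs m)]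
        refine isTestFunction_reflect (hρs m) (hρc m) fun z hz => hδX ?_
        refine Metric.mem_thickening_iff.2 ⟨x, hx, ?_⟩
        have := tsupport_bumpKernel _ hz
        rw [mem_closedBall_zero_iff] at this
        simpa [dist_eq_norm] using this.trans_lt hm
      · rw [image_eq_zero_of_notMem_tsupport hx]; ring
    simp only [h2] at h1
    have i1 : Integrable (fun x => cv f (ρ m) x * (g x * partialDeriv i ψ x)) := by
      exact (hψ'.integrable_mul (hg.locallyIntegrableOn _)).bdd_mul (c := M)
        hs.continuous.aestronglyMeasurable (Eventually.of_forall (hbd hfM m))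
    have i2 : Integrable (fun x => cv f' (ρ m) x * (g x * ψ x)) := by
      exact (hψ.integrable_mul (hg.locallyIntegrableOn _)).bdd_mul (c := M)
        hs'.continuous.aestronglyMeasurable (Eventually.of_forall (hbd hfM' m))
    have i3 : Integrable (fun x => cv f (ρ m) x * (g' x * ψ x)) := by
      exact (hψ.integrable_mul (hg'.locallyIntegrableOn _)).bdd_mul (c := M)
        hs.continuous.aestronglyMeasurable (Eventually.of_forall (hbd hfM m))
    have e1 : ∫ x, g x * (cv f' (ρ m) x * ψ x + cv f (ρ m) x * partialDeriv i ψ x)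
        = (∫ x, cv f' (ρ m) x * (g x * ψ x))
          + ∫ x, cv f (ρ m) x * (g x * partialDeriv i ψ x) := by
      rw [← integral_add i2 i1]
      congr 1; funext x; ring
    have e2 : ∫ x, g' x * (cv f (ρ m) x * ψ x) = ∫ x, cv f (ρ m) x * (g' x * ψ x) := by
      congr 1; funext x; ring
    rw [e1, e2] at h1
    rw [integral_add i2 i3]
    linear_combination h1
  have lim1 : Tendsto (fun m => ∫ x, cv f (ρ m) x * (g x * partialDeriv i ψ x)) atTop
      (𝓝 (∫ x, f x * (g x * partialDeriv i ψ x))) := by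
    refine tendsto_integral_of_dominated_convergence
      (fun x => M * ‖g x * partialDeriv i ψ x‖) (fun m => ?_) ?_ (fun m => ?_) ?_
    · exact (cv_smooth hf (hρs m) (hρc m)).continuous.aestronglyMeasurable.mul
        (hψ'.integrable_mul (hg.locallyIntegrableOn _)).aestronglyMeasurable
    · exact (hψ'.integrable_mul (hg.locallyIntegrableOn _)).norm.const_mul M
    · refine Eventually.of_forall fun x => ?_
      rw [norm_mul]
      gcongr
      exact hbd hfM m x
    · filter_upwards [ae_tendsto_cv_bumpSeq hf] with x hx
      exact hx.mul_const _
  have lim2 : Tendsto (fun m => ∫ x, (cv f' (ρ m) x * (g x * ψ x) + cv f (ρ m) x * (g' x * ψ x)))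
      atTop (𝓝 (∫ x, (f' x * (g x * ψ x) + f x * (g' x * ψ x)))) := by
    have j1 := (hψ.integrable_mul (hg.locallyIntegrableOn (X ∩ Y)))
    have j2 := (hψ.integrable_mul (hg'.locallyIntegrableOn (X ∩ Y)))
    refine tendsto_integral_of_dominated_convergence
      (fun x => M * ‖g x * ψ x‖ + M * ‖g' x * ψ x‖) (fun m => ?_) ?_ (fun m => ?_) ?_
    · exact ((cv_smooth hf' (hρs m) (hρc m)).continuous.aestronglyMeasurable.mul
        j1.aestronglyMeasurable).add
        ((cv_smooth hf (hρs m) (hρc m)).continuous.aestronglyMeasurable.mul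
        j2.aestronglyMeasurable)
    · exact (j1.norm.const_mul M).add (j2.norm.const_mul M)
    · refine Eventually.of_forall fun x => (norm_add_le _ _).trans ?_
      rw [norm_mul, norm_mul (cv f (ρ m) x)]
      gcongr
      · exact hbd hfM' m x
      · exact hbd hfM m x
    · filter_upwards [ae_tendsto_cv_bumpSeq hf, ae_tendsto_cv_bumpSeq hf'] with x hx hx'
      exact (hx'.mul_const _).add (hx.mul_const _)
  have := tendsto_nhds_unique_of_eventuallyEq lim1 lim2.neg hev
  have e3 : ∀ x, (f x * g x) * partialDeriv i ψ x = f x * (g x * partialDeriv i ψ x) :=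
    fun x => mul_assoc _ _ _
  have e4 : ∀ x, (f' x * g x + f x * g' x) * ψ x = f' x * (g x * ψ x) + f x * (g' x * ψ x) :=
    fun x => by ring
  simp only [e3, e4]
  exact this

/-- The product rule for a bounded function on `X` whose support (relative to `X`) lies in `Y` and
a function on `Y`. -/
theorem wd_mul {X Y T : Set (E n)} (hX : IsOpen X) (hY : IsOpen Y) (hT : IsClosed T)
    (hTXY : T ∩ X ⊆ Y) {f f' g g' : E n → ℂ} {i : Fin n}
    {M : ℝ} (hf : LocallyIntegrable f volume) (hf' : LocallyIntegrable f' volume)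
    (hg : LocallyIntegrable g volume) (hg' : LocallyIntegrable g' volume)
    (hfM : ∀ᵐ x ∂(volume : Measure (E n)), ‖f x‖ ≤ M)
    (hfM' : ∀ᵐ x ∂(volume : Measure (E n)), ‖f' x‖ ≤ M)
    (hfT : ∀ x, x ∉ T → f x = 0) (hfT' : ∀ x, x ∉ T → f' x = 0)
    (hWf : WD i X f f') (hWg : WD i Y g g') :
    WD i X (fun x => f x * g x) (fun x => f' x * g x + f x * g' x) := by
  intro ψ hψ
  -- The set T ∩ supp ψ is compact in X ∩ Y. Replacing ψ by χψ makes the test function admissible on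
  -- Y and leaves the integrals alone, since χ = 1 near that set and f, f' vanish off T.
  obtain ⟨χ, hχ, hχ1, -⟩ := exists_cutoff (hψ.hasCompactSupport.inter_left hT) (hX.inter hY)
    (show T ∩ tsupport ψ ⊆ X ∩ Y from fun x hx => ⟨hψ.2.2 hx.2, hTXY ⟨hx.1, hψ.2.2 hx.2⟩⟩)
  have hχψ : IsTestFunction (X ∩ Y) (fun x => χ x * ψ x) :=
    IsTestFunction.smooth_mul_of_subset hχ.smooth hψ.smooth hψ.hasCompactSupport
      (inter_subset_left.trans hχ.2.2)
  have key := wd_mul_of_test hX hf hf' hg hg' hfM hfM' hWf hWg hχψ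
  have hloc : ∀ x ∈ T, (fun y => χ y * ψ y) =ᶠ[𝓝 x] ψ := by
    intro x hx
    by_cases hxs : x ∈ tsupport ψ
    · filter_upwards [mem_nhdsSet_iff_forall.1 hχ1 x ⟨hx, hxs⟩] with y hy
      rw [show χ y = 1 from hy, one_mul]
    · have := notMem_tsupport_iff_eventuallyEq.1 hxs
      filter_upwards [this] with y hy
      simp [hy]
  have e1 : ∀ x, f x * g x * partialDeriv i (fun y => χ y * ψ y) x
      = f x * g x * partialDeriv i ψ x := by
    intro x
    by_cases hx : x ∈ T
    · rw [partialDeriv_congr (hloc x hx)]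
    · simp [hfT x hx]
  have e2 : ∀ x, (f' x * g x + f x * g' x) * (χ x * ψ x)
      = (f' x * g x + f x * g' x) * ψ x := by
    intro x
    by_cases hx : x ∈ T
    · rw [show χ x * ψ x = ψ x from (hloc x hx).self_of_nhds]
    · simp [hfT x hx, hfT' x hx]
  simp only [e1, e2] at key
  exact key

/-! ### The Leibniz rule -/

theorem HasWeakDeriv.add {α : Fin n → ℕ} {V : Set (E n)} {u v u' v' : E n → ℂ}
    (h : HasWeakDeriv α V u v) (h' : HasWeakDeriv α V u' v') :
    HasWeakDeriv α V (fun x => u x + u' x) (fun x => v x + v' x) := by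
  refine ⟨h.1.add h'.1, h.2.1.add h'.2.1, fun ψ hψ => ?_⟩
  have hψ' := hψ.multiDeriv α
  rw [hψ.setIntegral_eq, hψ'.setIntegral_eq]
  simp only [add_mul]
  rw [integral_add (hψ'.integrable_mul h.1) (hψ'.integrable_mul h'.1),
    integral_add (hψ.integrable_mul h.2.1) (hψ.integrable_mul h'.2.1), h.integral_eq hψ,
    h'.integral_eq hψ]
  change _ = (-1) ^ deg α * _
  ring

theorem LocallyIntegrable.mul_ae_bounded {f g : E n → ℂ} (hg : LocallyIntegrable g volume)
    (hf : Measurable f) {M : ℝ} (hM : ∀ᵐ x ∂(volume : Measure (E n)), ‖f x‖ ≤ M) :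
    LocallyIntegrable (fun x => f x * g x) volume := by
  intro x
  obtain ⟨s, hs, hgs⟩ := hg x
  exact ⟨s, hs, hgs.bdd_mul hf.aestronglyMeasurable (ae_restrict_of_ae hM)⟩

/-- Reindexing by γ ↦ γ + e_i: in a scaled sum, one more derivative is paid for by one factor η. -/
theorem sum_shift_le {k : ℕ} {i : Fin n} {η : ℝ} (hη : 0 < η) (a : (Fin n → ℕ) → ℝ)
    (ha : ∀ γ, 0 ≤ a γ) :
    η * ∑ γ ∈ multiIndices n k, η ^ deg γ * a (γ + Pi.single i 1)
      ≤ ∑ γ ∈ multiIndices n (k + 1), η ^ deg γ * a γ := by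
  rw [Finset.mul_sum]
  have h1 : ∑ γ ∈ multiIndices n k, η * (η ^ deg γ * a (γ + Pi.single i 1))
      = ∑ γ ∈ (multiIndices n k).image (fun γ => γ + Pi.single i 1), η ^ deg γ * a γ := by
    rw [Finset.sum_image (fun x _ y _ h => add_right_cancel h)]
    refine Finset.sum_congr rfl fun γ _ => ?_
    rw [deg_add_single, pow_succ]
    ring
  rw [h1]
  refine Finset.sum_le_sum_of_subset_of_nonneg ?_ fun γ _ _ => mul_nonneg (by positivity) (ha γ)
  intro γ hγ
  obtain ⟨β, hβ, rfl⟩ := Finset.mem_image.1 hγ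
  rw [mem_multiIndices] at hβ ⊢
  rw [deg_add_single]
  omega

theorem multiIndices_mono {k l : ℕ} (h : k ≤ l) : multiIndices n k ⊆ multiIndices n l := by
  intro α hα
  rw [mem_multiIndices] at hα ⊢
  omega

/-- Weak derivatives of a product. -/
theorem Jet.exists_hasWeakDeriv_mul {X Y T : Set (E n)} (hX : IsOpen X) (hY : IsOpen Y)
    (hT : IsClosed T) (hTXY : T ∩ X ⊆ Y) {η : ℝ} (hη : 0 < η) (α : Fin n → ℕ) :
    ∀ {k : ℕ} {p g : (Fin n → ℕ) → E n → ℂ} {M : ℝ}, deg α ≤ k → Jet k X p → Jet k Y g → 0 ≤ M →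
      (∀ β, deg β ≤ k → ∀ᵐ x ∂(volume : Measure (E n)), η ^ deg β * ‖p β x‖ ≤ M) →
      (∀ β, deg β ≤ k → ∀ x, x ∉ T → p β x = 0) →
      ∃ v, HasWeakDeriv α X (fun x => p 0 x * g 0 x) v ∧ (∀ x, x ∉ T → v x = 0) ∧
        ∀ᵐ x ∂(volume : Measure (E n)), η ^ deg α * ‖v x‖
          ≤ 2 ^ deg α * M * ∑ γ ∈ multiIndices n k, η ^ deg γ * ‖g γ x‖ := by
  have bound : ∀ {k : ℕ} {p : (Fin n → ℕ) → E n → ℂ} {M : ℝ},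
      (∀ β, deg β ≤ k → ∀ᵐ x ∂(volume : Measure (E n)), η ^ deg β * ‖p β x‖ ≤ M) →
      ∀ β, deg β ≤ k → ∀ᵐ x ∂(volume : Measure (E n)), ‖p β x‖ ≤ M / η ^ deg β := by
    intro k p M hp β hβ
    filter_upwards [hp β hβ] with x hx
    rw [le_div_iff₀ (by positivity)]
    linarith
  induction α using multiIndex_induction with
  | h0 =>
    intro k p g M _ hp hg hM hpM hpT
    have hloc : LocallyIntegrable (fun x => p 0 x * g 0 x) volume :=
      LocallyIntegrable.mul_ae_bounded (hg.locallyIntegrable (by simp)) (hp.meas 0)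
        (bound hpM 0 (by simp))
    refine ⟨fun x => p 0 x * g 0 x, ⟨hloc.locallyIntegrableOn X, hloc.locallyIntegrableOn X,
      fun ψ _ => by simp⟩, fun x hx => by simp [hpT 0 (by simp) x hx], ?_⟩
    filter_upwards [hpM 0 (by simp)] with x hx
    simp only [deg_zero, pow_zero, one_mul] at hx ⊢
    rw [norm_mul]
    gcongr
    have : ‖g 0 x‖ = η ^ deg (0 : Fin n → ℕ) * ‖g 0 x‖ := by simp
    rw [this]
    exact Finset.single_le_sum (f := fun γ => η ^ deg γ * ‖g γ x‖) (fun γ _ => by positivity)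
      (mem_multiIndices.2 (by simp))
  | hs α i ih =>
    intro k p g M hk hp hg hM hpM hpT
    obtain ⟨k, rfl⟩ : ∃ l, k = l + 1 := ⟨k - 1, by rw [deg_add_single] at hk; omega⟩
    have hα : deg α ≤ k := by rw [deg_add_single] at hk; omega
    have hi : deg (Pi.single i 1 : Fin n → ℕ) ≤ k + 1 := by simp
    -- Since ∂^(α+e_i)(pg) = ∂^α(∂_i p · g) + ∂^α(p · ∂_i g), the induction hypothesis is used for
    -- two shifted jets. The shift of p has scaled bound M/η, and the spare factor η restores M; the
    -- two summands double the constant at each derivative.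
    obtain ⟨v₁, h1, h1T, h1M⟩ := ih (M := M / η) hα (hp.shift i) (hg.mono_order (Nat.le_succ k))
      (by positivity) (fun β hβ => by
        have := hpM (β + Pi.single i 1) (by rw [deg_add_single]; omega)
        filter_upwards [this] with x hx
        rw [le_div_iff₀ hη]
        rw [deg_add_single, pow_succ] at hx
        linarith)
      (fun β hβ x hx => hpT _ (by rw [deg_add_single]; omega) x hx)
    obtain ⟨v₂, h2, h2T, h2M⟩ := ih hα (hp.mono_order (Nat.le_succ k)) (hg.shift i) hM
      (fun β hβ => hpM β (by omega)) (fun β hβ => hpT β (by omega))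
    simp only [zero_add] at h1 h2
    have b0 := bound hpM 0 (by simp)
    have b1 := bound hpM _ hi
    simp only [deg_zero, deg_single, pow_zero, pow_one, div_one] at b0 b1
    have hwd := wd_mul hX hY hT hTXY (i := i) (M := max M (M / η))
      (hp.locallyIntegrable (α := 0) (by simp)) (hp.locallyIntegrable hi)
      (hg.locallyIntegrable (α := 0) (by simp)) (hg.locallyIntegrable hi)
      (b0.mono fun x hx => hx.trans (le_max_left _ _))
      (b1.mono fun x hx => hx.trans (le_max_right _ _)) (hpT 0 (by simp)) (hpT _ hi)
      (by simpa using hp.deriv 0 i (by simp)) (by simpa using hg.deriv 0 i (by simp))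
    have hloc : LocallyIntegrable (fun x => p 0 x * g 0 x) volume :=
      LocallyIntegrable.mul_ae_bounded (hg.locallyIntegrable (by simp)) (hp.meas 0) b0
    refine ⟨fun x => v₁ x + v₂ x,
      HasWeakDeriv.comp (hloc.locallyIntegrableOn X) hwd (h1.add h2),
      fun x hx => by simp [h1T x hx, h2T x hx], ?_⟩
    filter_upwards [h1M, h2M] with x hx1 hx2
    rw [deg_add_single, pow_succ, pow_succ]
    have e1 : ∑ γ ∈ multiIndices n k, η ^ deg γ * ‖g γ x‖
        ≤ ∑ γ ∈ multiIndices n (k + 1), η ^ deg γ * ‖g γ x‖ :=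
      Finset.sum_le_sum_of_subset_of_nonneg (multiIndices_mono (Nat.le_succ k))
        fun γ _ _ => by positivity
    have e2 := sum_shift_le (k := k) (i := i) hη (fun γ => ‖g γ x‖) (fun γ => norm_nonneg _)
    set S := ∑ γ ∈ multiIndices n (k + 1), η ^ deg γ * ‖g γ x‖
    set S₁ := ∑ γ ∈ multiIndices n k, η ^ deg γ * ‖g γ x‖
    set S₂ := ∑ γ ∈ multiIndices n k, η ^ deg γ * ‖g (γ + Pi.single i 1) x‖
    calc η ^ deg α * η * ‖v₁ x + v₂ x‖
        ≤ η ^ deg α * η * (‖v₁ x‖ + ‖v₂ x‖) := by gcongr; exact norm_add_le _ _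
      _ = η * (η ^ deg α * ‖v₁ x‖) + η * (η ^ deg α * ‖v₂ x‖) := by ring
      _ ≤ η * (2 ^ deg α * (M / η) * S₁) + η * (2 ^ deg α * M * S₂) := by gcongr
      _ = 2 ^ deg α * M * S₁ + 2 ^ deg α * M * (η * S₂) := by field_simp
      _ ≤ 2 ^ deg α * M * S + 2 ^ deg α * M * S := by gcongr
      _ = 2 ^ deg α * 2 * M * S := by ring

/-- A square-integrated version of a pointwise bound. -/
theorem sqNorm_le_of_pointwise {ι : Type*} {V : Set (E n)} {q : E n → ℂ} {A B : ℝ} (hA : 0 ≤ A)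
    (hB : 0 ≤ B) (s : Finset ι) {a : ι → ℝ} (ha : ∀ i, 0 ≤ a i) {g : ι → E n → ℂ}
    (hg : ∀ i ∈ s, Measurable (g i))
    (h : ∀ᵐ x ∂(volume.restrict V), A * ‖q x‖ ≤ B * ∑ i ∈ s, a i * ‖g i x‖) :
    ENNReal.ofReal A ^ 2 * sqNorm V q
      ≤ ENNReal.ofReal B ^ 2 * s.card * ∑ i ∈ s, ENNReal.ofReal (a i) ^ 2 * sqNorm V (g i) := by
  unfold sqNorm
  simp_rw [← fun i => lintegral_const_mul' (μ := volume.restrict V) (ENNReal.ofReal (a i) ^ 2)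
    (fun x => ‖g i x‖ₑ ^ 2) (by simp)]
  rw [← lintegral_finsetSum _ (fun i hi => ((hg i hi).enorm.pow_const 2).const_mul _),
    ← lintegral_const_mul' _ _ (by simp), ← lintegral_const_mul' _ _
      (ENNReal.mul_ne_top (by simp) (by simp))]
  refine lintegral_mono_ae ?_
  filter_upwards [h] with x hx
  have e : ∀ z : ℂ, ‖z‖ₑ = ENNReal.ofReal ‖z‖ := fun z => (ofReal_norm z).symm
  have h1 : (A * ‖q x‖) ^ 2 ≤ B ^ 2 * (s.card * ∑ i ∈ s, (a i * ‖g i x‖) ^ 2) := by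
    calc (A * ‖q x‖) ^ 2 ≤ (B * ∑ i ∈ s, a i * ‖g i x‖) ^ 2 := by gcongr
      _ = B ^ 2 * (∑ i ∈ s, a i * ‖g i x‖) ^ 2 := by ring
      _ ≤ _ := by gcongr; exact sq_sum_le_card_mul_sum_sq
  have h2 := ENNReal.ofReal_le_ofReal h1
  rw [ENNReal.ofReal_pow (by positivity), ENNReal.ofReal_mul hA, mul_pow,
    ENNReal.ofReal_mul (by positivity), ENNReal.ofReal_pow hB, ENNReal.ofReal_mul (by positivity),
    ENNReal.ofReal_natCast, ENNReal.ofReal_sum_of_nonneg (fun i _ => by positivity)] at h2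
  have h3 : ∀ i ∈ s, ENNReal.ofReal ((a i * ‖g i x‖) ^ 2)
      = ENNReal.ofReal (a i) ^ 2 * ENNReal.ofReal ‖g i x‖ ^ 2 := fun i _ => by
    rw [ENNReal.ofReal_pow (mul_nonneg (ha i) (norm_nonneg _)), ENNReal.ofReal_mul (ha i), mul_pow]
  rw [Finset.sum_congr rfl h3, ← mul_assoc] at h2
  simpa only [e] using h2

/-- The scaled square norm `h^{2|α|} ‖∂^α f‖²_{L²(V)}` of an entry of a jet. -/
noncomputable def wsq (h : ℝ) (V : Set (E n)) (f : (Fin n → ℕ) → E n → ℂ) (α : Fin n → ℕ) :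
    ℝ≥0∞ := ENNReal.ofReal h ^ (2 * deg α) * sqNorm V (f α)

/-- **Leibniz rule** for jets. -/
theorem Jet.exists_mul {X Y T : Set (E n)} (hX : IsOpen X) (hY : IsOpen Y)
    (hT : IsClosed T) (hTXY : T ∩ X ⊆ Y) {η : ℝ} (hη : 0 < η) {k : ℕ}
    {p g : (Fin n → ℕ) → E n → ℂ} {M : ℝ} (hp : Jet k X p) (hg : Jet k Y g) (hM : 0 ≤ M)
    (hpM : ∀ β, deg β ≤ k → ∀ᵐ x ∂(volume : Measure (E n)), η ^ deg β * ‖p β x‖ ≤ M)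
    (hpT : ∀ β, deg β ≤ k → ∀ x, x ∉ T → p β x = 0) :
    ∃ q, Jet k X q ∧ q 0 =ᵐ[volume.restrict X] (fun x => p 0 x * g 0 x) ∧
      (∀ α, deg α ≤ k → ∀ᵐ x ∂(volume.restrict X), x ∉ T → q α x = 0) ∧
      ∀ α, deg α ≤ k → wsq η X q α ≤ ENNReal.ofReal (2 ^ k * M) ^ 2 * (multiIndices n k).card *
        ∑ γ ∈ multiIndices n k, wsq η Y g γ := by
  choose! v hv hvT hvM using fun α (hα : deg α ≤ k) =>
    Jet.exists_hasWeakDeriv_mul hX hY hT hTXY hη α hα hp hg hM hpM hpT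
  have hsum : MemLp (fun x => ∑ γ ∈ multiIndices n k, η ^ deg γ * ‖g γ x‖) 2
      (volume.restrict X) := by
    refine memLp_finsetSum _ fun γ hγ => ?_
    exact ((hg.memLp γ (mem_multiIndices.1 hγ)).restrict X).norm.const_mul _
  have hv2 : ∀ α, deg α ≤ k → eLpNorm (v α) 2 (volume.restrict X) < ∞ := by
    intro α hα
    refine (hsum.of_le_mul (c := 2 ^ deg α * M / η ^ deg α)
      (hv α hα).2.1.aestronglyMeasurable ?_).2
    filter_upwards [ae_restrict_of_ae (hvM α hα)] with x hx
    rw [Real.norm_of_nonneg (Finset.sum_nonneg fun γ _ => by positivity), div_mul_eq_mul_div,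
      le_div_iff₀ (by positivity)]
    linarith
  obtain ⟨q, hq, hq0, hqv⟩ := exists_jet_of_hasWeakDeriv hX v hv hv2
  refine ⟨q, hq, hq0, fun α hα => ?_, fun α hα => ?_⟩
  · filter_upwards [hqv α hα] with x hx hxT
    rw [hx, hvT α hα x hxT]
  · have h1 := sqNorm_le_of_pointwise (V := X) (q := q α) (A := η ^ deg α) (B := 2 ^ k * M)
      (by positivity) (by positivity) (multiIndices n k) (a := fun γ => η ^ deg γ)
      (fun γ => by positivity) (g := g) (fun γ _ => hg.meas γ) (by
        filter_upwards [hqv α hα, ae_restrict_of_ae (hvM α hα)] with x hx hx2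
        rw [hx]
        refine hx2.trans ?_
        gcongr
        norm_num)
    unfold wsq
    simp only [ENNReal.ofReal_pow hη.le, ← pow_mul] at h1
    simp only [mul_comm 2]
    refine h1.trans ?_
    gcongr with γ hγ
    -- The entries of g are extended by zero off Y, so integrals over X are at most those over Y
    -- although neither set contains the other.
    rw [← sqNorm_univ_of_zero hY.measurableSet (hg.zero γ)]
    exact sqNorm_mono_set (subset_univ X) _

/-! ### Translation estimates -/

theorem sq_lintegral_le {α : Type*} [MeasurableSpace α] (ν : Measure α) {g : α → ℝ≥0∞}
    (hg : AEMeasurable g ν) : (∫⁻ x, g x ∂ν) ^ 2 ≤ ν univ * ∫⁻ x, g x ^ 2 ∂ν := by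
  have h := ENNReal.lintegral_mul_le_Lp_mul_Lq ν Real.HolderConjugate.two_two hg
    (aemeasurable_const (b := (1 : ℝ≥0∞)))
  simp only [Pi.mul_apply, mul_one, ENNReal.rpow_ofNat, one_pow, lintegral_one] at h
  calc (∫⁻ x, g x ∂ν) ^ 2
      ≤ ((∫⁻ x, g x ^ 2 ∂ν) ^ (1 / 2 : ℝ) * ν univ ^ (1 / 2 : ℝ)) ^ 2 := by gcongr
    _ = ν univ * ∫⁻ x, g x ^ 2 ∂ν := by
      rw [mul_pow, ← ENNReal.rpow_natCast, ← ENNReal.rpow_natCast, ← ENNReal.rpow_mul,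
        ← ENNReal.rpow_mul]
      norm_num
      ring

theorem Jet.shift_add {k l : ℕ} {V : Set (E n)} {f : (Fin n → ℕ) → E n → ℂ} (h : Jet k V f)
    {γ : Fin n → ℕ} (hγ : deg γ + l ≤ k) : Jet l V (fun α => f (γ + α)) := by
  refine ⟨fun α => h.meas _, fun α => h.zero _, fun α hα => h.memLp _ ?_, fun α j hα => ?_⟩
  · rw [deg_add]; omega
  · have := h.deriv (γ + α) j (by rw [deg_add]; omega)
    rwa [add_assoc] at this

/-- The derivative of a jet in the direction `τ`. -/
noncomputable def dirDeriv (f : (Fin n → ℕ) → E n → ℂ) (τ : E n) (y : E n) : ℂ :=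
  ∑ i, (τ i : ℂ) * f (Pi.single i 1) y

section dirDeriv

variable {V : Set (E n)} {f : (Fin n → ℕ) → E n → ℂ}

theorem Jet.measurable_dirDeriv {k : ℕ} (hf : Jet k V f) (τ : E n) :
    Measurable (dirDeriv f τ) :=
  Finset.measurable_sum _ fun _ _ => (hf.meas _).const_mul _

theorem Jet.memLp_dirDeriv (hf : Jet 1 V f) (τ : E n) : MemLp (dirDeriv f τ) 2 volume :=
  memLp_finsetSum _ fun _ _ => (hf.memLp _ (by simp)).const_mul _

theorem Jet.sqNorm_dirDeriv_le {k : ℕ} (hf : Jet k V f) (τ : E n) :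
    sqNorm V (dirDeriv f τ)
      ≤ n * ENNReal.ofReal ‖τ‖ ^ 2 * ∑ i, sqNorm V (f (Pi.single i 1)) := by
  unfold dirDeriv
  refine (sqNorm_finset_sum_le Finset.univ V _
    fun _ _ => ((hf.meas _).const_mul _).aemeasurable).trans ?_
  rw [Finset.card_univ, Fintype.card_fin, mul_assoc, Finset.mul_sum (a := ENNReal.ofReal ‖τ‖ ^ 2)]
  gcongr with i
  rw [sqNorm_const_mul]
  gcongr
  rw [← ofReal_norm]
  gcongr
  rw [Complex.norm_real]
  exact PiLp.norm_apply_le τ i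

theorem fderiv_eq_sum_partialDeriv (F : E n → ℂ) (x τ : E n) :
    fderiv ℝ F x τ = ∑ i, (τ i : ℂ) * partialDeriv i F x := by
  have h : τ = ∑ i, τ i • EuclideanSpace.single i (1 : ℝ) := by
    have := (EuclideanSpace.basisFun (Fin n) ℝ).sum_repr τ
    simpa using this.symm
  conv_lhs => rw [h]
  simp [partialDeriv, map_sum]

/-- Integrals of translates, against a test function, as an integral along the segment. -/
theorem Jet.integral_translate_sub {U : Set (E n)} (hf : Jet 1 V f)
    {τ : E n} (hτ : ∀ y ∈ U, ∀ t ∈ Icc (0 : ℝ) 1, y + t • τ ∈ V) {ψ : E n → ℂ}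
    (hψ : IsTestFunction U ψ) :
    (∫ y, f 0 (y + τ) * ψ y) - ∫ y, f 0 y * ψ y
      = ∫ t in (0 : ℝ)..1, ∫ y, dirDeriv f τ (y + t • τ) * ψ y := by
  -- With this reflection, ∫ F(y + z) ψ(y) dy is the convolution of F with k at z. The claim becomes
  -- the fundamental theorem of calculus for the smooth function t ↦ (f₀ * k)(tτ).
  set k : E n → ℂ := fun x => ψ (-x) with hk
  have hks : Smooth k := hψ.smooth.comp contDiff_neg
  have hkc : HasCompactSupport k := hψ.hasCompactSupport.comp_homeomorph (Homeomorph.neg (E n))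
  have hf0 : LocallyIntegrable (f 0) volume := hf.locallyIntegrable (by simp)
  have hf1 : ∀ i, LocallyIntegrable (f (Pi.single i 1)) volume :=
    fun i => hf.locallyIntegrable (by simp)
  have hcv : ∀ (F : E n → ℂ) (z : E n), cv F k z = ∫ y, F (y + z) * ψ y := by
    intro F z
    rw [cv, ← integral_add_right_eq_self (fun t => F t * k (z - t)) z]
    congr 1
    funext y
    simp [hk]
  have hD : LocallyIntegrable (dirDeriv f τ) volume :=
    (hf.memLp_dirDeriv τ).locallyIntegrable (by norm_num)
  have hmem : ∀ t ∈ Icc (0 : ℝ) 1, IsTestFunction V (fun s => k (t • τ - s)) := by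
    intro t ht
    refine isTestFunction_reflect hks hkc fun x hx => ?_
    have : -x ∈ tsupport ψ := by
      have h1 : tsupport k ⊆ (fun x => -x) ⁻¹' tsupport ψ :=
        closure_minimal (fun s hs => subset_tsupport ψ hs)
          ((isClosed_tsupport ψ).preimage continuous_neg)
      exact h1 hx
    have := hτ _ (hψ.2.2 this) t ht
    rwa [neg_add_eq_sub] at this
  have hcvD : ∀ t ∈ Icc (0 : ℝ) 1, fderiv ℝ (cv (f 0) k) (t • τ) τ
      = cv (dirDeriv f τ) k (t • τ) := by
    intro t ht
    rw [fderiv_eq_sum_partialDeriv]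
    have h1 : ∀ i, partialDeriv i (cv (f 0) k) (t • τ) = cv (f (Pi.single i 1)) k (t • τ) := by
      intro i
      rw [partialDeriv_cv hf0 hks hkc]
      have := hf.deriv 0 i (by simp)
      rw [zero_add] at this
      exact this.cv_eq hks (hmem t ht)
    simp only [h1]
    simp only [cv, dirDeriv, Finset.sum_mul]
    rw [integral_finsetSum]
    · refine Finset.sum_congr rfl fun i _ => ?_
      rw [← integral_const_mul]
      congr 1; funext s; ring
    · intro i _
      simp only [mul_assoc]
      exact ((hmem t ht).integrable_mul ((hf1 i).locallyIntegrableOn V)).const_mul _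
  have hderiv : ∀ t ∈ uIcc (0 : ℝ) 1,
      HasDerivAt (fun t : ℝ => cv (f 0) k (t • τ)) (cv (dirDeriv f τ) k (t • τ)) t := by
    intro t ht
    rw [uIcc_of_le zero_le_one] at ht
    rw [← hcvD t ht]
    have h1 : HasDerivAt (fun t : ℝ => t • τ) τ t := by
      simpa using (hasDerivAt_id t).smul_const τ
    exact ((cv_smooth hf0 hks hkc).differentiable (t • τ)).hasFDerivAt.comp_hasDerivAt t h1
  have hcont : Continuous (fun t : ℝ => cv (dirDeriv f τ) k (t • τ)) :=
    (cv_smooth hD hks hkc).continuous.comp (by fun_prop)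
  have := intervalIntegral.integral_eq_sub_of_hasDerivAt hderiv (hcont.intervalIntegrable _ _)
  simp only [hcv] at this
  rw [this]
  simp

/-- The integral of `F` along the segments in the direction `τ`. -/
noncomputable def segInt (F : E n → ℂ) (τ : E n) (y : E n) : ℂ :=
  ∫ t in (0 : ℝ)..1, F (y + t • τ)

theorem segInt_eq (F : E n → ℂ) (τ : E n) (y : E n) :
    segInt F τ y = ∫ t in Ioc (0 : ℝ) 1, F (y + t • τ) :=
  intervalIntegral.integral_of_le zero_le_one

theorem stronglyMeasurable_segInt {F : E n → ℂ} (hF : Measurable F) (τ : E n) :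
    StronglyMeasurable (segInt F τ) := by
  have : segInt F τ = fun y => ∫ t in Ioc (0 : ℝ) 1, F (y + t • τ) := funext (segInt_eq F τ)
  rw [this]
  have hm : StronglyMeasurable (Function.uncurry fun (y : E n) (t : ℝ) => F (y + t • τ)) := by
    apply Measurable.stronglyMeasurable
    change Measurable (fun p : E n × ℝ => F (p.1 + p.2 • τ))
    fun_prop
  exact hm.integral_prod_right

theorem sqNorm_segInt_le {F : E n → ℂ} (hF : Measurable F) (τ : E n) :
    sqNorm univ (segInt F τ) ≤ sqNorm univ F := by
  unfold sqNorm
  simp only [Measure.restrict_univ]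
  calc ∫⁻ y, ‖segInt F τ y‖ₑ ^ 2
      ≤ ∫⁻ y, ∫⁻ t in Ioc (0 : ℝ) 1, ‖F (y + t • τ)‖ₑ ^ 2 := by
        refine lintegral_mono fun y => ?_
        have h1 : ‖segInt F τ y‖ₑ ≤ ∫⁻ t in Ioc (0 : ℝ) 1, ‖F (y + t • τ)‖ₑ := by
          rw [segInt_eq]
          exact enorm_integral_le_lintegral_enorm _
        have h2 := sq_lintegral_le (volume.restrict (Ioc (0 : ℝ) 1))
          (g := fun t => ‖F (y + t • τ)‖ₑ) (by fun_prop)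
        simp only [Measure.restrict_apply_univ, Real.volume_Ioc, sub_zero, ENNReal.ofReal_one,
          one_mul] at h2
        exact (pow_le_pow_left' h1 2).trans h2
    _ = ∫⁻ t in Ioc (0 : ℝ) 1, ∫⁻ y, ‖F (y + t • τ)‖ₑ ^ 2 :=
        lintegral_lintegral_swap (by
          change AEMeasurable (fun p : E n × ℝ => ‖F (p.1 + p.2 • τ)‖ₑ ^ 2) _
          fun_prop)
    _ = ∫⁻ t in Ioc (0 : ℝ) 1, ∫⁻ y, ‖F y‖ₑ ^ 2 := by
        refine lintegral_congr fun t => ?_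
        exact lintegral_add_right_eq_self (fun y => ‖F y‖ₑ ^ 2) (t • τ)
    _ = ∫⁻ y, ‖F y‖ₑ ^ 2 := by simp

theorem memLp_of_sqNorm_lt_top {F : E n → ℂ} (hF : AEStronglyMeasurable F volume)
    (h : sqNorm univ F < ∞) : MemLp F 2 volume := by
  refine ⟨hF, ?_⟩
  rw [← sqNorm_eq_eLpNorm, Measure.restrict_univ] at h
  exact sq_lt_top_iff.1 h

theorem MemLp.translate {F : E n → ℂ} (hF : MemLp F 2 volume) (τ : E n) :
    MemLp (fun y => F (y + τ)) 2 volume :=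
  hF.comp_measurePreserving (measurePreserving_add_right volume τ)

/-- Fubini. The majorant |F|² + |ψ|² has an integral independent of t by translation invariance. -/
theorem integral_segInt_mul {F : E n → ℂ} (hFm : Measurable F) (hF : MemLp F 2 volume) (τ : E n)
    {U : Set (E n)} {ψ : E n → ℂ} (hψ : IsTestFunction U ψ) :
    ∫ t in (0 : ℝ)..1, ∫ y, F (y + t • τ) * ψ y = ∫ y, segInt F τ y * ψ y := by
  have hψm : Measurable ψ := hψ.continuous.measurable
  have hm : Measurable (fun p : ℝ × E n => F (p.2 + p.1 • τ) * ψ p.2) := by fun_prop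
  have hF2 : ∀ z : E n, Integrable (fun y => ‖F (y + z)‖ ^ 2) :=
    fun z => (MemLp.translate hF z).integrable_norm_pow (by norm_num)
  have hψ2 : Integrable (fun y => ‖ψ y‖ ^ 2) := (hψ.memLp 2).integrable_norm_pow (by norm_num)
  have hle : ∀ (z y : E n), ‖F (y + z) * ψ y‖ ≤ ‖F (y + z)‖ ^ 2 + ‖ψ y‖ ^ 2 := by
    intro z y
    rw [norm_mul]
    nlinarith [sq_nonneg (‖F (y + z)‖ - ‖ψ y‖), norm_nonneg (F (y + z)), norm_nonneg (ψ y),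
      mul_nonneg (norm_nonneg (F (y + z))) (norm_nonneg (ψ y))]
  have hI : Integrable (fun p : ℝ × E n => F (p.2 + p.1 • τ) * ψ p.2)
      ((volume.restrict (Ioc (0 : ℝ) 1)).prod volume) := by
    rw [integrable_prod_iff hm.aestronglyMeasurable]
    refine ⟨Eventually.of_forall fun t => ?_, ?_⟩
    · refine ((hF2 (t • τ)).add hψ2).mono' (by fun_prop) (Eventually.of_forall fun y => ?_)
      exact hle (t • τ) y
    · refine Integrable.mono' (g := fun _ => (∫ y, ‖F y‖ ^ 2) + ∫ y, ‖ψ y‖ ^ 2)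
        (integrable_const _) ?_ (Eventually.of_forall fun t => ?_)
      · exact hm.norm.stronglyMeasurable.integral_prod_right.aestronglyMeasurable
      · rw [Real.norm_of_nonneg (integral_nonneg fun y => norm_nonneg _)]
        rw [← integral_add_right_eq_self (fun y => ‖F y‖ ^ 2) (t • τ),
          ← integral_add (hF2 _) hψ2]
        refine integral_mono_of_nonneg (Eventually.of_forall fun y => norm_nonneg _)
          ((hF2 _).add hψ2) (Eventually.of_forall fun y => ?_)
        exact hle (t • τ) y
  rw [intervalIntegral.integral_of_le zero_le_one, integral_integral_swap hI]
  congr 1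
  funext y
  rw [segInt_eq, ← integral_mul_const]

/-- Differences in the direction `τ` are controlled by the derivatives. -/
theorem Jet.sqNorm_translate_sub_le {U : Set (E n)} (hU : IsOpen U) (hV : IsOpen V)
    (hf : Jet 1 V f) {τ : E n} (hτ : ∀ y ∈ U, ∀ t ∈ Icc (0 : ℝ) 1, y + t • τ ∈ V) :
    sqNorm U (fun y => f 0 (y + τ) - f 0 y)
      ≤ n * ENNReal.ofReal ‖τ‖ ^ 2 * ∑ i, sqNorm V (f (Pi.single i 1)) := by
  have hDm := hf.measurable_dirDeriv τ
  have hD := hf.memLp_dirDeriv τ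
  have hDz : ∀ x, x ∉ V → dirDeriv f τ x = 0 := fun x hx => by
    simp [dirDeriv, hf.zero _ x hx]
  have hDU := sqNorm_univ_of_zero hV.measurableSet hDz
  have hS : MemLp (segInt (dirDeriv f τ) τ) 2 volume := by
    refine memLp_of_sqNorm_lt_top (stronglyMeasurable_segInt hDm τ).aestronglyMeasurable ?_
    refine (sqNorm_segInt_le hDm τ).trans_lt (GFEM.sqNorm_lt_top ?_)
    rwa [Measure.restrict_univ]
  have h0 : MemLp (f 0) 2 volume := hf.memLp 0 (by simp)
  have hdiff : MemLp (fun y => f 0 (y + τ) - f 0 y) 2 volume := (MemLp.translate h0 τ).sub h0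
  -- Tested against functions supported in U both sides have equal integrals, which upgrades the
  -- weak identity to a pointwise one.
  have hae : (fun y => f 0 (y + τ) - f 0 y) =ᵐ[volume.restrict U] segInt (dirDeriv f τ) τ := by
    have loc : ∀ {F : E n → ℂ}, MemLp F 2 volume → LocallyIntegrableOn F U volume :=
      fun h => (h.locallyIntegrable (by norm_num)).locallyIntegrableOn U
    refine ae_eq_of_forall_test hU (loc hdiff) (loc hS) fun ψ hψ => ?_
    rw [← integral_segInt_mul hDm hD τ hψ, ← hf.integral_translate_sub hτ hψ,
      ← integral_sub (hψ.integrable_mul (loc (MemLp.translate h0 τ))) (hψ.integrable_mul (loc h0))]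
    congr 1; funext y; ring
  rw [sqNorm_congr hae]
  calc sqNorm U (segInt (dirDeriv f τ) τ) ≤ sqNorm univ (segInt (dirDeriv f τ) τ) :=
        sqNorm_mono_set (subset_univ U) _
    _ ≤ sqNorm univ (dirDeriv f τ) := sqNorm_segInt_le hDm τ
    _ = sqNorm V (dirDeriv f τ) := hDU
    _ ≤ _ := hf.sqNorm_dirDeriv_le τ

end dirDeriv

/-! ### A Poincaré inequality on convex sets -/

/-- Double integrals of differences over a convex set. -/
theorem Jet.lintegral_sub_le {ω b : Set (E n)} (hω : IsOpen ω) (hc : Convex ℝ ω)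
    (hb : MeasurableSet b) (hbω : b ⊆ ω) {d : ℝ} (hd : ∀ x ∈ ω, ∀ y ∈ ω, dist x y ≤ d)
    {f : (Fin n → ℕ) → E n → ℂ} (hf : Jet 1 ω f) :
    ∫⁻ y in ω, ∫⁻ z in b, ‖f 0 z - f 0 y‖ₑ ^ 2
      ≤ volume (Metric.closedBall (0 : E n) d) *
        (n * ENNReal.ofReal d ^ 2 * ∑ i, sqNorm ω (f (Pi.single i 1))) := by
  have hfm : Measurable (f 0) := hf.meas 0
  -- Change of variables z = y + τ: for fixed τ the inner integral is a translation difference, and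
  -- τ ranges over a ball of radius d.
  set S : Set (E n × E n) := {p | p.1 ∈ ω ∧ p.1 + p.2 ∈ ω ∧ p.2 ∈ Metric.closedBall (0 : E n) d}
    with hS
  have hSm : MeasurableSet S :=
    (hω.measurableSet.preimage measurable_fst).inter
      ((hω.measurableSet.preimage (measurable_fst.add measurable_snd)).inter
        (Metric.isClosed_closedBall.measurableSet.preimage measurable_snd))
  set H : E n × E n → ℝ≥0∞ := S.indicator fun p => ‖f 0 (p.1 + p.2) - f 0 p.1‖ₑ ^ 2 with hH
  have hHm : Measurable H := by
    refine Measurable.indicator ?_ hSm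
    fun_prop
  have h1 : ∀ y, ω.indicator (fun y => ∫⁻ z in b, ‖f 0 z - f 0 y‖ₑ ^ 2) y ≤ ∫⁻ τ, H (y, τ) := by
    intro y
    by_cases hy : y ∈ ω
    · rw [indicator_of_mem hy, ← lintegral_indicator hb, ← lintegral_add_left_eq_self _ y]
      refine lintegral_mono fun τ => ?_
      by_cases hτ : y + τ ∈ b
      · have hmem : (y, τ) ∈ S := by
          refine ⟨hy, hbω hτ, ?_⟩
          have := hd _ (hbω hτ) _ hy
          simpa [dist_eq_norm] using this
        rw [indicator_of_mem hτ, hH, indicator_of_mem hmem]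
      · rw [indicator_of_notMem hτ]
        exact zero_le
    · rw [indicator_of_notMem hy]
      exact zero_le
  calc ∫⁻ y in ω, ∫⁻ z in b, ‖f 0 z - f 0 y‖ₑ ^ 2
      ≤ ∫⁻ y, ∫⁻ τ, H (y, τ) := by
        rw [← lintegral_indicator hω.measurableSet]
        exact lintegral_mono h1
    _ = ∫⁻ τ, ∫⁻ y, H (y, τ) := lintegral_lintegral_swap hHm.aemeasurable
    _ ≤ ∫⁻ τ, (Metric.closedBall (0 : E n) d).indicator (fun _ =>
          n * ENNReal.ofReal d ^ 2 * ∑ i, sqNorm ω (f (Pi.single i 1))) τ := by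
        refine lintegral_mono fun τ => ?_
        by_cases hτ : τ ∈ Metric.closedBall (0 : E n) d
        · rw [indicator_of_mem hτ]
          set U : Set (E n) := ω ∩ (fun y => y + τ) ⁻¹' ω with hUdef
          have hU : IsOpen U := hω.inter (hω.preimage (by fun_prop))
          -- Convexity enters only here: the segment from y to y + τ stays in ω.
          have hseg : ∀ y ∈ U, ∀ t ∈ Icc (0 : ℝ) 1, y + t • τ ∈ ω := by
            intro y hy t ht
            have := hc.add_smul_sub_mem hy.1 hy.2 ht
            simpa using this
          have e : ∫⁻ y, H (y, τ) = sqNorm U (fun y => f 0 (y + τ) - f 0 y) := by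
            rw [sqNorm, ← lintegral_indicator hU.measurableSet]
            refine lintegral_congr fun y => ?_
            by_cases hy : y ∈ U
            · rw [indicator_of_mem hy, hH, indicator_of_mem (show (y, τ) ∈ S from
                ⟨hy.1, hy.2, hτ⟩)]
            · rw [indicator_of_notMem hy, hH, indicator_of_notMem]
              exact fun h => hy ⟨h.1, h.2.1⟩
          rw [e]
          refine (hf.sqNorm_translate_sub_le hU hω hseg).trans ?_
          gcongr
          simpa using hτ
        · rw [indicator_of_notMem hτ]
          refine le_of_eq ?_
          have : ∀ y, H (y, τ) = 0 := fun y => by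
            rw [hH, indicator_of_notMem fun h => hτ h.2.2]
          simp [this]
    _ = _ := by
        rw [lintegral_indicator Metric.isClosed_closedBall.measurableSet, setLIntegral_const,
          mul_comm]

/-- Integrate |f(y)|² ≤ 2 (|f(z)|² + |f(z) - f(y)|²) over y ∈ ω and z ∈ b. -/
theorem Jet.poincare_volume {ω b : Set (E n)} (hω : IsOpen ω) (hc : Convex ℝ ω)
    (hb : MeasurableSet b) (hbω : b ⊆ ω) {d : ℝ} (hd : ∀ x ∈ ω, ∀ y ∈ ω, dist x y ≤ d)
    {f : (Fin n → ℕ) → E n → ℂ} (hf : Jet 1 ω f) :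
    volume b * sqNorm ω (f 0) ≤ 2 * (volume ω * sqNorm b (f 0) +
      volume (Metric.closedBall (0 : E n) d) *
        (n * ENNReal.ofReal d ^ 2 * ∑ i, sqNorm ω (f (Pi.single i 1)))) := by
  have hfm : Measurable (f 0) := hf.meas 0
  have h1 : volume b * sqNorm ω (f 0) = ∫⁻ y in ω, ∫⁻ z in b, ‖f 0 y‖ₑ ^ 2 := by
    simp only [setLIntegral_const]
    rw [lintegral_mul_const _ (by fun_prop), sqNorm, mul_comm]
  have h2 : volume ω * sqNorm b (f 0) = ∫⁻ y in ω, ∫⁻ z in b, ‖f 0 z‖ₑ ^ 2 := by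
    rw [setLIntegral_const, sqNorm, mul_comm]
  rw [h1, h2]
  refine le_trans ?_ (mul_le_mul_right (add_le_add_right
    (hf.lintegral_sub_le hω hc hb hbω hd) _) 2)
  rw [← lintegral_add_left (by fun_prop), ← lintegral_const_mul' _ _ (by simp)]
  refine lintegral_mono fun y => ?_
  rw [← lintegral_add_left (by fun_prop), ← lintegral_const_mul' _ _ (by simp)]
  refine lintegral_mono fun z => ?_
  have := enorm_add_sq_le (f 0 z) (-(f 0 z - f 0 y))
  rw [enorm_neg] at this
  simpa using this

/-- **Poincaré inequality** on a convex set of diameter at most `h` relative to a ball of comparable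
radius. -/
theorem Jet.poincare {ω : Set (E n)} (hω : IsOpen ω) (hc : Convex ℝ ω) {c : E n} {ρ h l : ℝ}
    (hρ : 0 < ρ) (hl : h ≤ l * ρ) (hh : 0 < h)
    (hbω : Metric.ball c ρ ⊆ ω) (hd : ∀ x ∈ ω, ∀ y ∈ ω, dist x y ≤ h)
    {f : (Fin n → ℕ) → E n → ℂ} (hf : Jet 1 ω f) :
    sqNorm ω (f 0) ≤ 2 * ENNReal.ofReal (l ^ n) * (n + 1) *
      (sqNorm (Metric.ball c ρ) (f 0) +
        ENNReal.ofReal h ^ 2 * ∑ i, sqNorm ω (f (Pi.single i 1))) := by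
  have hl0 : 0 ≤ l := by
    by_contra hneg
    push Not at hneg
    nlinarith
  have key := hf.poincare_volume hω hc Metric.isOpen_ball.measurableSet hbω hd
  have hfin : Module.finrank ℝ (E n) = n := by simp
  set v := volume (Metric.ball (0 : E n) 1) with hv
  have hv0 : v ≠ 0 := (Metric.measure_ball_pos volume _ one_pos).ne'
  have hvt : v ≠ ∞ := measure_ball_lt_top.ne
  have hvb : volume (Metric.ball c ρ) = ENNReal.ofReal (ρ ^ n) * v := by
    rw [Measure.addHaar_ball_of_pos _ _ hρ, hfin]
  -- As h ≤ lρ, both ω and the ball of translations have volume at most l^n times that of the small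
  -- ball, whose volume then cancels.
  have hvB : ∀ z : E n, volume (Metric.closedBall z h) ≤ ENNReal.ofReal (l ^ n) *
      volume (Metric.ball c ρ) := by
    intro z
    rw [Measure.addHaar_closedBall _ _ hh.le, hfin, hvb, ← mul_assoc,
      ← ENNReal.ofReal_mul (by positivity), ← mul_pow]
    gcongr
  have hvω : volume ω ≤ ENNReal.ofReal (l ^ n) * volume (Metric.ball c ρ) := by
    refine (measure_mono fun x hx => ?_).trans (hvB c)
    exact hd x hx c (hbω (Metric.mem_ball_self hρ))
  set vb := volume (Metric.ball c ρ) with hvbdef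
  have hvb0 : vb ≠ 0 := (Metric.measure_ball_pos volume _ hρ).ne'
  have hvbt : vb ≠ ∞ := measure_ball_lt_top.ne
  set Λ := ENNReal.ofReal (l ^ n)
  set Sb := sqNorm (Metric.ball c ρ) (f 0)
  set Sd := ENNReal.ofReal h ^ 2 * ∑ i, sqNorm ω (f (Pi.single i 1))
  have h1 : vb * sqNorm ω (f 0) ≤ vb * (2 * Λ * (n + 1) * (Sb + Sd)) := by
    calc vb * sqNorm ω (f 0) ≤ 2 * (Λ * vb * Sb + Λ * vb * (n * Sd)) := by
          refine key.trans ?_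
          rw [mul_assoc (n : ℝ≥0∞)]
          gcongr
          exact hvB 0
      _ = vb * (2 * Λ * (1 * Sb + n * Sd)) := by ring
      _ ≤ vb * (2 * Λ * ((n + 1) * Sb + (n + 1) * Sd)) := by
          gcongr
          · exact le_add_self
          · exact le_self_add
      _ = _ := by ring
  exact (ENNReal.mul_le_mul_iff_right hvb0 hvbt).1 h1

/-- The iterated Poincaré inequality. -/
theorem exists_poincare_iterate (n : ℕ) (l : ℝ) (k : ℕ) : ∃ C : ℝ≥0∞, C ≠ ∞ ∧
    ∀ {ω : Set (E n)} {c : E n} {ρ h : ℝ}, IsOpen ω → Convex ℝ ω → 0 < ρ → h ≤ l * ρ → 0 < h →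
      Metric.ball c ρ ⊆ ω → (∀ x ∈ ω, ∀ y ∈ ω, dist x y ≤ h) →
      ∀ {f : (Fin n → ℕ) → E n → ℂ}, Jet k ω f → ∀ γ, deg γ ≤ k →
        wsq h ω f γ ≤ C * (∑ δ ∈ multiIndices n k, wsq h (Metric.ball c ρ) f δ +
          ∑ δ ∈ (multiIndices n k).filter (fun δ => deg δ = k), wsq h ω f δ) := by
  -- Induction on the number m = k - |γ| of missing orders. Poincaré for ∂^γ f trades it for its
  -- values on the ball and for derivatives one order higher, with a factor h² that the scaling in
  -- `wsq` absorbs.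
  have main : ∀ m, ∃ C : ℝ≥0∞, C ≠ ∞ ∧
    ∀ {ω : Set (E n)} {c : E n} {ρ h : ℝ}, IsOpen ω → Convex ℝ ω → 0 < ρ → h ≤ l * ρ → 0 < h →
      Metric.ball c ρ ⊆ ω → (∀ x ∈ ω, ∀ y ∈ ω, dist x y ≤ h) →
      ∀ {f : (Fin n → ℕ) → E n → ℂ}, Jet k ω f → ∀ γ, deg γ + m = k →
        wsq h ω f γ ≤ C * (∑ δ ∈ multiIndices n k, wsq h (Metric.ball c ρ) f δ +
          ∑ δ ∈ (multiIndices n k).filter (fun δ => deg δ = k), wsq h ω f δ) := by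
    intro m
    induction m with
    | zero =>
      refine ⟨1, by simp, fun hω hc hρ hl hh hb hd f hf γ hγ => ?_⟩
      rw [one_mul]
      refine le_trans ?_ le_add_self
      exact Finset.single_le_sum (f := fun δ => wsq _ _ f δ) (fun _ _ => zero_le)
        (Finset.mem_filter.2 ⟨mem_multiIndices.2 (by omega), by omega⟩)
    | succ m ih =>
      obtain ⟨C, hC, hCm⟩ := ih
      refine ⟨2 * ENNReal.ofReal (l ^ n) * (n + 1) * (1 + n * C), ?_, ?_⟩
      · finiteness
      · intro ω c ρ h hω hc hρ hl hh hb hd f hf γ hγ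
        have h1 := (hf.shift_add (γ := γ) (l := 1) (by omega)).poincare hω hc hρ hl hh hb hd
        simp only [add_zero] at h1
        set R := ∑ δ ∈ multiIndices n k, wsq h (Metric.ball c ρ) f δ +
          ∑ δ ∈ (multiIndices n k).filter (fun δ => deg δ = k), wsq h ω f δ with hR
        have h2 : wsq h (Metric.ball c ρ) f γ ≤ R := by
          refine le_trans ?_ le_self_add
          exact Finset.single_le_sum (f := fun δ => wsq _ _ f δ) (fun _ _ => zero_le)
            (mem_multiIndices.2 (by omega))
        have h3 : ∀ i, wsq h ω f (γ + Pi.single i 1) ≤ C * R := fun i =>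
          hCm hω hc hρ hl hh hb hd hf _ (by rw [deg_add_single]; omega)
        have h4 : ∑ i, wsq h ω f (γ + Pi.single i 1) ≤ n * (C * R) := by
          refine (Finset.sum_le_sum fun i _ => h3 i).trans ?_
          simp
        set P := 2 * ENNReal.ofReal (l ^ n) * ((n : ℝ≥0∞) + 1)
        calc wsq h ω f γ ≤ ENNReal.ofReal h ^ (2 * deg γ) *
              (P * (sqNorm (Metric.ball c ρ) (f γ) +
                ENNReal.ofReal h ^ 2 * ∑ i, sqNorm ω (f (γ + Pi.single i 1)))) := by
              unfold wsq; gcongr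
          _ = P * (wsq h (Metric.ball c ρ) f γ + ∑ i, wsq h ω f (γ + Pi.single i 1)) := by
              simp only [wsq, deg_add_single, mul_add, mul_one, pow_add, Finset.mul_sum]
              congr 1
              · ring
              · exact Finset.sum_congr rfl fun i _ => by ring
          _ ≤ P * (R + n * (C * R)) := by gcongr
          _ = P * (1 + n * C) * R := by ring
  choose C hC hCm using main
  refine ⟨∑ m ∈ Finset.range (k + 1), C m, ?_, ?_⟩
  · exact (ENNReal.sum_lt_top.2 fun m _ => (hC m).lt_top).ne
  · intro ω c ρ h hω hc hρ hl hh hb hd f hf γ hγ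
    refine (hCm (k - deg γ) hω hc hρ hl hh hb hd hf γ (by omega)).trans ?_
    gcongr
    exact Finset.single_le_sum (f := C) (fun _ _ => zero_le)
      (Finset.mem_range.2 (by omega))

theorem Jet.congr_ae {k : ℕ} {V : Set (E n)} {f g : (Fin n → ℕ) → E n → ℂ} (hV : IsOpen V)
    (hf : Jet k V f) (hg : ∀ α, Measurable (g α)) (hz : ∀ α x, x ∉ V → g α x = 0)
    (h : ∀ α, deg α ≤ k → f α =ᵐ[volume.restrict V] g α) : Jet k V g := by
  refine ⟨hg, hz, fun α hα => ?_, fun α i hα => ?_⟩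
  · refine (hf.memLp α hα).ae_eq ?_
    have := (ae_restrict_iff' hV.measurableSet).1 (h α hα)
    filter_upwards [this] with x hx
    by_cases hxV : x ∈ V
    · exact hx hxV
    · rw [hf.zero α x hxV, hz α x hxV]
  · exact (hf.deriv α i hα).congr (h α hα.le) (h _ (by rw [deg_add_single]; omega))

/-- A jet vanishes almost everywhere on an open set where its base function does. -/
theorem Jet.ae_zero_of_ae_zero {k : ℕ} {U V : Set (E n)} {f : (Fin n → ℕ) → E n → ℂ}
    (hf : Jet k V f) (hU : IsOpen U) (hUV : U ⊆ V) (h0 : f 0 =ᵐ[volume.restrict U] 0)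
    {α : Fin n → ℕ} (hα : deg α ≤ k) : f α =ᵐ[volume.restrict U] 0 := by
  have h1 := (hf.restrict hU hUV).unique hU (Jet.zero_jet k U)
    ((indicator_ae_eq_restrict hU.measurableSet).trans h0) hα
  exact (indicator_ae_eq_restrict hU.measurableSet).symm.trans h1

/-- Two jets agree almost everywhere on an open set where their base functions do. -/
theorem Jet.ae_eq_on {k : ℕ} {U V W : Set (E n)} {f g : (Fin n → ℕ) → E n → ℂ}
    (hf : Jet k V f) (hg : Jet k W g) (hU : IsOpen U) (hUV : U ⊆ V) (hUW : U ⊆ W)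
    (h0 : f 0 =ᵐ[volume.restrict U] g 0) {α : Fin n → ℕ} (hα : deg α ≤ k) :
    f α =ᵐ[volume.restrict U] g α := by
  have e : ∀ F : E n → ℂ, U.indicator F =ᵐ[volume.restrict U] F :=
    fun F => indicator_ae_eq_restrict hU.measurableSet
  have h1 := (hf.restrict hU hUV).unique hU (hg.restrict hU hUW)
    ((e _).trans (h0.trans (e _).symm)) hα
  exact (e _).symm.trans (h1.trans (e _))

/-! ### Bounded overlap -/

/-- Sums of integrals over sets with bounded overlap. -/
theorem sum_setLIntegral_le {ι : Type*} (s : Finset ι) {κ : ℕ} {U W : ι → Set (E n)}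
    {V : Set (E n)} (hUm : ∀ j ∈ s, MeasurableSet (U j)) (hUV : ∀ j ∈ s, U j ⊆ V)
    (hUW : ∀ j ∈ s, U j ⊆ W j) (hW : ∀ x, {j | x ∈ W j}.encard ≤ κ) {F : E n → ℝ≥0∞}
    (hF : Measurable F) : ∑ j ∈ s, ∫⁻ x in U j, F x ≤ κ * ∫⁻ x in V, F x := by
  classical
  have h1 : ∀ j ∈ s, ∫⁻ x in U j, F x = ∫⁻ x in V, (U j).indicator F x := by
    intro j hj
    rw [lintegral_indicator (hUm j hj), Measure.restrict_restrict_of_subset (hUV j hj)]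
  rw [Finset.sum_congr rfl h1, ← lintegral_finsetSum _ fun j hj => hF.indicator (hUm j hj),
    ← lintegral_const_mul _ hF]
  refine lintegral_mono fun x => ?_
  have h2 : ∑ j ∈ s, (U j).indicator F x = ((s.filter fun j => x ∈ U j).card : ℝ≥0∞) * F x := by
    simp only [indicator_apply]
    rw [← Finset.sum_filter, Finset.sum_const, nsmul_eq_mul]
  rw [h2]
  gcongr
  have h3 : ((s.filter fun j => x ∈ U j).card : ℕ∞) ≤ κ := by
    rw [← Set.encard_coe_eq_coe_finsetCard]
    refine (Set.encard_le_encard fun j hj => ?_).trans (hW x)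
    rw [Finset.mem_coe, Finset.mem_filter] at hj
    exact hUW j hj.1 hj.2
  exact_mod_cast h3

/-- Sums of functions supported in sets with bounded overlap. -/
theorem sqNorm_sum_le_of_overlap {ι : Type*} (s : Finset ι) {κ : ℕ} {W : ι → Set (E n)}
    {V : Set (E n)} (hW : ∀ x, {j | x ∈ W j}.encard ≤ κ) {q : ι → E n → ℂ}
    (hq : ∀ j ∈ s, Measurable (q j))
    (hz : ∀ j ∈ s, ∀ᵐ x ∂(volume.restrict V), x ∉ W j → q j x = 0) :
    sqNorm V (fun x => ∑ j ∈ s, q j x) ≤ κ * ∑ j ∈ s, sqNorm V (q j) := by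
  classical
  unfold sqNorm
  rw [← lintegral_finsetSum _ fun j hj => (hq j hj).enorm.pow_const 2,
    ← lintegral_const_mul' _ _ (by simp)]
  refine lintegral_mono_ae ?_
  have hz' : ∀ᵐ x ∂(volume.restrict V), ∀ j ∈ s, x ∉ W j → q j x = 0 :=
    (Filter.eventually_all_finset s).2 hz
  filter_upwards [hz'] with x hx
  -- At x only these at most κ terms survive, so Cauchy–Schwarz costs κ and not the number of
  -- summands.
  set t := s.filter fun j => x ∈ W j with ht
  have hts : t ⊆ s := Finset.filter_subset _ _
  have hout : ∀ j ∈ s, j ∉ t → q j x = 0 := fun j hj hjt =>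
    hx j hj fun h => hjt (Finset.mem_filter.2 ⟨hj, h⟩)
  have h3 : (t.card : ℕ∞) ≤ κ := by
    rw [← Set.encard_coe_eq_coe_finsetCard]
    refine (Set.encard_le_encard fun j hj => ?_).trans (hW x)
    exact (Finset.mem_filter.1 hj).2
  have h4 : (t.card : ℝ≥0∞) ≤ κ := by exact_mod_cast h3
  rw [← Finset.sum_subset hts hout]
  calc ‖∑ j ∈ t, q j x‖ₑ ^ 2 ≤ (∑ j ∈ t, ‖q j x‖ₑ) ^ 2 := by
        gcongr; exact enorm_sum_le _ _
    _ ≤ t.card * ∑ j ∈ t, ‖q j x‖ₑ ^ 2 := by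
        simp only [enorm_eq_nnnorm]
        exact_mod_cast sq_sum_le_card_mul_sum_sq (s := t) (f := fun i => ‖q i x‖₊)
    _ ≤ κ * ∑ j ∈ s, ‖q j x‖ₑ ^ 2 := by gcongr

/-! ### Generalized finite element spaces -/

namespace Family

variable {G : Family n} {Ω : Set (E n)} {m κ : ℕ} {σ A B h : ℝ} {Cφ : ℕ → ℝ}

/-- The ratio controlling `h` by the radii of the balls and the diameters of the patches. -/
noncomputable def ratio (σ : ℝ) : ℝ := max 1 (2 / σ)

theorem one_le_ratio : 1 ≤ ratio σ := le_max_left _ _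

theorem AssumptionA.radius_pos (hA : G.AssumptionA Ω σ h) (hσ : 0 < σ) (hh : 0 < h)
    (j : Fin G.N) : 0 < G.radius j := by
  have := hA.le_diam_star j
  have := mul_pos hσ hh
  linarith

theorem AssumptionA.le_ratio_mul_radius (hA : G.AssumptionA Ω σ h) (hσ : 0 < σ) (hh : 0 < h)
    (j : Fin G.N) : h ≤ ratio σ * G.radius j := by
  have h1 := hA.le_diam_star j
  have h2 := hA.radius_pos hσ hh j
  calc h ≤ 2 / σ * G.radius j := by
        rw [div_mul_eq_mul_div, le_div_iff₀ hσ]; linarith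
    _ ≤ _ := by gcongr; exact le_max_right _ _

/-- Positive dimension supplies a unit vector, and the closed ball lies in the patch, so the patch
contains two points at distance exactly the radius. -/
theorem AssumptionA.radius_le_diam (hn : 0 < n) (hA : G.AssumptionA Ω σ h) (hσ : 0 < σ)
    (hh : 0 < h) (j : Fin G.N) : G.radius j ≤ Metric.diam (G.patch j) := by
  have hr := hA.radius_pos hσ hh j
  have hcl := hA.closure_star j
  rw [star, closure_ball _ hr.ne'] at hcl
  have h1 : G.center j ∈ G.patch j := hcl (Metric.mem_closedBall_self hr.le)
  have h2 : G.center j + G.radius j • EuclideanSpace.single (⟨0, hn⟩ : Fin n) (1 : ℝ)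
      ∈ G.patch j := by
    apply hcl
    simp [norm_smul, abs_of_pos hr]
  have := Metric.dist_le_diam_of_mem (hA.bounded j) h1 h2
  simpa [norm_smul, abs_of_pos hr] using this

theorem AssumptionA.diam_pos (hn : 0 < n) (hA : G.AssumptionA Ω σ h) (hσ : 0 < σ)
    (hh : 0 < h) (j : Fin G.N) : 0 < Metric.diam (G.patch j) :=
  (hA.radius_pos hσ hh j).trans_le (hA.radius_le_diam hn hσ hh j)

theorem AssumptionA.le_ratio_mul_diam (hn : 0 < n) (hA : G.AssumptionA Ω σ h) (hσ : 0 < σ)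
    (hh : 0 < h) (j : Fin G.N) : h ≤ ratio σ * Metric.diam (G.patch j) := by
  refine (hA.le_ratio_mul_radius hσ hh j).trans ?_
  gcongr
  · exact zero_le_one.trans one_le_ratio
  · exact hA.radius_le_diam hn hσ hh j

theorem AssumptionA.star_subset_patch (hA : G.AssumptionA Ω σ h) (j : Fin G.N) :
    G.star j ⊆ G.patch j := subset_closure.trans (hA.closure_star j)

/-- The bound for the scaled derivatives of the partition of unity. -/
noncomputable def pouBound (m : ℕ) (σ : ℝ) (Cφ : ℕ → ℝ) : ℝ :=
  ∑ k ∈ Finset.range (m + 1), |Cφ k| * ratio σ ^ k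

theorem pouBound_nonneg : 0 ≤ pouBound m σ Cφ :=
  Finset.sum_nonneg fun _ _ => mul_nonneg (abs_nonneg _)
    (pow_nonneg (zero_le_one.trans one_le_ratio) _)

/-- The (closed) support of `φ_j`. -/
def pouSupport (G : Family n) (Ω : Set (E n)) (j : Fin G.N) : Set (E n) :=
  closure {x ∈ Ω | G.pou j x ≠ 0}

/-- Bounded derivatives on a bounded set are square integrable, and h ≤ `ratio σ` · d_j turns the
powers of d_j into powers of h. The entries can be cut off to the closed support because weak
derivatives vanish almost everywhere on the open set where φ_j does. -/
theorem exists_pou_jet (hn : 0 < n) (hΩ : IsOpen Ω) (hΩb : Bornology.IsBounded Ω) (hσ : 0 < σ)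
    (hh : 0 < h) (hA : G.AssumptionA Ω σ h) (hP : G.IsPartition Ω m κ Cφ) (j : Fin G.N) :
    ∃ p, Jet m Ω p ∧ p 0 =ᵐ[volume.restrict Ω] (fun x => (G.pou j x : ℂ)) ∧
      (∀ β, deg β ≤ m → ∀ᵐ x ∂(volume : Measure (E n)),
        h ^ deg β * ‖p β x‖ ≤ pouBound m σ Cφ) ∧
      ∀ β, deg β ≤ m → ∀ x, x ∉ pouSupport G Ω j → p β x = 0 := by
  have hfin : volume Ω < ∞ := hΩb.measure_lt_top
  have : IsFiniteMeasure (volume.restrict Ω) := ⟨by rwa [Measure.restrict_apply_univ]⟩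
  have h1 : ∀ α, deg α ≤ m → weakDerivNorm ∞ α Ω (fun x => (G.pou j x : ℂ)) < ∞ := fun α hα =>
    (hP.deriv_le j α (mem_multiIndices.2 hα)).trans_lt ENNReal.ofReal_lt_top
  choose! v hv hv2 using fun α (hα : deg α ≤ m) => exists_of_weakDerivNorm_lt_top (h1 α hα)
  have hv2' : ∀ α, deg α ≤ m → eLpNorm (v α) 2 (volume.restrict Ω) < ∞ := fun α hα =>
    (MemLp.mono_exponent ⟨(hv α hα).2.1.aestronglyMeasurable, hv2 α hα⟩ le_top).2
  obtain ⟨f, hf, hf0, hfv⟩ := exists_jet_of_hasWeakDeriv hΩ v hv hv2'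
  set T := pouSupport G Ω j with hT
  have hTc : IsClosed T := isClosed_closure
  have hU : IsOpen (Ω \ T) := hΩ.sdiff hTc
  have hzero : ∀ α, deg α ≤ m → f α =ᵐ[volume.restrict (Ω \ T)] 0 := by
    intro α hα
    refine hf.ae_zero_of_ae_zero hU sdiff_subset ?_ hα
    filter_upwards [ae_restrict_of_ae_restrict_of_subset sdiff_subset hf0,
      ae_restrict_mem hU.measurableSet] with x hx hxU
    rw [hx]
    have : G.pou j x = 0 := by
      by_contra hc
      exact hxU.2 (subset_closure ⟨hxU.1, hc⟩)
    simp [this]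
  have hind : ∀ α, deg α ≤ m → f α =ᵐ[volume.restrict Ω] T.indicator (f α) := by
    intro α hα
    have := (ae_restrict_iff' hU.measurableSet).1 (hzero α hα)
    refine (ae_restrict_iff' hΩ.measurableSet).2 ?_
    filter_upwards [this] with x hx hxΩ
    by_cases hxT : x ∈ T
    · rw [indicator_of_mem hxT]
    · rw [indicator_of_notMem hxT, hx ⟨hxΩ, hxT⟩]
      rfl
  refine ⟨fun α => T.indicator (f α),
    hf.congr_ae hΩ (fun α => (hf.meas α).indicator hTc.measurableSet) (fun α x hx => ?_) hind,
    ((hind 0 (by simp)).symm).trans hf0, fun β hβ => ?_, fun β hβ x hx => ?_⟩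
  · by_cases hxT : x ∈ T
    · rw [indicator_of_mem hxT, hf.zero α x hx]
    · rw [indicator_of_notMem hxT]
  · have hd := hA.diam_pos hn hσ hh j
    have hle := hA.le_ratio_mul_diam hn hσ hh j
    set d := Metric.diam (G.patch j) with hddef
    have hb : eLpNorm (f β) ∞ (volume.restrict Ω)
        ≤ ENNReal.ofReal (Cφ (deg β) / d ^ deg β) := by
      rw [eLpNorm_congr_ae (hfv β hβ), ← weakDerivNorm_eq hΩ (hv β hβ)]
      exact hP.deriv_le j β (mem_multiIndices.2 hβ)
    -- The constants `Cφ` carry no sign assumption, hence the absolute value.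
    have hae : ∀ᵐ x ∂(volume.restrict Ω), ‖f β x‖ ≤ |Cφ (deg β)| / d ^ deg β := by
      rw [eLpNorm_exponent_top] at hb
      filter_upwards [ae_le_eLpNormEssSup (f := f β) (μ := volume.restrict Ω)] with x hx
      have h2 := hx.trans hb
      have h3 : ENNReal.ofReal ‖f β x‖ ≤ ENNReal.ofReal (|Cφ (deg β)| / d ^ deg β) := by
        rw [ofReal_norm]
        refine h2.trans (ENNReal.ofReal_le_ofReal ?_)
        gcongr
        exact le_abs_self _
      exact (ENNReal.ofReal_le_ofReal_iff (by positivity)).1 h3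
    have hae' := (ae_restrict_iff' hΩ.measurableSet).1 hae
    filter_upwards [hae'] with x hx
    by_cases hxm : x ∈ Ω ∧ x ∈ T
    · rw [indicator_of_mem hxm.2]
      calc h ^ deg β * ‖f β x‖ ≤ (ratio σ * d) ^ deg β * (|Cφ (deg β)| / d ^ deg β) := by
            have := zero_le_one.trans (one_le_ratio (σ := σ))
            gcongr
            exact hx hxm.1
        _ = |Cφ (deg β)| * ratio σ ^ deg β := by
            rw [mul_pow]; field_simp
        _ ≤ pouBound m σ Cφ :=
            Finset.single_le_sum (f := fun k => |Cφ k| * ratio σ ^ k)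
              (fun _ _ => mul_nonneg (abs_nonneg _)
                (pow_nonneg (zero_le_one.trans one_le_ratio) _))
              (Finset.mem_range.2 (by omega))
    · have : T.indicator (f β) x = 0 := by
        by_cases hxT : x ∈ T
        · rw [indicator_of_mem hxT, hf.zero β x fun hc => hxm ⟨hc, hxT⟩]
        · rw [indicator_of_notMem hxT]
      rw [this]
      simpa using pouBound_nonneg
  · exact indicator_of_notMem hx _

open Classical in
/-- The indices of the functions `φ_j` that do not vanish identically on `Ω`. -/
noncomputable def active (G : Family n) (Ω : Set (E n)) : Finset (Fin G.N) :=
  Finset.univ.filter fun j => ∃ x ∈ Ω, G.pou j x ≠ 0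

theorem mem_active {j : Fin G.N} : j ∈ G.active Ω ↔ ∃ x ∈ Ω, G.pou j x ≠ 0 := by
  simp [active]

theorem pou_eq_zero {j : Fin G.N} (hj : j ∉ G.active Ω) {x : E n} (hx : x ∈ Ω) :
    G.pou j x = 0 := by
  by_contra hc
  exact hj (mem_active.2 ⟨x, hx, hc⟩)

/-- The constant in the localization estimate. -/
noncomputable def glueConst (n m κ : ℕ) (σ : ℝ) (Cφ : ℕ → ℝ) : ℝ≥0∞ :=
  κ * (ENNReal.ofReal (2 ^ m * pouBound m σ Cφ) ^ 2 * (multiIndices n m).card)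

theorem glueConst_ne_top : glueConst n m κ σ Cφ ≠ ∞ := by
  unfold glueConst
  finiteness

/-- Gluing local functions with the partition of unity. -/
theorem exists_glue (hn : 0 < n) (hΩ : IsOpen Ω) (hΩb : Bornology.IsBounded Ω) (hσ : 0 < σ)
    (hh : 0 < h) (hA : G.AssumptionA Ω σ h) (hP : G.IsPartition Ω m κ Cφ) {k : ℕ} (hk : k ≤ m)
    {u : Fin G.N → (Fin n → ℕ) → E n → ℂ} (hu : ∀ j ∈ G.active Ω, Jet k (G.patch j) (u j)) :
    ∃ q, Jet k Ω q ∧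
      q 0 =ᵐ[volume.restrict Ω] (fun x => ∑ j, (G.pou j x : ℂ) * u j 0 x) ∧
      ∀ α, deg α ≤ k → wsq h Ω q α ≤ glueConst n m κ σ Cφ *
        ∑ j ∈ G.active Ω, ∑ γ ∈ multiIndices n k, wsq h (G.patch j) (u j) γ := by
  choose p hp hp0 hpM hpT using fun j => exists_pou_jet hn hΩ hΩb hσ hh hA hP j
  have hex : ∀ j, ∃ q, j ∈ G.active Ω → Jet k Ω q ∧
      q 0 =ᵐ[volume.restrict Ω] (fun x => p j 0 x * u j 0 x) ∧
      (∀ α, deg α ≤ k → ∀ᵐ x ∂(volume.restrict Ω), x ∉ pouSupport G Ω j → q α x = 0) ∧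
      ∀ α, deg α ≤ k → wsq h Ω q α ≤ ENNReal.ofReal (2 ^ k * pouBound m σ Cφ) ^ 2 *
        (multiIndices n k).card * ∑ γ ∈ multiIndices n k, wsq h (G.patch j) (u j) γ := by
    intro j
    by_cases hj : j ∈ G.active Ω
    · obtain ⟨q, hq⟩ := Jet.exists_mul hΩ (hP.isOpen j) (isClosed_closure : IsClosed
        (pouSupport G Ω j)) (hP.support j) hh ((hp j).mono_order hk) (hu j hj) pouBound_nonneg
        (fun β hβ => hpM j β (hβ.trans hk)) (fun β hβ => hpT j β (hβ.trans hk))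
      exact ⟨q, fun _ => hq⟩
    · exact ⟨0, fun hc => absurd hc hj⟩
  choose q hq using hex
  refine ⟨fun α x => ∑ j ∈ G.active Ω, q j α x, Jet.sum _ fun j hj => (hq j hj).1, ?_,
    fun α hα => ?_⟩
  · have h1 : ∀ᵐ x ∂(volume.restrict Ω), ∀ j ∈ G.active Ω, q j 0 x = p j 0 x * u j 0 x :=
      (Filter.eventually_all_finset _).2 fun j hj => (hq j hj).2.1
    have h2 : ∀ᵐ x ∂(volume.restrict Ω), ∀ j, p j 0 x = (G.pou j x : ℂ) :=
      ae_all_iff.2 hp0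
    filter_upwards [h1, h2, ae_restrict_mem hΩ.measurableSet] with x hx1 hx2 hxΩ
    have h3 : ∑ j ∈ G.active Ω, q j 0 x = ∑ j ∈ G.active Ω, (G.pou j x : ℂ) * u j 0 x :=
      Finset.sum_congr rfl fun j hj => by rw [hx1 j hj, hx2 j]
    rw [h3]
    refine Finset.sum_subset (Finset.subset_univ _) fun j _ hj => ?_
    simp [pou_eq_zero hj hxΩ]
  -- Each product vanishes on Ω off its own patch, so the overlap bound keeps the constant
  -- independent of the number of patches.
  · have h1 : sqNorm Ω (fun x => ∑ j ∈ G.active Ω, q j α x)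
        ≤ κ * ∑ j ∈ G.active Ω, sqNorm Ω (q j α) := by
      refine sqNorm_sum_le_of_overlap _ hP.overlap (fun j hj => (hq j hj).1.meas α)
        fun j hj => ?_
      filter_upwards [(hq j hj).2.2.1 α hα, ae_restrict_mem hΩ.measurableSet] with x hx hxΩ hxW
      exact hx fun hc => hxW (hP.support j ⟨hc, hxΩ⟩)
    calc wsq h Ω (fun α x => ∑ j ∈ G.active Ω, q j α x) α
        ≤ κ * ∑ j ∈ G.active Ω, wsq h Ω (q j) α := by
          simp only [wsq]
          rw [← Finset.mul_sum, mul_left_comm]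
          gcongr
      _ ≤ κ * ∑ j ∈ G.active Ω, ENNReal.ofReal (2 ^ m * pouBound m σ Cφ) ^ 2 *
            (multiIndices n m).card * ∑ γ ∈ multiIndices n k, wsq h (G.patch j) (u j) γ := by
          gcongr with j hj
          refine ((hq j hj).2.2.2 α hα).trans ?_
          have := pouBound_nonneg (m := m) (σ := σ) (Cφ := Cφ)
          gcongr
          · norm_num
          · exact multiIndices_mono hk
      _ = _ := by
          rw [← Finset.mul_sum, glueConst]
          ring

end Family

/-! ### Sobolev norms, pairings and dual norms -/

/-- The square of the `H^k(V)` norm of a jet. -/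
noncomputable def sobSum (k : ℕ) (V : Set (E n)) (f : (Fin n → ℕ) → E n → ℂ) : ℝ≥0∞ :=
  ∑ α ∈ multiIndices n k, sqNorm V (f α)

theorem sqNorm_le_sobSum {k : ℕ} {V : Set (E n)} {f : (Fin n → ℕ) → E n → ℂ} {α : Fin n → ℕ}
    (hα : deg α ≤ k) : sqNorm V (f α) ≤ sobSum k V f :=
  Finset.single_le_sum (f := fun α => sqNorm V (f α)) (fun _ _ => zero_le)
    (mem_multiIndices.2 hα)

theorem multiIndices_zero : multiIndices n 0 = {0} := by
  ext α
  rw [mem_multiIndices, Finset.mem_singleton]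
  exact ⟨fun h => deg_eq_zero (by omega), fun h => by simp [h]⟩

theorem sobSum_zero (V : Set (E n)) (f : (Fin n → ℕ) → E n → ℂ) :
    sobSum 0 V f = sqNorm V (f 0) := by
  simp [sobSum, multiIndices_zero]

theorem sobolevNorm_mono_order {k l : ℕ} (h : k ≤ l) (V : Set (E n)) (u : E n → ℂ) :
    sobolevNorm k V u ≤ sobolevNorm l V u := by
  unfold sobolevNorm
  gcongr
  exact multiIndices_mono h

theorem MemSobolev.mono_order {k l : ℕ} (h : k ≤ l) {V : Set (E n)} {u : E n → ℂ}
    (hu : MemSobolev l V u) : MemSobolev k V u :=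
  (sobolevNorm_mono_order h V u).trans_lt hu

theorem MemSobolev.sobolevNorm_zero_sq {V : Set (E n)} (hV : IsOpen V) {u : E n → ℂ}
    (hu : MemSobolev 0 V u) : sobolevNorm 0 V u ^ 2 = sqNorm V u := by
  obtain ⟨f, hf, hf0⟩ := hu.exists_jet hV
  rw [hf.sobolevNorm_sq hV hf0 le_rfl]
  change sobSum 0 V f = _
  rw [sobSum_zero, sqNorm_congr hf0]

theorem MemSobolev.aemeasurable {V : Set (E n)} (hV : IsOpen V) {u : E n → ℂ}
    (hu : MemSobolev 0 V u) : AEMeasurable u (volume.restrict V) := by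
  obtain ⟨f, hf, hf0⟩ := hu.exists_jet hV
  exact (hf.meas 0).aemeasurable.congr hf0

theorem MemSobolev.memLp {V : Set (E n)} (hV : IsOpen V) {u : E n → ℂ}
    (hu : MemSobolev 0 V u) : MemLp u 2 (volume.restrict V) := by
  obtain ⟨f, hf, hf0⟩ := hu.exists_jet hV
  exact ((hf.memLp 0 (by simp)).restrict V).ae_eq hf0

/-- Cauchy--Schwarz for the `L²` pairing. -/
theorem enorm_pairing_le {V : Set (E n)} (hV : IsOpen V) {u φ : E n → ℂ}
    (hu : MemSobolev 0 V u) (hφ : MemSobolev 0 V φ) :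
    ‖∫ x in V, u x * conj (φ x)‖ₑ ≤ sobolevNorm 0 V u * sobolevNorm 0 V φ := by
  rw [← ENNReal.pow_le_pow_left_iff (n := 2) (by norm_num), mul_pow, hu.sobolevNorm_zero_sq hV,
    hφ.sobolevNorm_zero_sq hV]
  have h1 : ‖∫ x in V, u x * conj (φ x)‖ₑ ≤ ∫⁻ x in V, ‖u x‖ₑ * ‖φ x‖ₑ := by
    refine (enorm_integral_le_lintegral_enorm _).trans (le_of_eq (lintegral_congr fun x => ?_))
    rw [enorm_mul, RCLike.enorm_conj]
  have h2 := ENNReal.lintegral_mul_le_Lp_mul_Lq (volume.restrict V) Real.HolderConjugate.two_two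
    (hu.aemeasurable hV).enorm (hφ.aemeasurable hV).enorm
  simp only [Pi.mul_apply, ENNReal.rpow_ofNat] at h2
  calc ‖∫ x in V, u x * conj (φ x)‖ₑ ^ 2
      ≤ ((∫⁻ x in V, ‖u x‖ₑ ^ 2) ^ (1 / 2 : ℝ) * (∫⁻ x in V, ‖φ x‖ₑ ^ 2) ^ (1 / 2 : ℝ)) ^ 2 := by
        gcongr; exact h1.trans h2
    _ = sqNorm V u * sqNorm V φ := by
        rw [mul_pow, ← ENNReal.rpow_natCast, ← ENNReal.rpow_natCast, ← ENNReal.rpow_mul,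
          ← ENNReal.rpow_mul]
        norm_num [sqNorm]

theorem enorm_pairing_self {V : Set (E n)} (hV : IsOpen V) {u : E n → ℂ}
    (hu : MemSobolev 0 V u) : ‖∫ x in V, u x * conj (u x)‖ₑ = sobolevNorm 0 V u ^ 2 := by
  rw [hu.sobolevNorm_zero_sq hV]
  have h1 : ∀ x, u x * conj (u x) = ((‖u x‖ ^ 2 : ℝ) : ℂ) := fun x => by
    rw [Complex.mul_conj, Complex.normSq_eq_norm_sq]
  simp only [h1]
  rw [integral_complex_ofReal, ← ofReal_norm, Complex.norm_real, Real.norm_of_nonneg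
    (integral_nonneg fun x => by positivity), ofReal_integral_eq_lintegral_ofReal
    ((hu.memLp hV).integrable_norm_pow (by norm_num))
    (Eventually.of_forall fun x => by positivity)]
  unfold sqNorm
  refine lintegral_congr fun x => ?_
  rw [ENNReal.ofReal_pow (norm_nonneg _), ofReal_norm]

theorem enorm_pairing_le_dual {V : Set (E n)} (hV : IsOpen V) {k : ℕ} {u φ : E n → ℂ}
    (hu : MemSobolev 0 V u) (hφ : MemSobolev k V φ) :
    ‖∫ x in V, u x * conj (φ x)‖ₑ ≤ sobolevDualNorm k V u * sobolevNorm k V φ := by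
  -- The supremum skips functions of norm zero; for them Cauchy–Schwarz shows that the pairing is
  -- zero.
  by_cases h0 : sobolevNorm k V φ = 0
  · have h1 : sobolevNorm 0 V φ = 0 :=
      le_antisymm ((sobolevNorm_mono_order (Nat.zero_le k) V φ).trans h0.le) zero_le
    have := enorm_pairing_le hV hu (hφ.mono_order (Nat.zero_le k))
    rw [h1, mul_zero] at this
    exact this.trans zero_le
  · rw [← ENNReal.div_le_iff h0 (ne_of_lt hφ)]
    exact le_iSup₂_of_le φ hφ (le_iSup (fun _ : sobolevNorm k V φ ≠ 0 =>
      ‖∫ x in V, u x * conj (φ x)‖ₑ / sobolevNorm k V φ) h0)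

/-- The dual norms are bounded by the `L²` norm. -/
theorem sobolevDualNorm_le {V : Set (E n)} (hV : IsOpen V) {k : ℕ} {u : E n → ℂ}
    (hu : MemSobolev 0 V u) : sobolevDualNorm k V u ≤ sobolevNorm 0 V u := by
  refine iSup₂_le fun φ hφ => iSup_le fun h0 => ?_
  rw [ENNReal.div_le_iff h0 (ne_of_lt hφ)]
  refine (enorm_pairing_le hV hu (hφ.mono_order (Nat.zero_le k))).trans ?_
  gcongr
  exact sobolevNorm_mono_order (Nat.zero_le k) V φ

/-- A real constant extracted from a constant for squares. -/
noncomputable def rootConst (n m : ℕ) (K : ℝ≥0∞) : ℝ :=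
  -- The summand 1 only makes the constant positive.
  Real.sqrt ((multiIndices n m).card * K.toReal) + 1

theorem rootConst_pos {m : ℕ} {K : ℝ≥0∞} : 0 < rootConst n m K := by
  unfold rootConst
  positivity

theorem ofReal_zpow_mul {h : ℝ} (hh : 0 < h) (i j : ℕ) :
    ENNReal.ofReal h ^ (2 * j) * ENNReal.ofReal (h ^ ((i : ℤ) - (j : ℤ))) ^ 2
      = ENNReal.ofReal h ^ (2 * i) := by
  rw [← ENNReal.ofReal_pow hh.le, ← ENNReal.ofReal_pow (by positivity),
    ← ENNReal.ofReal_mul (by positivity), ← ENNReal.ofReal_pow hh.le]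
  congr 1
  rw [← zpow_natCast, ← zpow_natCast, ← zpow_natCast, ← zpow_mul, ← zpow_add₀ hh.ne']
  congr 1
  push_cast
  ring

/-- A norm bound from bounds for the scaled squares of the derivatives. -/
theorem Jet.sobolevNorm_le_of_scaled {V : Set (E n)} (hV : IsOpen V) {m i j : ℕ} (hj : j ≤ m)
    {f : (Fin n → ℕ) → E n → ℂ} (hf : Jet j V f) {u : E n → ℂ}
    (hu : f 0 =ᵐ[volume.restrict V] u) {h : ℝ} (hh : 0 < h) {K N : ℝ≥0∞} (hK : K ≠ ∞)
    (hb : ∀ α, deg α ≤ j → ENNReal.ofReal h ^ (2 * j) * sqNorm V (f α)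
      ≤ K * (ENNReal.ofReal h ^ (2 * i) * N ^ 2)) :
    sobolevNorm j V u ≤ ENNReal.ofReal (rootConst n m K * h ^ ((i : ℤ) - (j : ℤ))) * N := by
  rw [← ENNReal.pow_le_pow_left_iff (n := 2) (by norm_num), hf.sobolevNorm_sq hV hu le_rfl]
  have he0 : ENNReal.ofReal h ≠ 0 := by simpa using hh
  have he : ENNReal.ofReal h ^ (2 * j) ≠ 0 := pow_ne_zero _ he0
  -- Multiplying by h^(2j) clears the negative power of h.
  refine (ENNReal.mul_le_mul_iff_right he (by finiteness)).1 ?_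
  have hc : (multiIndices n m).card * K ≤ ENNReal.ofReal (rootConst n m K) ^ 2 := by
    have h1 : ((multiIndices n m).card * K.toReal : ℝ) ≤ rootConst n m K ^ 2 := by
      have h2 : (0 : ℝ) ≤ (multiIndices n m).card * K.toReal := by positivity
      have h3 := Real.sq_sqrt h2
      have h4 := Real.sqrt_nonneg ((multiIndices n m).card * K.toReal)
      unfold rootConst
      nlinarith
    have h5 := ENNReal.ofReal_le_ofReal h1
    rwa [ENNReal.ofReal_mul (by positivity), ENNReal.ofReal_natCast, ENNReal.ofReal_toReal hK,
      ENNReal.ofReal_pow rootConst_pos.le] at h5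
  calc ENNReal.ofReal h ^ (2 * j) * ∑ α ∈ multiIndices n j, sqNorm V (f α)
      = ∑ α ∈ multiIndices n j, ENNReal.ofReal h ^ (2 * j) * sqNorm V (f α) := Finset.mul_sum _ _ _
    _ ≤ ∑ α ∈ multiIndices n j, K * (ENNReal.ofReal h ^ (2 * i) * N ^ 2) :=
        Finset.sum_le_sum fun α hα => hb α (mem_multiIndices.1 hα)
    _ = (multiIndices n j).card * K * (ENNReal.ofReal h ^ (2 * i) * N ^ 2) := by
        rw [Finset.sum_const, nsmul_eq_mul]; ring
    _ ≤ (multiIndices n m).card * K * (ENNReal.ofReal h ^ (2 * i) * N ^ 2) := by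
        gcongr
        exact multiIndices_mono hj
    _ ≤ ENNReal.ofReal (rootConst n m K) ^ 2 * (ENNReal.ofReal h ^ (2 * i) * N ^ 2) := by
        gcongr
    _ = ENNReal.ofReal h ^ (2 * j) *
          (ENNReal.ofReal (rootConst n m K * h ^ ((i : ℤ) - (j : ℤ))) * N) ^ 2 := by
        rw [ENNReal.ofReal_mul rootConst_pos.le, mul_pow, mul_pow, ← ofReal_zpow_mul hh i j]
        ring

/-! ### Local estimates -/

namespace Family

variable {G : Family n} {Ω : Set (E n)} {m κ : ℕ} {σ A B h : ℝ} {Cφ : ℕ → ℝ}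

/-- The scaled inverse estimate on a patch. -/
theorem wsq_patch_le (hn : 0 < n) (hσ : 0 < σ) (hB : 0 < B) (hh : 0 < h)
    (hG : G.SatisfiesABCD Ω m κ σ A B Cφ h) {j : Fin G.N} {v : E n → ℂ}
    (hv : v ∈ G.locSpace j) {u : (Fin n → ℕ) → E n → ℂ} (hu : Jet m (G.patch j) u)
    (hu0 : u 0 =ᵐ[volume.restrict (G.patch j)] v) {s : ℕ} {γ : Fin n → ℕ} (hs : s ≤ deg γ)
    (hγ : deg γ ≤ m) :
    wsq h (G.patch j) u γ ≤ ENNReal.ofReal (B * ratio σ ^ m) ^ 2 *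
      (ENNReal.ofReal h ^ (2 * s) * sobSum s (G.patch j) u) := by
  have hV := hG.assumptionB.partition.isOpen j
  have hd := hG.assumptionA.diam_pos hn hσ hh j
  have hle := hG.assumptionA.le_ratio_mul_diam hn hσ hh j
  have h1 := hG.assumptionD j v hv s (deg γ) hs hγ
  rw [← ENNReal.pow_le_pow_left_iff (n := 2) (by norm_num), mul_pow,
    hu.sobolevNorm_sq hV hu0 hγ, hu.sobolevNorm_sq hV hu0 (hs.trans hγ)] at h1
  set d := Metric.diam (G.patch j)
  -- With |γ| = s + t the left side is B h^s (h/d)^t, and h/d ≤ `ratio σ`. As `ratio σ` ≥ 1, the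
  -- exponent t may be raised to m.
  have hreal : h ^ deg γ * (B * d ^ ((s : ℤ) - (deg γ : ℤ))) ≤ B * ratio σ ^ m * h ^ s := by
    obtain ⟨t, ht⟩ := Nat.exists_eq_add_of_le hs
    rw [ht]
    have e : d ^ ((s : ℤ) - ((s + t : ℕ) : ℤ)) = (d ^ t)⁻¹ := by
      rw [← zpow_natCast, ← zpow_neg]
      congr 1
      push_cast
      ring
    rw [e, pow_add]
    have h2 : h ^ t * (d ^ t)⁻¹ ≤ ratio σ ^ m := by
      calc h ^ t * (d ^ t)⁻¹ ≤ (ratio σ * d) ^ t * (d ^ t)⁻¹ := by gcongr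
        _ = ratio σ ^ t := by rw [mul_pow]; field_simp
        _ ≤ ratio σ ^ m := pow_le_pow_right₀ one_le_ratio (by omega)
    calc h ^ s * h ^ t * (B * (d ^ t)⁻¹) = B * (h ^ t * (d ^ t)⁻¹) * h ^ s := by ring
      _ ≤ _ := by gcongr
  have hE := ENNReal.ofReal_le_ofReal hreal
  rw [ENNReal.ofReal_mul (by positivity), ENNReal.ofReal_pow hh.le,
    ENNReal.ofReal_mul (p := B * ratio σ ^ m)
      (mul_nonneg hB.le (pow_nonneg (zero_le_one.trans one_le_ratio) _)),
    ENNReal.ofReal_pow hh.le] at hE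
  unfold wsq
  calc ENNReal.ofReal h ^ (2 * deg γ) * sqNorm (G.patch j) (u γ)
      ≤ ENNReal.ofReal h ^ (2 * deg γ) * (ENNReal.ofReal (B * d ^ ((s : ℤ) - (deg γ : ℤ))) ^ 2 *
          sobSum s (G.patch j) u) := by
        gcongr
        exact (sqNorm_le_sobSum le_rfl).trans h1
    _ = (ENNReal.ofReal h ^ deg γ * ENNReal.ofReal (B * d ^ ((s : ℤ) - (deg γ : ℤ)))) ^ 2 *
          sobSum s (G.patch j) u := by ring
    _ ≤ (ENNReal.ofReal (B * ratio σ ^ m) * ENNReal.ofReal h ^ s) ^ 2 *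
          sobSum s (G.patch j) u := by gcongr
    _ = _ := by ring

theorem sobSum_patch_le (hG : G.SatisfiesABCD Ω m κ σ A B Cφ h) {j : Fin G.N} {v : E n → ℂ}
    (hv : v ∈ G.locSpace j) {u : (Fin n → ℕ) → E n → ℂ} (hu : Jet m (G.patch j) u)
    (hu0 : u 0 =ᵐ[volume.restrict (G.patch j)] v) {s : ℕ} (hs : s ≤ m) :
    sobSum s (G.patch j) u ≤ ENNReal.ofReal A ^ 2 * sobSum s (G.star j) u := by
  have hV := hG.assumptionB.partition.isOpen j
  have hsub := hG.assumptionA.star_subset_patch j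
  have hopen : IsOpen (G.star j) := Metric.isOpen_ball
  have h1 := hG.assumptionC.norm_le j v hv s hs
  have h2 : (fun α => (G.star j).indicator (u α)) 0 =ᵐ[volume.restrict (G.star j)] v :=
    (indicator_ae_eq_restrict hopen.measurableSet).trans
      (ae_restrict_of_ae_restrict_of_subset hsub hu0)
  rw [← ENNReal.pow_le_pow_left_iff (n := 2) (by norm_num), mul_pow,
    hu.sobolevNorm_sq hV hu0 hs, (hu.restrict hopen hsub).sobolevNorm_sq hopen h2 hs] at h1
  refine h1.trans (le_of_eq ?_)
  unfold sobSum
  congr 1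
  exact Finset.sum_congr rfl fun α _ => sqNorm_indicator hopen.measurableSet Subset.rfl _

theorem pou_support_subset (hP : G.IsPartition Ω m κ Cφ) {j : Fin G.N} {x : E n} (hx : x ∈ Ω)
    (h0 : G.pou j x ≠ 0) : x ∈ G.patch j :=
  hP.support j ⟨subset_closure ⟨hx, h0⟩, hx⟩

/-- On `ω_j^*` the other functions of the partition vanish. -/
theorem sum_pou_star (hB : G.AssumptionB Ω m κ Cφ) {j : Fin G.N} {x : E n} (hx : x ∈ Ω)
    (hxj : x ∈ G.star j) (v : Fin G.N → ℂ) : ∑ l, (G.pou l x : ℂ) * v l = v j := by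
  have h1 := hB.eq_one j x ⟨hxj, hx⟩
  have h2 := hB.partition.sum_eq_one x hx
  rw [← Finset.add_sum_erase _ _ (Finset.mem_univ j), h1] at h2
  have h3 : ∑ l ∈ Finset.univ.erase j, G.pou l x = 0 := by linarith
  have h4 := (Finset.sum_eq_zero_iff_of_nonneg
    (fun l _ => hB.partition.nonneg l x hx)).1 h3
  rw [Finset.sum_eq_single j]
  · simp [h1]
  · intro l _ hl
    rw [h4 l (Finset.mem_erase.2 ⟨hl, Finset.mem_univ l⟩)]
    simp
  · simp

/-- The jets of `w` and of its local contribution agree on `ω_j^*`. -/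
theorem jet_ae_eq_star (hG : G.SatisfiesABCD Ω m κ σ A B Cφ h) {w : E n → ℂ}
    {v : Fin G.N → E n → ℂ}
    (hw : ∀ᵐ x ∂(volume.restrict Ω), w x = ∑ j, (G.pou j x : ℂ) * v j x)
    {k : ℕ} {f : (Fin n → ℕ) → E n → ℂ} (hf : Jet k Ω f) (hf0 : f 0 =ᵐ[volume.restrict Ω] w)
    {j : Fin G.N} (hj : j ∈ G.active Ω) {u : (Fin n → ℕ) → E n → ℂ} (hk : k ≤ m)
    (hu : Jet m (G.patch j) u) (hu0 : u 0 =ᵐ[volume.restrict (G.patch j)] v j)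
    {δ : Fin n → ℕ} (hδ : deg δ ≤ k) : f δ =ᵐ[volume.restrict (G.star j)] u δ := by
  have hsub := hG.assumptionA.star_subset j (mem_active.1 hj)
  have hsub' := hG.assumptionA.star_subset_patch j
  refine hf.ae_eq_on (hu.mono_order hk) Metric.isOpen_ball hsub hsub' ?_ hδ
  filter_upwards [ae_restrict_of_ae_restrict_of_subset hsub hf0,
    ae_restrict_of_ae_restrict_of_subset hsub hw,
    ae_restrict_of_ae_restrict_of_subset hsub' hu0,
    ae_restrict_mem Metric.isOpen_ball.measurableSet] with x h1 h2 h3 hx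
  rw [h1, h2, h3]
  exact sum_pou_star hG.assumptionB (hsub hx) hx fun l => v l x

theorem sobSum_star_eq (hG : G.SatisfiesABCD Ω m κ σ A B Cφ h) {w : E n → ℂ}
    {v : Fin G.N → E n → ℂ}
    (hw : ∀ᵐ x ∂(volume.restrict Ω), w x = ∑ j, (G.pou j x : ℂ) * v j x)
    {k : ℕ} {f : (Fin n → ℕ) → E n → ℂ} (hf : Jet k Ω f) (hf0 : f 0 =ᵐ[volume.restrict Ω] w)
    {j : Fin G.N} (hj : j ∈ G.active Ω) {u : (Fin n → ℕ) → E n → ℂ} (hk : k ≤ m)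
    (hu : Jet m (G.patch j) u) (hu0 : u 0 =ᵐ[volume.restrict (G.patch j)] v j)
    {s : ℕ} (hs : s ≤ k) : sobSum s (G.star j) u = sobSum s (G.star j) f :=
  Finset.sum_congr rfl fun _ hα => (sqNorm_congr (jet_ae_eq_star hG hw hf hf0 hj hk hu hu0
    ((mem_multiIndices.1 hα).trans hs))).symm

theorem sum_sqNorm_star_le (hG : G.SatisfiesABCD Ω m κ σ A B Cφ h) {F : E n → ℂ}
    (hF : Measurable F) : ∑ j ∈ G.active Ω, sqNorm (G.star j) F ≤ κ * sqNorm Ω F :=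
  sum_setLIntegral_le _ (W := G.patch) (fun _ _ => Metric.isOpen_ball.measurableSet)
    (fun j hj => hG.assumptionA.star_subset j (mem_active.1 hj))
    (fun j _ => hG.assumptionA.star_subset_patch j) hG.assumptionB.partition.overlap
    (hF.enorm.pow_const 2)

theorem sum_sobSum_star_le (hG : G.SatisfiesABCD Ω m κ σ A B Cφ h) {f : (Fin n → ℕ) → E n → ℂ}
    (hf : ∀ α, Measurable (f α)) (s : ℕ) :
    ∑ j ∈ G.active Ω, sobSum s (G.star j) f ≤ κ * sobSum s Ω f := by
  unfold sobSum
  rw [Finset.sum_comm, Finset.mul_sum]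
  exact Finset.sum_le_sum fun α _ => sum_sqNorm_star_le hG (hf α)

/-- Jets of the local contributions. -/
theorem exists_patch_jets (hG : G.SatisfiesABCD Ω m κ σ A B Cφ h) {v : Fin G.N → E n → ℂ}
    (hv : ∀ j, v j ∈ G.locSpace j) : ∃ u : Fin G.N → (Fin n → ℕ) → E n → ℂ,
      ∀ j, Jet m (G.patch j) (u j) ∧ u j 0 =ᵐ[volume.restrict (G.patch j)] v j := by
  choose u hu using fun j => (hG.assumptionC.memSobolev j (v j) (hv j)).exists_jet
    (hG.assumptionB.partition.isOpen j)
  exact ⟨u, hu⟩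

/-- Points of Ω outside a patch do not matter, because φ_j vanishes there. -/
theorem sum_pou_congr (hP : G.IsPartition Ω m κ Cφ) (hΩ : IsOpen Ω) {u v : Fin G.N → E n → ℂ}
    (h : ∀ j, u j =ᵐ[volume.restrict (G.patch j)] v j) :
    (fun x => ∑ j, (G.pou j x : ℂ) * u j x)
      =ᵐ[volume.restrict Ω] fun x => ∑ j, (G.pou j x : ℂ) * v j x := by
  have h1 : ∀ j, ∀ᵐ x, x ∈ G.patch j → u j x = v j x := fun j =>
    (ae_restrict_iff' (hP.isOpen j).measurableSet).1 (h j)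
  filter_upwards [ae_restrict_of_ae (ae_all_iff.2 h1), ae_restrict_mem hΩ.measurableSet]
    with x hx hxΩ
  refine Finset.sum_congr rfl fun j _ => ?_
  by_cases h0 : G.pou j x = 0
  · simp [h0]
  · rw [hx j (pou_support_subset hP hxΩ h0)]

/-- The constant in the inverse estimate relative to `L²`. -/
noncomputable def invConst (n m κ : ℕ) (σ A B : ℝ) (Cφ : ℕ → ℝ) : ℝ≥0∞ :=
  glueConst n m κ σ Cφ * ((multiIndices n m).card * (ENNReal.ofReal (B * ratio σ ^ m) ^ 2 *
    ENNReal.ofReal A ^ 2) * κ)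

theorem invConst_ne_top : invConst n m κ σ A B Cφ ≠ ∞ := by
  have := glueConst_ne_top (n := n) (m := m) (κ := κ) (σ := σ) (Cφ := Cφ)
  unfold invConst
  finiteness

/-- Elements of the space have all derivatives, with the inverse estimate relative to `L²`. -/
theorem exists_space_jet (hn : 0 < n) (hΩ : IsOpen Ω) (hΩb : Bornology.IsBounded Ω) (hσ : 0 < σ)
    (hB : 0 < B) (hh : 0 < h) (hG : G.SatisfiesABCD Ω m κ σ A B Cφ h) {w : E n → ℂ}
    (hw : w ∈ G.space Ω) : ∃ q, Jet m Ω q ∧ q 0 =ᵐ[volume.restrict Ω] w ∧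
      ∀ α, deg α ≤ m → wsq h Ω q α ≤ invConst n m κ σ A B Cφ * sqNorm Ω w := by
  obtain ⟨v, hv, hwv⟩ := hw
  obtain ⟨u, hu⟩ := exists_patch_jets hG hv
  have hP := hG.assumptionB.partition
  obtain ⟨q, hq, hq0, hqb⟩ := exists_glue hn hΩ hΩb hσ hh hG.assumptionA hP le_rfl
    (u := u) (fun j _ => (hu j).1)
  have hqw : q 0 =ᵐ[volume.restrict Ω] w :=
    (hq0.trans (sum_pou_congr hP hΩ fun j => (hu j).2)).trans (hwv.mono fun x hx => hx.symm)
  refine ⟨q, hq, hqw, fun α hα => (hqb α hα).trans ?_⟩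
  set L := ENNReal.ofReal (B * ratio σ ^ m) ^ 2 * ENNReal.ofReal A ^ 2
  -- (D) with s = 0 passes to the L² norm on the patch, (C) with l = 0 to the ball, and on the ball
  -- v_j = w.
  have h1 : ∀ j ∈ G.active Ω, ∀ γ ∈ multiIndices n m,
      wsq h (G.patch j) (u j) γ ≤ L * sqNorm (G.star j) (q 0) := by
    intro j hj γ hγ
    have e1 := wsq_patch_le hn hσ hB hh hG (hv j) (hu j).1 (hu j).2 (Nat.zero_le _)
      (mem_multiIndices.1 hγ)
    have e2 := sobSum_patch_le hG (hv j) (hu j).1 (hu j).2 (Nat.zero_le m)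
    have e3 := sobSum_star_eq hG hwv hq hqw hj le_rfl (hu j).1 (hu j).2 (Nat.zero_le m)
    rw [e3] at e2
    simp only [sobSum_zero, mul_zero, pow_zero, one_mul] at e1 e2
    refine e1.trans ?_
    rw [mul_assoc]
    gcongr
  rw [invConst, mul_assoc (glueConst n m κ σ Cφ)]
  gcongr
  calc ∑ j ∈ G.active Ω, ∑ γ ∈ multiIndices n m, wsq h (G.patch j) (u j) γ
      ≤ ∑ j ∈ G.active Ω, ∑ _γ ∈ multiIndices n m, L * sqNorm (G.star j) (q 0) :=
        Finset.sum_le_sum fun j hj => Finset.sum_le_sum fun γ hγ => h1 j hj γ hγ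
    _ = (multiIndices n m).card * L * ∑ j ∈ G.active Ω, sqNorm (G.star j) (q 0) := by
        simp only [Finset.sum_const, nsmul_eq_mul]
        rw [Finset.mul_sum]
        exact Finset.sum_congr rfl fun j _ => by ring
    _ ≤ (multiIndices n m).card * L * (κ * sqNorm Ω (q 0)) := by
        gcongr
        exact sum_sqNorm_star_le hG (hq.meas 0)
    _ = _ := by rw [sqNorm_congr hqw]; ring

/-- The inverse estimates relative to `L²`, with a constant independent of the domain. -/
theorem inverse_estimate_zero (hn : 0 < n) (hΩ : IsOpen Ω) (hΩb : Bornology.IsBounded Ω)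
    (hσ : 0 < σ) (hB : 0 < B) (hh : 0 < h) (hG : G.SatisfiesABCD Ω m κ σ A B Cφ h) {w : E n → ℂ}
    (hw : w ∈ G.space Ω) : MemSobolev m Ω w ∧ ∀ j : ℕ, j ≤ m →
      sobolevNorm j Ω w ≤ ENNReal.ofReal (rootConst n m (invConst n m κ σ A B Cφ) *
        h ^ (-(j : ℤ))) * sobolevNorm 0 Ω w ∧
      sobolevNorm 0 Ω w ≤ ENNReal.ofReal (rootConst n m (invConst n m κ σ A B Cφ) *
        h ^ (-(j : ℤ))) * sobolevDualNorm j Ω w := by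
  obtain ⟨q, hq, hqw, hqb⟩ := exists_space_jet hn hΩ hΩb hσ hB hh hG hw
  have hmem : MemSobolev m Ω w := hq.memSobolev hΩ hqw le_rfl
  have hmem0 := hmem.mono_order (Nat.zero_le m)
  have hh1 := hG.assumptionA.h_le_one
  refine ⟨hmem, fun j hj => ?_⟩
  have key : sobolevNorm j Ω w ≤ ENNReal.ofReal (rootConst n m (invConst n m κ σ A B Cφ) *
        h ^ (-(j : ℤ))) * sobolevNorm 0 Ω w := by
    have := (hq.mono_order hj).sobolevNorm_le_of_scaled hΩ (i := 0) hj hqw hh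
      (K := invConst n m κ σ A B Cφ) (N := sobolevNorm 0 Ω w) invConst_ne_top (fun α hα => by
        rw [hmem0.sobolevNorm_zero_sq hΩ, mul_zero, pow_zero, one_mul]
        refine le_trans ?_ (hqb α (hα.trans hj))
        unfold wsq
        gcongr ?_ * _
        -- As h ≤ 1, the worst power h^(2j) may replace h^(2|α|).
        exact pow_le_pow_of_le_one zero_le (by simpa using hh1) (by omega))
    simpa using this
  refine ⟨key, ?_⟩
  set c := ENNReal.ofReal (rootConst n m (invConst n m κ σ A B Cφ) * h ^ (-(j : ℤ)))
  by_cases h0 : sobolevNorm 0 Ω w = 0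
  · rw [h0]; exact zero_le
  -- Duality: w, being in H^j, is its own test function, and one factor ‖w‖ cancels.
  · have h1 : sobolevNorm 0 Ω w * sobolevNorm 0 Ω w
        ≤ sobolevNorm 0 Ω w * (c * sobolevDualNorm j Ω w) := by
      calc sobolevNorm 0 Ω w * sobolevNorm 0 Ω w = sobolevNorm 0 Ω w ^ 2 := by ring
        _ = ‖∫ x in Ω, w x * conj (w x)‖ₑ := (enorm_pairing_self hΩ hmem0).symm
        _ ≤ sobolevDualNorm j Ω w * sobolevNorm j Ω w :=
            enorm_pairing_le_dual hΩ hmem0 (hmem.mono_order hj)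
        _ ≤ sobolevDualNorm j Ω w * (c * sobolevNorm 0 Ω w) := by gcongr
        _ = _ := by ring
    exact (ENNReal.mul_le_mul_iff_right h0 (ne_of_lt hmem0)).1 h1

end Family

/-! ### Scaled kernels -/

/-- Young's inequality, in the form `‖∫ H(·, x) k(x) dx‖ ≤ ‖k‖₁ sup_x ‖H(·, x)‖` for `L²` norms. -/
theorem sqNorm_integral_mul_le {V : Set (E n)} {H : E n → E n → ℂ}
    (hH : Measurable fun p : E n × E n => H p.1 p.2) {k : E n → ℂ} (hkm : Measurable k)
    (hk : Integrable k) {M : ℝ≥0∞} (hM : ∀ x ∈ tsupport k, sqNorm V (fun y => H y x) ≤ M) :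
    sqNorm V (fun y => ∫ x, H y x * k x) ≤ ENNReal.ofReal (∫ x, ‖k x‖) ^ 2 * M := by
  -- For the finite measure |k| dx the inequality is Cauchy–Schwarz followed by Tonelli. This
  -- measure lives on the support of k, so the bound on H is needed only there.
  set ν : Measure (E n) := volume.withDensity fun x => ‖k x‖ₑ with hν
  have hkm' : Measurable fun x => ‖k x‖ₑ := hkm.enorm
  have hνu : ν univ = ENNReal.ofReal (∫ x, ‖k x‖) := by
    rw [hν, withDensity_apply _ MeasurableSet.univ, Measure.restrict_univ,
      ofReal_integral_norm_eq_lintegral_enorm hk]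
  have hνfin : IsFiniteMeasure ν := ⟨by rw [hνu]; exact ENNReal.ofReal_lt_top⟩
  have hHy : ∀ y, Measurable fun x => H y x := fun y =>
    hH.comp (measurable_const.prodMk measurable_id)
  have h1 : ∀ y, ‖∫ x, H y x * k x‖ₑ ^ 2 ≤ ν univ * ∫⁻ x, ‖H y x‖ₑ ^ 2 ∂ν := by
    intro y
    have e : ‖∫ x, H y x * k x‖ₑ ≤ ∫⁻ x, ‖H y x‖ₑ ∂ν := by
      refine (enorm_integral_le_lintegral_enorm _).trans (le_of_eq ?_)
      rw [hν, lintegral_withDensity_eq_lintegral_mul _ hkm' (hHy y).enorm]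
      refine lintegral_congr fun x => ?_
      rw [enorm_mul, Pi.mul_apply, mul_comm]
    exact (pow_le_pow_left' e 2).trans (sq_lintegral_le ν (hHy y).enorm.aemeasurable)
  calc sqNorm V (fun y => ∫ x, H y x * k x)
      ≤ ∫⁻ y in V, ν univ * ∫⁻ x, ‖H y x‖ₑ ^ 2 ∂ν := lintegral_mono h1
    _ = ν univ * ∫⁻ y in V, ∫⁻ x, ‖H y x‖ₑ ^ 2 ∂ν :=
        lintegral_const_mul' _ _ (measure_ne_top _ _)
    _ = ν univ * ∫⁻ x, ∫⁻ y in V, ‖H y x‖ₑ ^ 2 ∂volume ∂ν := by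
        rw [lintegral_lintegral_swap]
        exact (hH.enorm.pow_const 2).aemeasurable
    _ ≤ ν univ * ∫⁻ _, M ∂ν := by
        gcongr ν univ * ?_
        refine lintegral_mono_ae ?_
        have : ∀ᵐ x ∂ν, x ∈ tsupport k := by
          rw [hν, ae_withDensity_iff hkm']
          refine Eventually.of_forall fun x hx => subset_tsupport k ?_
          intro hc
          exact hx (by simp [hc])
        filter_upwards [this] with x hx
        exact hM x hx
    _ = _ := by rw [lintegral_const, hνu]; ring

theorem cv_eq_integral_sub (F k : E n → ℂ) (y : E n) : cv F k y = ∫ x, F (y - x) * k x := by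
  rw [cv, ← integral_sub_left_eq_self _ volume y]
  simp

theorem sqNorm_translate_univ (F : E n → ℂ) (x : E n) :
    sqNorm univ (fun y => F (y - x)) = sqNorm univ F := by
  unfold sqNorm
  simp only [Measure.restrict_univ]
  exact lintegral_sub_right_eq_self (fun y => ‖F y‖ₑ ^ 2) x

/-- Young's inequality for convolutions. -/
theorem sqNorm_cv_le {F k : E n → ℂ} (hF : Measurable F) (hkm : Measurable k)
    (hk : Integrable k) (V : Set (E n)) :
    sqNorm V (cv F k) ≤ ENNReal.ofReal (∫ x, ‖k x‖) ^ 2 * sqNorm univ F := by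
  have h : cv F k = fun y => ∫ x, F (y - x) * k x := funext (cv_eq_integral_sub F k)
  rw [h]
  refine sqNorm_integral_mul_le (H := fun y x => F (y - x)) (by fun_prop) hkm hk fun x _ => ?_
  rw [← sqNorm_translate_univ F x]
  exact sqNorm_mono_set (subset_univ V) _

/-- The `L¹`-normalized dilation of a kernel. -/
noncomputable def dil (ρ : E n → ℂ) (t : ℝ) (x : E n) : ℂ := ((t ^ n)⁻¹ : ℝ) * ρ (t⁻¹ • x)

theorem dil_smooth {ρ : E n → ℂ} (hρ : Smooth ρ) (t : ℝ) : Smooth (dil ρ t) :=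
  contDiff_const.mul (hρ.comp (contDiff_const_smul _))

theorem partialDeriv_dil {ρ : E n → ℂ} (hρ : Smooth ρ) (t : ℝ) (i : Fin n) :
    partialDeriv i (dil ρ t) = fun x => ((t⁻¹ : ℝ) : ℂ) * dil (partialDeriv i ρ) t x := by
  funext x
  unfold partialDeriv dil
  have h1 : HasFDerivAt (fun x : E n => t⁻¹ • x) (t⁻¹ • ContinuousLinearMap.id ℝ (E n)) x :=
    (hasFDerivAt_id x).const_smul t⁻¹
  have h2 := ((hρ.differentiable (t⁻¹ • x)).hasFDerivAt.comp x h1).const_mul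
    (((t ^ n)⁻¹ : ℝ) : ℂ)
  have h3 : (fun x => (((t ^ n)⁻¹ : ℝ) : ℂ) * ρ (t⁻¹ • x))
      = fun x => (((t ^ n)⁻¹ : ℝ) : ℂ) * (ρ ∘ fun x => t⁻¹ • x) x := rfl
  rw [h3, h2.fderiv]
  simp
  ring

theorem partialDeriv_const_mul (c : ℂ) {f : E n → ℂ} (hf : Smooth f) (i : Fin n) :
    partialDeriv i (fun x => c * f x) = fun x => c * partialDeriv i f x := by
  funext x
  unfold partialDeriv
  rw [fderiv_const_mul (hf.differentiable x)]
  rfl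

theorem multiDeriv_dil {ρ : E n → ℂ} (hρ : Smooth ρ) (t : ℝ) (δ : Fin n → ℕ) :
    multiDeriv δ (dil ρ t) = fun x => (((t⁻¹) ^ deg δ : ℝ) : ℂ) * dil (multiDeriv δ ρ) t x := by
  induction δ using multiIndex_induction with
  | h0 => simp
  | hs δ i ih =>
    rw [multiDeriv_add_single (dil_smooth hρ t), ih,
      partialDeriv_const_mul _ (dil_smooth (hρ.multiDeriv δ) t),
      partialDeriv_dil (hρ.multiDeriv δ), multiDeriv_add_single hρ, deg_add_single]
    funext x
    push_cast
    ring

theorem integral_norm_dil (ρ : E n → ℂ) {t : ℝ} (ht : 0 < t) :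
    ∫ x, ‖dil ρ t x‖ = ∫ x, ‖ρ x‖ := by
  have h1 : ∀ x, ‖dil ρ t x‖ = (t ^ n)⁻¹ * ‖ρ (t⁻¹ • x)‖ := fun x => by
    rw [dil, norm_mul, Complex.norm_real, Real.norm_of_nonneg (by positivity)]
  simp only [h1]
  rw [integral_const_mul, Measure.integral_comp_inv_smul_of_nonneg volume (fun x => ‖ρ x‖) ht.le]
  simp only [finrank_euclideanSpace, Fintype.card_fin, smul_eq_mul]
  rw [inv_mul_cancel_left₀ (by positivity)]

theorem integral_norm_multiDeriv_dil {ρ : E n → ℂ} (hρ : Smooth ρ) {t : ℝ} (ht : 0 < t)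
    (δ : Fin n → ℕ) :
    ∫ x, ‖multiDeriv δ (dil ρ t) x‖ = (t⁻¹) ^ deg δ * ∫ x, ‖multiDeriv δ ρ x‖ := by
  rw [multiDeriv_dil hρ, ← integral_norm_dil (multiDeriv δ ρ) ht, ← integral_const_mul]
  congr 1
  funext x
  rw [norm_mul, Complex.norm_real, Real.norm_of_nonneg (by positivity)]

theorem cv_dil (F ρ : E n → ℂ) {t : ℝ} (ht : 0 < t) (y : E n) :
    cv F (dil ρ t) y = ∫ x, F (y - t • x) * ρ x := by
  rw [cv_eq_integral_sub]
  have h1 : ∀ x, F (y - x) * dil ρ t x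
      = (((t ^ n)⁻¹ : ℝ) : ℂ) * (fun z => F (y - t • z) * ρ z) (t⁻¹ • x) := by
    intro x
    simp only [dil, smul_inv_smul₀ ht.ne']
    ring
  simp only [h1]
  have h2 : ∫ x, F (y - t • t⁻¹ • x) * ρ (t⁻¹ • x) = _ :=
    Measure.integral_comp_inv_smul_of_nonneg volume (fun z => F (y - t • z) * ρ z) ht.le
  rw [integral_const_mul, h2]
  simp only [finrank_euclideanSpace, Fintype.card_fin, Complex.real_smul]
  rw [← mul_assoc, ← Complex.ofReal_mul, inv_mul_cancel₀ (by positivity)]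
  simp

theorem tsupport_dil_subset {ρ : E n → ℂ} {t : ℝ} {x : E n}
    (hx : x ∈ tsupport (dil ρ t)) : t⁻¹ • x ∈ tsupport ρ := by
  have h1 : tsupport (dil ρ t) ⊆ (fun x => t⁻¹ • x) ⁻¹' tsupport ρ := by
    refine closure_minimal (fun y hy => subset_tsupport ρ ?_)
      ((isClosed_tsupport ρ).preimage (by fun_prop))
    exact right_ne_zero_of_mul hy
  exact h1 hx

theorem dil_hasCompactSupport {ρ : E n → ℂ} (hρ : HasCompactSupport ρ) {t : ℝ} (ht : 0 < t) :
    HasCompactSupport (dil ρ t) := by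
  have h1 : HasCompactSupport (fun x => ρ (t⁻¹ • x)) :=
    hρ.comp_homeomorph (Homeomorph.smulOfNeZero t⁻¹ (inv_ne_zero ht.ne'))
  exact h1.mul_left

theorem tsupport_multiDeriv_subset {k : E n → ℂ} (hk : Smooth k) (δ : Fin n → ℕ) :
    tsupport (multiDeriv δ k) ⊆ tsupport k := by
  induction δ using multiIndex_induction with
  | h0 => simp
  | hs δ i ih =>
    rw [multiDeriv_add_single hk]
    exact (tsupport_partialDeriv_subset i _).trans ih

theorem hasCompactSupport_multiDeriv {k : E n → ℂ} (hk : Smooth k) (hc : HasCompactSupport k)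
    (δ : Fin n → ℕ) : HasCompactSupport (multiDeriv δ k) :=
  hc.of_isClosed_subset (isClosed_tsupport _) (tsupport_multiDeriv_subset hk δ)

/-- Derivatives may be moved from the kernel to a jet. -/
theorem Jet.cv_multiDeriv {i : ℕ} {V : Set (E n)} {f : (Fin n → ℕ) → E n → ℂ} (hf : Jet i V f)
    {k : E n → ℂ} (hk : Smooth k) (hc : HasCompactSupport k) {y : E n}
    (hy : ∀ x ∈ tsupport k, y - x ∈ V) (γ : Fin n → ℕ) (hγ : deg γ ≤ i) (δ : Fin n → ℕ) :
    cv (f 0) (multiDeriv (γ + δ) k) y = cv (f γ) (multiDeriv δ k) y := by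
  induction γ using multiIndex_induction generalizing δ with
  | h0 => simp
  | hs γ l ih =>
    rw [deg_add_single] at hγ
    have h1 := ih (by omega) (δ + Pi.single l 1)
    rw [show γ + Pi.single l 1 + δ = γ + (δ + Pi.single l 1) by
      rw [add_assoc, add_comm (Pi.single l 1) δ], h1, multiDeriv_add_single hk]
    exact (hf.deriv γ l (by omega)).cv_eq (hk.multiDeriv δ)
      (isTestFunction_reflect (hk.multiDeriv δ) (hasCompactSupport_multiDeriv hk hc δ)
        fun x hx => hy x (tsupport_multiDeriv_subset hk δ hx))

/-! ### Higher differences -/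

theorem fwdDiff_iterate_congr {V : Set (E n)} {τ : E n} (hτ : ∀ y ∈ V, y + τ ∈ V)
    {F F' : E n → ℂ} (h : ∀ y ∈ V, F y = F' y) (q : ℕ) :
    ∀ y ∈ V, (fwdDiff τ)^[q] F y = (fwdDiff τ)^[q] F' y := by
  induction q generalizing F F' with
  | zero => exact h
  | succ q ih =>
    intro y hy
    rw [Function.iterate_succ_apply, Function.iterate_succ_apply]
    refine ih (fun z hz => ?_) y hy
    simp only [fwdDiff]
    rw [h z hz, h _ (hτ z hz)]

theorem measurable_fwdDiff_iterate {τ : E n} {F : E n → ℂ} (hF : Measurable F) (q : ℕ) :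
    Measurable ((fwdDiff τ)^[q] F) := by
  induction q generalizing F with
  | zero => exact hF
  | succ q ih =>
    rw [Function.iterate_succ_apply]
    refine ih ?_
    unfold fwdDiff
    fun_prop

theorem sqNorm_translate_le {V : Set (E n)} (hV : IsOpen V) {τ : E n}
    (hτ : ∀ y ∈ V, y + τ ∈ V) (F : E n → ℂ) :
    sqNorm V (fun y => F (y + τ)) ≤ sqNorm V F := by
  unfold sqNorm
  rw [← lintegral_indicator hV.measurableSet, ← lintegral_indicator hV.measurableSet,
    ← lintegral_add_right_eq_self (V.indicator fun y => ‖F y‖ₑ ^ 2) τ]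
  refine lintegral_mono fun y => ?_
  by_cases hy : y ∈ V
  · rw [indicator_of_mem hy, indicator_of_mem (hτ y hy)]
  · rw [indicator_of_notMem hy]
    exact zero_le

/-- Translation by τ maps V into itself, so it does not increase norms on V. This crude bound serves
for differences that have no derivatives to spend. -/
theorem sqNorm_fwdDiff_iterate_le {V : Set (E n)} (hV : IsOpen V) {τ : E n}
    (hτ : ∀ y ∈ V, y + τ ∈ V) {F : E n → ℂ} (hF : Measurable F) (p : ℕ) :
    sqNorm V ((fwdDiff τ)^[p] F) ≤ 4 ^ p * sqNorm V F := by
  induction p generalizing F with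
  | zero => simp
  | succ p ih =>
    rw [Function.iterate_succ_apply]
    have hm : Measurable (fwdDiff τ F) := measurable_fwdDiff_iterate hF 1
    refine (ih hm).trans ?_
    have h1 : sqNorm V (fwdDiff τ F) ≤ 2 * (sqNorm V F + sqNorm V F) := by
      refine (sqNorm_sub_le (f := fun y => F (y + τ)) (by fun_prop)).trans ?_
      gcongr
      exact sqNorm_translate_le hV hτ F
    calc 4 ^ p * sqNorm V (fwdDiff τ F) ≤ 4 ^ p * (2 * (sqNorm V F + sqNorm V F)) := by gcongr
      _ = 4 ^ (p + 1) * sqNorm V F := by ring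

/-- The translate of a jet on a translation invariant set. -/
theorem Jet.fwdDiff_jet {k : ℕ} {V : Set (E n)} (hV : IsOpen V) {f : (Fin n → ℕ) → E n → ℂ}
    (hf : Jet k V f) {τ : E n} (hτ : ∀ y ∈ V, y + τ ∈ V) :
    Jet k V (fun α => V.indicator (fwdDiff τ (f α))) := by
  have hm : ∀ α, Measurable (fwdDiff τ (f α)) := fun α =>
    measurable_fwdDiff_iterate (hf.meas α) 1
  have hL : ∀ α, deg α ≤ k → MemLp (fwdDiff τ (f α)) 2 volume := fun α hα =>
    (MemLp.translate (hf.memLp α hα) τ).sub (hf.memLp α hα)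
  refine ⟨fun α => (hm α).indicator hV.measurableSet, fun α x hx => indicator_of_notMem hx _,
    fun α hα => (hL α hα).indicator hV.measurableSet, fun α l hα => ?_⟩
  have hα' : deg (α + Pi.single l 1) ≤ k := by rw [deg_add_single]; omega
  refine WD.congr ?_ (indicator_ae_eq_restrict hV.measurableSet).symm
    (indicator_ae_eq_restrict hV.measurableSet).symm
  intro ψ hψ
  -- Moving the translation to ψ shifts its support by τ, which stays in V by invariance.
  have hψτ : IsTestFunction V (fun y => ψ (y - τ)) := by
    refine ⟨hψ.smooth.comp (contDiff_id.sub contDiff_const),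
      hψ.hasCompactSupport.comp_homeomorph (Homeomorph.subRight τ), fun y hy => ?_⟩
    have h1 : tsupport (fun y => ψ (y - τ)) ⊆ (fun y => y - τ) ⁻¹' tsupport ψ :=
      closure_minimal (fun z hz => subset_tsupport ψ hz)
        ((isClosed_tsupport ψ).preimage (by fun_prop))
    have := hτ _ (hψ.2.2 (h1 hy))
    simpa using this
  have hpd : ∀ y, partialDeriv l (fun y => ψ (y - τ)) y = partialDeriv l ψ (y - τ) := by
    intro y
    unfold partialDeriv
    rw [fderiv_comp_sub]
  have key := hf.deriv α l hα _ hψτ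
  simp only [hpd] at key
  have e : ∀ F P : E n → ℂ, ∫ y, F y * P (y - τ) = ∫ y, F (y + τ) * P y := fun F P => by
    rw [← integral_add_right_eq_self (fun y => F y * P (y - τ)) τ]
    simp only [add_sub_cancel_right]
  rw [e, e] at key
  have loc : ∀ {F : E n → ℂ}, MemLp F 2 volume → LocallyIntegrableOn F V volume :=
    fun h => (h.locallyIntegrable (by norm_num)).locallyIntegrableOn V
  simp only [fwdDiff, sub_mul]
  rw [integral_sub ((hψ.partialDeriv l).integrable_mul (loc (MemLp.translate (hf.memLp α hα.le) τ)))
      ((hψ.partialDeriv l).integrable_mul (loc (hf.memLp α hα.le))),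
    integral_sub (hψ.integrable_mul (loc (MemLp.translate (hf.memLp _ hα') τ)))
      (hψ.integrable_mul (loc (hf.memLp _ hα'))), key, hf.deriv α l hα ψ hψ]
  ring

/-- Differences of order `q` are controlled by the derivatives of order `q`. -/
theorem Jet.sqNorm_fwdDiff_iterate_le {V : Set (E n)} (hV : IsOpen V) {τ : E n}
    (hτ : ∀ y ∈ V, ∀ t : ℝ, 0 ≤ t → y + t • τ ∈ V) (q : ℕ) {f : (Fin n → ℕ) → E n → ℂ}
    (hf : Jet q V f) {M : ℝ≥0∞} (hM : ∀ δ, deg δ = q → sqNorm V (f δ) ≤ M) :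
    sqNorm V ((fwdDiff τ)^[q] (f 0)) ≤ (n ^ 2 * ENNReal.ofReal ‖τ‖ ^ 2) ^ q * M := by
  have hτ1 : ∀ y ∈ V, y + τ ∈ V := fun y hy => by simpa using hτ y hy 1 zero_le_one
  induction q generalizing f M with
  | zero => simpa using hM 0 (by simp)
  | succ q ih =>
    rw [Function.iterate_succ_apply]
    have hJ := (hf.mono_order (Nat.le_succ q)).fwdDiff_jet hV hτ1
    -- The derivatives of order q of the differenced jet are first differences of derivatives of f,
    -- hence bounded through derivatives of order q + 1.
    have h1 := ih hJ (M := n ^ 2 * ENNReal.ofReal ‖τ‖ ^ 2 * M) (fun δ hδ => by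
      rw [sqNorm_indicator hV.measurableSet Subset.rfl]
      have h2 := (hf.shift_add (γ := δ) (l := 1) (by omega)).sqNorm_translate_sub_le hV hV
        (fun y hy t ht => hτ y hy t ht.1)
      simp only [add_zero] at h2
      refine h2.trans ?_
      calc (n : ℝ≥0∞) * ENNReal.ofReal ‖τ‖ ^ 2 * ∑ i, sqNorm V (f (δ + Pi.single i 1))
          ≤ n * ENNReal.ofReal ‖τ‖ ^ 2 * ∑ _i : Fin n, M := by
            gcongr with i
            exact hM _ (by rw [deg_add_single, hδ])
        _ = _ := by
            rw [Finset.sum_const, Finset.card_univ, Fintype.card_fin, nsmul_eq_mul]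
            ring)
    -- Iterated differences at points of V use only values on V, so the cut-off in the jet is
    -- invisible.
    have h3 : sqNorm V ((fwdDiff τ)^[q] (fwdDiff τ (f 0)))
        = sqNorm V ((fwdDiff τ)^[q] (V.indicator (fwdDiff τ (f 0)))) :=
      sqNorm_congr_on hV.measurableSet (fwdDiff_iterate_congr hτ1
        (fun y hy => (indicator_of_mem hy _).symm) q)
    rw [h3]
    refine h1.trans (le_of_eq ?_)
    ring

/-! ### Smoothing on a set invariant under a cone of translations -/

/-- A normalized kernel supported in the unit ball around `-a`. -/
noncomputable def baseKernel (a x : E n) : ℂ := bumpKernel (bumpSeq n 1) (x + a)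

theorem baseKernel_smooth (a : E n) : Smooth (baseKernel a) :=
  (bumpKernel_smooth _).comp (contDiff_id.add contDiff_const)

theorem baseKernel_hasCompactSupport (a : E n) : HasCompactSupport (baseKernel a) :=
  (bumpKernel_hasCompactSupport _).comp_homeomorph (Homeomorph.addRight a)

theorem norm_add_le_of_mem_tsupport_baseKernel {a x : E n} (hx : x ∈ tsupport (baseKernel a)) :
    ‖x + a‖ ≤ 1 := by
  have h1 : tsupport (baseKernel a) ⊆ (fun x => x + a) ⁻¹' tsupport (bumpKernel (bumpSeq n 1)) :=
    closure_minimal (fun z hz => subset_tsupport _ hz)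
      ((isClosed_tsupport _).preimage (by fun_prop))
  have h2 := tsupport_bumpKernel _ (h1 hx)
  rw [mem_closedBall_zero_iff] at h2
  -- The outer radius of `bumpSeq n 1` is 2/(1 + 1) = 1.
  norm_num [bumpSeq] at h2
  exact h2

theorem norm_le_of_mem_tsupport_baseKernel {a x : E n} (hx : x ∈ tsupport (baseKernel a)) :
    ‖x‖ ≤ ‖a‖ + 1 := by
  have := norm_add_le_of_mem_tsupport_baseKernel hx
  calc ‖x‖ = ‖(x + a) - a‖ := by simp
    _ ≤ ‖x + a‖ + ‖a‖ := norm_sub_le _ _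
    _ ≤ ‖a‖ + 1 := by linarith

theorem integral_norm_baseKernel (a : E n) : ∫ x, ‖baseKernel a x‖ = 1 := by
  unfold baseKernel
  rw [integral_add_right_eq_self (fun x => ‖bumpKernel (bumpSeq n 1) x‖) a,
    integral_norm_bumpKernel]

theorem integral_baseKernel (a : E n) : ∫ x, baseKernel a x = 1 := by
  unfold baseKernel
  rw [integral_add_right_eq_self (fun x => bumpKernel (bumpSeq n 1) x) a]
  unfold bumpKernel
  rw [integral_complex_ofReal, ContDiffBump.integral_normed]
  simp

/-- The coefficients turning shifted averages into an approximation of order `i`. -/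
def diffCoeff (i s : ℕ) : ℂ := -((-1) ^ i * (((-1 : ℤ) ^ (i - s) * (i.choose s : ℤ) : ℤ) : ℂ))

/-- The binomial expansion of the i-th difference, with its term (-1)^i F(y) at s = 0 isolated. -/
theorem sub_sum_diffCoeff (i : ℕ) (F : E n → ℂ) (y τ : E n) :
    F y - ∑ s ∈ Finset.Icc 1 i, diffCoeff i s * F (y + s • τ)
      = (-1) ^ i * (fwdDiff τ)^[i] F y := by
  rw [fwdDiff_iter_eq_sum_shift, Finset.sum_range_succ', mul_add]
  have h1 : ∑ s ∈ Finset.Icc 1 i, diffCoeff i s * F (y + s • τ)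
      = ∑ s ∈ Finset.range i, diffCoeff i (s + 1) * F (y + (s + 1) • τ) := by
    rw [Finset.range_eq_Ico, Finset.sum_Ico_add' (fun s => diffCoeff i s * F (y + s • τ)) 0 i 1]
    rfl
  have h2 : ((-1 : ℂ) ^ i) * (-1) ^ i = 1 := by rw [← mul_pow]; simp
  rw [h1, Finset.mul_sum]
  have h3 : ∀ s, (-1 : ℂ) ^ i * (((-1 : ℤ) ^ (i - (s + 1)) * (i.choose (s + 1) : ℤ)) •
      F (y + (s + 1) • τ)) = -(diffCoeff i (s + 1) * F (y + (s + 1) • τ)) := by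
    intro s
    rw [diffCoeff, zsmul_eq_mul]
    ring
  simp only [h3, Finset.sum_neg_distrib]
  simp only [tsub_zero, Nat.choose_zero_right, Nat.cast_one, mul_one, zero_smul, add_zero,
    zsmul_eq_mul, Int.cast_pow, Int.cast_neg, Int.cast_one]
  rw [← mul_assoc, h2, one_mul]
  ring

/-- The smoothed jet. -/
noncomputable def smooth (a : E n) (i : ℕ) (h : ℝ) (F : E n → ℂ) (α : Fin n → ℕ) (y : E n) : ℂ :=
  ∑ s ∈ Finset.Icc 1 i, diffCoeff i s * cv F (multiDeriv α (dil (baseKernel a) (s * h))) y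

section smooth

variable {a : E n} {i : ℕ} {h : ℝ} {F : E n → ℂ}

theorem scale_pos (hh : 0 < h) {s : ℕ} (hs : s ∈ Finset.Icc 1 i) : 0 < s * h := by
  have : 0 < s := (Finset.mem_Icc.1 hs).1
  positivity

theorem scaled_hasCompactSupport (hh : 0 < h) {s : ℕ} (hs : s ∈ Finset.Icc 1 i) (α : Fin n → ℕ) :
    HasCompactSupport (multiDeriv α (dil (baseKernel a) (s * h))) :=
  hasCompactSupport_multiDeriv (dil_smooth (baseKernel_smooth a) _)
    (dil_hasCompactSupport (baseKernel_hasCompactSupport a) (scale_pos hh hs)) α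

theorem scaled_smooth (t : ℝ) (α : Fin n → ℕ) :
    Smooth (multiDeriv α (dil (baseKernel a) t)) :=
  (dil_smooth (baseKernel_smooth a) _).multiDeriv α

theorem smooth_smooth (hh : 0 < h) (hF : LocallyIntegrable F volume) (α : Fin n → ℕ) :
    Smooth (smooth a i h F α) := by
  unfold smooth
  exact ContDiff.sum fun s hs => contDiff_const.mul
    (cv_smooth hF (scaled_smooth _ α) (scaled_hasCompactSupport hh hs α))

theorem partialDeriv_smooth (hh : 0 < h) (hF : LocallyIntegrable F volume) (α : Fin n → ℕ)
    (l : Fin n) : partialDeriv l (smooth a i h F α) = smooth a i h F (α + Pi.single l 1) := by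
  have h1 : ∀ s ∈ Finset.Icc 1 i,
      Smooth (cv F (multiDeriv α (dil (baseKernel a) (s * h)))) := fun s hs =>
    cv_smooth hF (scaled_smooth _ α) (scaled_hasCompactSupport hh hs α)
  funext y
  have h2 : partialDeriv l (smooth a i h F α) y = ∑ s ∈ Finset.Icc 1 i,
      diffCoeff i s * partialDeriv l (cv F (multiDeriv α (dil (baseKernel a) (s * h)))) y := by
    have e : smooth a i h F α = fun y => ∑ s ∈ Finset.Icc 1 i,
      diffCoeff i s * cv F (multiDeriv α (dil (baseKernel a) (s * h))) y := rfl
    rw [e]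
    unfold partialDeriv
    rw [fderiv_fun_sum fun s hs => ((h1 s hs).differentiable y).const_mul _]
    rw [_root_.sum_apply]
    refine Finset.sum_congr rfl fun s hs => ?_
    rw [fderiv_const_mul ((h1 s hs).differentiable y)]
    rfl
  rw [h2, smooth]
  refine Finset.sum_congr rfl fun s hs => ?_
  rw [partialDeriv_cv hF (scaled_smooth _ α) (scaled_hasCompactSupport hh hs α),
    multiDeriv_add_single (dil_smooth (baseKernel_smooth a) _)]

theorem memLp_cv {k : E n → ℂ} (hF : Measurable F) (hF2 : MemLp F 2 volume) (hk : Smooth k)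
    (hc : HasCompactSupport k) : MemLp (cv F k) 2 volume := by
  have hloc : LocallyIntegrable F volume := hF2.locallyIntegrable (by norm_num)
  refine memLp_of_sqNorm_lt_top (cv_smooth hloc hk hc).continuous.aestronglyMeasurable ?_
  refine (sqNorm_cv_le hF hk.continuous.measurable
    (hk.continuous.integrable_of_hasCompactSupport hc) univ).trans_lt ?_
  exact ENNReal.mul_lt_top (by finiteness) (sqNorm_lt_top (by rwa [Measure.restrict_univ]))

theorem memLp_smooth (hh : 0 < h) (hF : Measurable F) (hF2 : MemLp F 2 volume) (α : Fin n → ℕ) :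
    MemLp (smooth a i h F α) 2 volume :=
  memLp_finsetSum _ fun _ hs => (memLp_cv hF hF2 (scaled_smooth _ α)
    (scaled_hasCompactSupport hh hs α)).const_mul _

theorem norm_le_of_mem_tsupport_scaled {t : ℝ} (ht : 0 < t) {x : E n}
    (hx : x ∈ tsupport (dil (baseKernel a) t)) : ‖x‖ ≤ t * (‖a‖ + 1) := by
  have h1 := norm_le_of_mem_tsupport_baseKernel (tsupport_dil_subset hx)
  rw [norm_smul, norm_inv, Real.norm_of_nonneg ht.le, inv_mul_le_iff₀ ht] at h1
  exact h1

/-- The smoothed jet vanishes away from the support of the function. -/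
theorem smooth_eq_zero (hh : 0 < h) {y : E n}
    (hy : ∀ u, ‖y - u‖ ≤ i * h * (‖a‖ + 1) → F u = 0) (α : Fin n → ℕ) :
    smooth a i h F α y = 0 := by
  unfold smooth
  refine Finset.sum_eq_zero fun s hs => ?_
  have hsp := scale_pos hh hs
  have : ∀ u, F u * multiDeriv α (dil (baseKernel a) (s * h)) (y - u) = 0 := by
    intro u
    by_cases hu : y - u ∈ tsupport (multiDeriv α (dil (baseKernel a) (s * h)))
    · have h1 := norm_le_of_mem_tsupport_scaled hsp
        (tsupport_multiDeriv_subset (dil_smooth (baseKernel_smooth a) _) α hu)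
      rw [hy u, zero_mul]
      refine h1.trans ?_
      have := (Finset.mem_Icc.1 hs).2
      gcongr
    · rw [image_eq_zero_of_notMem_tsupport hu, mul_zero]
  simp [cv, this]

/-- The radius 3 of the cone is 2 + 1: with y' ∈ V near y, the vector (y - y')/t has length below 2,
and -x/t lies within 1 of a. Hence y - x = y' + tz with z in the ball of radius 3 around a. -/
theorem sub_mem_of_cone {V : Set (E n)}
    (hcone : ∀ y ∈ V, ∀ t : ℝ, 0 < t → ∀ z ∈ Metric.ball a 3, y + t • z ∈ V) {t : ℝ} (hh : 0 < h)
    (ht : h ≤ t) {y : E n} (hy : y ∈ Metric.thickening (2 * h) V) {x : E n}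
    (hx : x ∈ tsupport (dil (baseKernel a) t)) : y - x ∈ V := by
  obtain ⟨y', hy', hd⟩ := Metric.mem_thickening_iff.1 hy
  have ht0 : 0 < t := hh.trans_le ht
  have h1 := norm_add_le_of_mem_tsupport_baseKernel (tsupport_dil_subset hx)
  have h2 := hcone y' hy' t ht0 (t⁻¹ • (y - y' - x)) (by
    rw [mem_ball_iff_norm]
    have e : t⁻¹ • (y - y' - x) - a = t⁻¹ • (y - y') - (t⁻¹ • x + a) := by
      rw [smul_sub]; abel
    rw [e]
    refine (norm_sub_le _ _).trans_lt ?_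
    have h3 : ‖t⁻¹ • (y - y')‖ < 2 := by
      rw [norm_smul, norm_inv, Real.norm_of_nonneg ht0.le, inv_mul_lt_iff₀ ht0]
      rw [dist_eq_norm] at hd
      linarith
    linarith)
  rw [smul_inv_smul₀ ht0.ne'] at h2
  convert h2 using 1
  abel

theorem integrable_shift_mul (hF : LocallyIntegrable F volume) {ρ : E n → ℂ} (hρ : Smooth ρ)
    (hc : HasCompactSupport ρ) {t : ℝ} (ht : 0 < t) (y : E n) :
    Integrable fun x => F (y - t • x) * ρ x := by
  have h1 : IsTestFunction univ (fun u => dil ρ t (y - u)) :=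
    isTestFunction_reflect (dil_smooth hρ t) (dil_hasCompactSupport hc ht) fun _ _ => mem_univ _
  have h2 := ((h1.integrable_mul (hF.locallyIntegrableOn univ)).comp_sub_left y).comp_smul ht.ne'
  have h3 := h2.const_mul (t ^ n : ℂ)
  refine h3.congr (Eventually.of_forall fun x => ?_)
  have h4 : (t : ℂ) ^ n ≠ 0 := pow_ne_zero _ (by exact_mod_cast ht.ne')
  simp only [dil, sub_sub_cancel, inv_smul_smul₀ ht.ne', Complex.ofReal_inv, Complex.ofReal_pow]
  field_simp

theorem subset_thickening_self {V : Set (E n)} (hh : 0 < h) : V ⊆ Metric.thickening (2 * h) V :=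
  Metric.self_subset_thickening (by positivity) V

/-- The approximation error as an average of differences. -/
theorem Jet.sub_smooth_eq {V : Set (E n)} {f : (Fin n → ℕ) → E n → ℂ} (hf : Jet i V f)
    (hcone : ∀ y ∈ V, ∀ t : ℝ, 0 < t → ∀ z ∈ Metric.ball a 3, y + t • z ∈ V) (hh : 0 < h)
    {γ : Fin n → ℕ} (hγ : deg γ ≤ i) {y : E n} (hy : y ∈ V) :
    f γ y - smooth a i h (f 0) γ y
      = ∫ x, ((-1) ^ i * (fwdDiff (-(h • x)))^[i] (f γ) y) * baseKernel a x := by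
  have hloc := hf.locallyIntegrable hγ
  have hks := baseKernel_smooth a
  have hkc := baseKernel_hasCompactSupport a
  have hki : Integrable (baseKernel a) := hks.continuous.integrable_of_hasCompactSupport hkc
  have h1 : smooth a i h (f 0) γ y
      = ∑ s ∈ Finset.Icc 1 i, diffCoeff i s * ∫ x, f γ (y - ((s : ℝ) * h) • x) * baseKernel a x := by
    unfold smooth
    refine Finset.sum_congr rfl fun s hs => ?_
    have hsp := scale_pos hh hs
    have hs1 : (1 : ℝ) ≤ s := by exact_mod_cast (Finset.mem_Icc.1 hs).1
    -- The whole of ∂^γ moves from the kernel to the jet, so the error for ∂^γ f has the same form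
    -- as the one for f.
    have h2 := hf.cv_multiDeriv (dil_smooth hks (s * h)) (dil_hasCompactSupport hkc hsp) (y := y)
      (fun x hx => sub_mem_of_cone hcone hh (by nlinarith) (subset_thickening_self hh hy) hx)
      γ hγ 0
    rw [add_zero, multiDeriv_zero] at h2
    rw [h2, cv_dil _ _ hsp]
  -- The kernel has integral one, so f_γ(y) can join the shifted values under a single integral and
  -- form a difference.
  have h3 : f γ y = ∫ x, f γ y * baseKernel a x := by
    rw [integral_const_mul, integral_baseKernel, mul_one]
  have hint : ∀ s ∈ Finset.Icc 1 i,
      Integrable fun x => diffCoeff i s * (f γ (y - ((s : ℝ) * h) • x) * baseKernel a x) :=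
    fun s hs => (integrable_shift_mul hloc hks hkc (scale_pos hh hs) y).const_mul _
  conv_lhs => rw [h3, h1]
  simp only [← integral_const_mul]
  rw [← integral_finsetSum _ hint, ← integral_sub (hki.const_mul _) (integrable_finsetSum _ hint)]
  congr 1
  funext x
  rw [← sub_sum_diffCoeff, sub_mul, Finset.sum_mul]
  congr 1
  refine Finset.sum_congr rfl fun s _ => ?_
  have : y + s • (-(h • x)) = y - ((s : ℝ) * h) • x := by
    rw [smul_neg, ← sub_eq_add_neg, mul_smul, Nat.cast_smul_eq_nsmul]
  rw [this]
  ring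

/-- The approximation constant. -/
noncomputable def approxConst (n i : ℕ) (a : E n) : ℝ≥0∞ :=
  (4 * ((n ^ 2 + 1) * ENNReal.ofReal (‖a‖ + 1) ^ 2)) ^ i

/-- The error is an average of i-th differences of ∂^γ f with steps of length O(h). Only i - |γ|
derivatives are left to spend, each gaining a factor h; the other |γ| differences cost constants,
and the weight h^|γ| completes h^i. -/
theorem Jet.wsq_sub_smooth_le {V : Set (E n)} (hV : IsOpen V) {f : (Fin n → ℕ) → E n → ℂ}
    (hf : Jet i V f)
    (hcone : ∀ y ∈ V, ∀ t : ℝ, 0 < t → ∀ z ∈ Metric.ball a 3, y + t • z ∈ V) (hh : 0 < h)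
    {γ : Fin n → ℕ} (hγ : deg γ ≤ i) :
    wsq h V (fun γ y => f γ y - smooth a i h (f 0) γ y) γ
      ≤ approxConst n i a * (ENNReal.ofReal h ^ (2 * i) * sobSum i V f) := by
  set R := ENNReal.ofReal (‖a‖ + 1) with hR
  have hR1 : 1 ≤ R := by
    rw [hR, ENNReal.one_le_ofReal]
    linarith [norm_nonneg a]
  obtain ⟨q, hq⟩ := Nat.exists_eq_add_of_le hγ
  have hks := baseKernel_smooth a
  have hfm := hf.meas γ
  set M : ℝ≥0∞ := 4 ^ deg γ * ((n ^ 2 * (ENNReal.ofReal h * R) ^ 2) ^ q * sobSum i V f) with hM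
  have hb : ∀ x ∈ tsupport (baseKernel a),
      sqNorm V (fun y => (-1) ^ i * (fwdDiff (-(h • x)))^[i] (f γ) y) ≤ M := by
    intro x hx
    set τ : E n := -(h • x) with hτ
    have hinv : ∀ y ∈ V, ∀ t : ℝ, 0 ≤ t → y + t • τ ∈ V := by
      intro y hy t ht
      rcases ht.eq_or_lt with rfl | ht
      · simpa using hy
      · have := hcone y hy (t * h) (by positivity) (-x) (by
          rw [mem_ball_iff_norm, ← norm_neg]
          have := norm_add_le_of_mem_tsupport_baseKernel hx
          have e : -(-x - a) = x + a := by abel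
          rw [e]
          linarith)
        rwa [hτ, ← smul_neg, smul_smul]
    have hinv1 : ∀ y ∈ V, y + τ ∈ V := fun y hy => by simpa using hinv y hy 1 zero_le_one
    have hτn : ENNReal.ofReal ‖τ‖ ≤ ENNReal.ofReal h * R := by
      rw [hR, ← ENNReal.ofReal_mul hh.le]
      apply ENNReal.ofReal_le_ofReal
      rw [hτ, norm_neg, norm_smul, Real.norm_of_nonneg hh.le]
      gcongr
      exact norm_le_of_mem_tsupport_baseKernel hx
    rw [sqNorm_const_mul]
    have h1 : ‖((-1 : ℂ)) ^ i‖ₑ ^ 2 = 1 := by simp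
    -- The i = |γ| + q differences are split: the inner q are traded for derivatives, the outer |γ|
    -- are bounded crudely.
    rw [h1, one_mul, hq, Function.iterate_add_apply]
    refine (GFEM.sqNorm_fwdDiff_iterate_le hV hinv1 (measurable_fwdDiff_iterate hfm q) _).trans ?_
    have h2 := (hf.shift_add (γ := γ) (l := q) (by omega)).sqNorm_fwdDiff_iterate_le hV hinv q
      (M := sobSum i V f) (fun δ hδ => sqNorm_le_sobSum (by rw [deg_add]; omega))
    simp only [add_zero] at h2
    rw [hM]
    gcongr
    refine h2.trans ?_
    gcongr
  -- Joint measurability is read off the expanded difference, since the step depends on the second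
  -- variable.
  have hH : Measurable fun p : E n × E n =>
      (-1 : ℂ) ^ i * (fwdDiff (-(h • p.2)))^[i] (f γ) p.1 := by
    have e : (fun p : E n × E n => (-1 : ℂ) ^ i * (fwdDiff (-(h • p.2)))^[i] (f γ) p.1)
        = fun p => f γ p.1 - ∑ s ∈ Finset.Icc 1 i, diffCoeff i s * f γ (p.1 + s • (-(h • p.2))) :=
      funext fun p => (sub_sum_diffCoeff i (f γ) p.1 _).symm
    rw [e]
    refine (hfm.comp measurable_fst).sub (Finset.measurable_sum _ fun s _ => ?_)
    exact (hfm.comp (by fun_prop)).const_mul _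
  have h1 : sqNorm V (fun y => f γ y - smooth a i h (f 0) γ y) ≤ M := by
    rw [sqNorm_congr_on hV.measurableSet fun y hy => hf.sub_smooth_eq hcone hh hγ hy]
    refine (sqNorm_integral_mul_le
      (H := fun y x => (-1 : ℂ) ^ i * (fwdDiff (-(h • x)))^[i] (f γ) y) hH
      hks.continuous.measurable
      (hks.continuous.integrable_of_hasCompactSupport (baseKernel_hasCompactSupport a)) hb).trans ?_
    rw [integral_norm_baseKernel]
    simp
  have h4 : (1 : ℝ≥0∞) ≤ 4 := by norm_num
  -- The summand 1 in `approxConst` keeps this base at least 1, so that the exponent q can be raised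
  -- to i.
  have hn1 : 1 ≤ ((n : ℝ≥0∞) ^ 2 + 1) * R ^ 2 := by
    calc (1 : ℝ≥0∞) = 1 * 1 ^ 2 := by norm_num
      _ ≤ _ := by
        gcongr
        exact le_add_self
  set e := ENNReal.ofReal h
  calc wsq h V (fun γ y => f γ y - smooth a i h (f 0) γ y) γ
      ≤ e ^ (2 * deg γ) * M := by
        unfold wsq; gcongr
    _ = (4 ^ deg γ * (n ^ 2 * R ^ 2) ^ q) * (e ^ (2 * i) * sobSum i V f) := by
        rw [hM, hq]; ring
    _ ≤ (4 ^ i * ((n ^ 2 + 1) * R ^ 2) ^ i) * (e ^ (2 * i) * sobSum i V f) := by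
        gcongr ?_ * _
        have h5 : ((n : ℝ≥0∞) ^ 2 * R ^ 2) ^ q ≤ (((n : ℝ≥0∞) ^ 2 + 1) * R ^ 2) ^ q := by
          gcongr
          exact le_self_add
        refine mul_le_mul' (pow_le_pow_right₀ h4 (by omega)) (h5.trans ?_)
        exact pow_le_pow_right₀ hn1 (by omega)
    _ = _ := by rw [approxConst, ← mul_pow]

/-- For high derivatives of the smoothed function: γ is the part that f can bear, δ the part left on
the kernel. -/
theorem exists_decomp (i : ℕ) (α : Fin n → ℕ) (hα : i ≤ deg α) :
    ∃ γ δ : Fin n → ℕ, α = γ + δ ∧ deg γ = i := by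
  induction α using multiIndex_induction with
  | h0 => exact ⟨0, 0, by simp, by simp at hα; simp [hα]⟩
  | hs α l ih =>
    rw [deg_add_single] at hα
    rcases hα.eq_or_lt with h | h
    · exact ⟨α + Pi.single l 1, 0, by simp, by rw [deg_add_single, h]⟩
    · obtain ⟨γ, δ, rfl, hγ⟩ := ih (by omega)
      exact ⟨γ, δ + Pi.single l 1, by rw [add_assoc], hγ⟩

/-- The constant for the high derivatives of the smoothed jet. -/
noncomputable def smoothConst (n i j : ℕ) (a : E n) : ℝ≥0∞ :=
  i * (∑ s ∈ Finset.Icc 1 i, ‖diffCoeff i s‖ₑ ^ 2) *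
    ∑ δ ∈ multiIndices n j, ENNReal.ofReal (∫ x, ‖multiDeriv δ (baseKernel a) x‖) ^ 2

/-- Exactly i derivatives fall on f; the remaining ones hit the kernel at scale sh and cost
(sh)^(-1) ≤ h^(-1) each. The slack in the cone makes this valid on a 2h-neighbourhood of V. -/
theorem Jet.wsq_smooth_le {V : Set (E n)} (hV : IsOpen V) {f : (Fin n → ℕ) → E n → ℂ}
    (hf : Jet i V f)
    (hcone : ∀ y ∈ V, ∀ t : ℝ, 0 < t → ∀ z ∈ Metric.ball a 3, y + t • z ∈ V) (hh : 0 < h)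
    {j : ℕ} {α : Fin n → ℕ} (hα : i ≤ deg α) (hαj : deg α ≤ j) :
    wsq h (Metric.thickening (2 * h) V) (smooth a i h (f 0)) α
      ≤ smoothConst n i j a * (ENNReal.ofReal h ^ (2 * i) * sobSum i V f) := by
  obtain ⟨γ, δ, rfl, hγ⟩ := exists_decomp i α hα
  have hks := baseKernel_smooth a
  have hkc := baseKernel_hasCompactSupport a
  set W := Metric.thickening (2 * h) V with hW
  have hWm : MeasurableSet W := Metric.isOpen_thickening.measurableSet
  set e := ENNReal.ofReal h with he
  set Nδ := ENNReal.ofReal (∫ x, ‖multiDeriv δ (baseKernel a) x‖) with hNδ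
  have hfm := hf.meas γ
  have hloc := hf.locallyIntegrable hγ.le
  have h1 : ∀ y ∈ W, smooth a i h (f 0) (γ + δ) y = ∑ s ∈ Finset.Icc 1 i,
      diffCoeff i s * cv (f γ) (multiDeriv δ (dil (baseKernel a) (s * h))) y := by
    intro y hy
    unfold smooth
    refine Finset.sum_congr rfl fun s hs => ?_
    have hs1 : (1 : ℝ) ≤ s := by exact_mod_cast (Finset.mem_Icc.1 hs).1
    rw [hf.cv_multiDeriv (dil_smooth hks (s * h)) (dil_hasCompactSupport hkc (scale_pos hh hs))
      (fun x hx => sub_mem_of_cone hcone hh (by nlinarith) hy hx) γ hγ.le δ]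
  have h2 : ∀ s ∈ Finset.Icc 1 i, e ^ (2 * deg δ) *
      sqNorm W (cv (f γ) (multiDeriv δ (dil (baseKernel a) (s * h)))) ≤ Nδ ^ 2 * sobSum i V f := by
    intro s hs
    have hsp := scale_pos hh hs
    have hs1 : (1 : ℝ) ≤ s := by exact_mod_cast (Finset.mem_Icc.1 hs).1
    have hks' := scaled_smooth (a := a) (s * h) δ
    have h3 := sqNorm_cv_le hfm hks'.continuous.measurable
      (hks'.continuous.integrable_of_hasCompactSupport (scaled_hasCompactSupport hh hs δ)) W
    rw [integral_norm_multiDeriv_dil hks hsp, sqNorm_univ_of_zero hV.measurableSet (hf.zero γ)] at h3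
    have h4 : e ^ deg δ * ENNReal.ofReal (((s : ℝ) * h)⁻¹ ^ deg δ *
        ∫ x, ‖multiDeriv δ (baseKernel a) x‖) ≤ Nδ := by
      rw [he, ← ENNReal.ofReal_pow hh.le, ← ENNReal.ofReal_mul (by positivity), hNδ]
      apply ENNReal.ofReal_le_ofReal
      have h5 : h ^ deg δ * ((s : ℝ) * h)⁻¹ ^ deg δ ≤ 1 := by
        rw [← mul_pow]
        apply pow_le_one₀ (by positivity)
        rw [mul_inv_le_iff₀ hsp]
        nlinarith
      have h6 : 0 ≤ ∫ x, ‖multiDeriv δ (baseKernel a) x‖ := integral_nonneg fun _ => norm_nonneg _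
      calc h ^ deg δ * (((s : ℝ) * h)⁻¹ ^ deg δ * ∫ x, ‖multiDeriv δ (baseKernel a) x‖)
          = (h ^ deg δ * ((s : ℝ) * h)⁻¹ ^ deg δ) * ∫ x, ‖multiDeriv δ (baseKernel a) x‖ := by ring
        _ ≤ 1 * ∫ x, ‖multiDeriv δ (baseKernel a) x‖ := by gcongr
        _ = _ := one_mul _
    set D := ENNReal.ofReal (((s : ℝ) * h)⁻¹ ^ deg δ * ∫ x, ‖multiDeriv δ (baseKernel a) x‖)
    calc e ^ (2 * deg δ) * sqNorm W (cv (f γ) (multiDeriv δ (dil (baseKernel a) (s * h))))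
        ≤ e ^ (2 * deg δ) * (D ^ 2 * sqNorm V (f γ)) := by gcongr
      _ = (e ^ deg δ * D) ^ 2 * sqNorm V (f γ) := by ring
      _ ≤ Nδ ^ 2 * sobSum i V f := by
          gcongr
          exact sqNorm_le_sobSum hγ.le
  have hcard : (Finset.Icc 1 i).card = i := by simp
  have hNle : Nδ ^ 2 ≤ ∑ δ ∈ multiIndices n j,
      ENNReal.ofReal (∫ x, ‖multiDeriv δ (baseKernel a) x‖) ^ 2 :=
    Finset.single_le_sum (f := fun δ =>
      ENNReal.ofReal (∫ x, ‖multiDeriv δ (baseKernel a) x‖) ^ 2) (fun _ _ => zero_le)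
      (mem_multiIndices.2 (by rw [deg_add] at hαj; omega))
  calc wsq h W (smooth a i h (f 0)) (γ + δ)
      = e ^ (2 * i) * (e ^ (2 * deg δ) * sqNorm W (fun y => ∑ s ∈ Finset.Icc 1 i,
          diffCoeff i s * cv (f γ) (multiDeriv δ (dil (baseKernel a) (s * h))) y)) := by
        rw [wsq, sqNorm_congr_on hWm h1, deg_add, hγ]
        ring
    _ ≤ e ^ (2 * i) * (e ^ (2 * deg δ) * (i * ∑ s ∈ Finset.Icc 1 i, ‖diffCoeff i s‖ₑ ^ 2 *
          sqNorm W (cv (f γ) (multiDeriv δ (dil (baseKernel a) (s * h)))))) := by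
        gcongr
        have := sqNorm_finset_sum_le (Finset.Icc 1 i) W (fun s y =>
          diffCoeff i s * cv (f γ) (multiDeriv δ (dil (baseKernel a) (s * h))) y) (fun s hs =>
            ((cv_smooth hloc (scaled_smooth _ δ)
              (scaled_hasCompactSupport hh hs δ)).continuous.measurable.const_mul _).aemeasurable)
        simpa only [hcard, sqNorm_const_mul] using this
    _ = e ^ (2 * i) * (i * ∑ s ∈ Finset.Icc 1 i, ‖diffCoeff i s‖ₑ ^ 2 * (e ^ (2 * deg δ) *
          sqNorm W (cv (f γ) (multiDeriv δ (dil (baseKernel a) (s * h)))))) := by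
        simp only [Finset.mul_sum]
        exact Finset.sum_congr rfl fun s _ => by ring
    _ ≤ e ^ (2 * i) * (i * ∑ s ∈ Finset.Icc 1 i, ‖diffCoeff i s‖ₑ ^ 2 *
          (Nδ ^ 2 * sobSum i V f)) := by
        exact mul_le_mul' le_rfl (mul_le_mul' le_rfl (Finset.sum_le_sum fun s hs =>
          mul_le_mul' le_rfl (h2 s hs)))
    _ = i * (∑ s ∈ Finset.Icc 1 i, ‖diffCoeff i s‖ₑ ^ 2) * Nδ ^ 2 *
          (e ^ (2 * i) * sobSum i V f) := by
        rw [← Finset.sum_mul]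
        ring
    _ ≤ _ := by
        unfold smoothConst
        gcongr

end smooth

/-! ### Multiplication by test functions -/

theorem sqNorm_le_of_zero {U V : Set (E n)} (hU : MeasurableSet U) (hV : MeasurableSet V)
    {f : E n → ℂ} (hf : ∀ x ∈ U, x ∉ V → f x = 0) : sqNorm U f ≤ sqNorm V f := by
  have h1 : sqNorm U f = sqNorm U (V.indicator f) :=
    sqNorm_congr_on hU fun x hx => by
      by_cases hxV : x ∈ V
      · simp [hxV]
      · simp [hxV, hf x hx hxV]
  rw [h1, ← sqNorm_indicator hV (subset_univ V) f]
  exact sqNorm_mono_set (subset_univ U) _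

/-- The jet of a globally smooth function. -/
theorem jet_of_partialDeriv {k : ℕ} {V : Set (E n)} (hV : IsOpen V)
    {f : (Fin n → ℕ) → E n → ℂ} (hf : ∀ α, Smooth (f α)) (hf2 : ∀ α, MemLp (f α) 2 volume)
    (hd : ∀ α l, partialDeriv l (f α) = f (α + Pi.single l 1)) :
    Jet k V (fun α => V.indicator (f α)) := by
  refine ⟨fun α => (hf α).continuous.measurable.indicator hV.measurableSet,
    fun α x hx => by simp [hx], fun α _ => (hf2 α).indicator hV.measurableSet, fun α l _ => ?_⟩
  have h := smooth_WD (hf α) l V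
  rw [hd] at h
  refine h.congr ?_ ?_ <;>
  · exact (indicator_ae_eq_restrict hV.measurableSet).symm

theorem exists_multiDeriv_bound {χ : E n → ℂ} (hχ : Smooth χ) (hc : HasCompactSupport χ)
    (k : ℕ) : ∃ M : ℝ, 0 ≤ M ∧ ∀ β, deg β ≤ k → ∀ x, ‖multiDeriv β χ x‖ ≤ M := by
  have h1 : ∀ β, ∃ C, ∀ x, ‖multiDeriv β χ x‖ ≤ C := fun β =>
    (hχ.multiDeriv β).continuous.bounded_above_of_compact_support
      (hc.of_isClosed_subset (isClosed_tsupport _) (tsupport_multiDeriv_subset hχ β))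
  choose C hC using h1
  refine ⟨∑ β ∈ multiIndices n k, |C β|, Finset.sum_nonneg fun _ _ => abs_nonneg _,
    fun β hβ x => ?_⟩
  calc ‖multiDeriv β χ x‖ ≤ |C β| := (hC β x).trans (le_abs_self _)
    _ ≤ _ := Finset.single_le_sum (f := fun β => |C β|) (fun _ _ => abs_nonneg _)
      (mem_multiIndices.2 hβ)

/-- The Leibniz rule for a fixed cut-off, at scale η = 1. Since X need not lie in Y, it also extends
χf by zero to a larger set. -/
theorem Jet.exists_mul_smooth {X Y : Set (E n)} (hX : IsOpen X) (hY : IsOpen Y) {χ : E n → ℂ}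
    (hχ : Smooth χ) (hc : HasCompactSupport χ) (hXY : tsupport χ ∩ X ⊆ Y) (k : ℕ) :
    ∃ C : ℝ≥0∞, C ≠ ∞ ∧ ∀ f, Jet k Y f → ∃ q, Jet k X q ∧
      (∀ α x, x ∉ tsupport χ → q α x = 0) ∧
      q 0 =ᵐ[volume.restrict X] (fun x => χ x * f 0 x) ∧ sobSum k X q ≤ C * sobSum k Y f := by
  obtain ⟨M, hM0, hM⟩ := exists_multiDeriv_bound hχ hc k
  have hp : Jet k X (fun β => X.indicator (multiDeriv β χ)) :=
    jet_of_partialDeriv hX (fun β => hχ.multiDeriv β)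
      (fun β => (hχ.multiDeriv β).continuous.memLp_of_hasCompactSupport
        (hc.of_isClosed_subset (isClosed_tsupport _) (tsupport_multiDeriv_subset hχ β)))
      (fun β l => (multiDeriv_add_single hχ β l).symm)
  set c : ℝ≥0∞ := ENNReal.ofReal (2 ^ k * M) ^ 2 * (multiIndices n k).card with hcdef
  refine ⟨(multiIndices n k).card * c, by rw [hcdef]; finiteness, fun f hf => ?_⟩
  obtain ⟨q, hq, hq0, hqT, hqs⟩ := Jet.exists_mul hX hY (isClosed_tsupport χ) hXY one_pos hp hf hM0
    (fun β hβ => Eventually.of_forall fun x => by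
      rw [one_pow, one_mul]
      exact (norm_indicator_le_norm_self _ x).trans (hM β hβ x))
    (fun β _ x hx => by
      have : multiDeriv β χ x = 0 :=
        image_eq_zero_of_notMem_tsupport fun h => hx (tsupport_multiDeriv_subset hχ β h)
      simp [this])
  have hTm : MeasurableSet (tsupport χ) := (isClosed_tsupport χ).measurableSet
  have hae : ∀ α, deg α ≤ k → q α =ᵐ[volume.restrict X] (tsupport χ).indicator (q α) := by
    intro α hα
    filter_upwards [hqT α hα] with x hx
    by_cases hxT : x ∈ tsupport χ
    · simp [hxT]
    · simp [hxT, hx hxT]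
  refine ⟨fun α => (tsupport χ).indicator (q α), hq.congr_ae hX
    (fun α => (hq.meas α).indicator hTm) (fun α x hx => by simp [hq.zero α x hx])
    hae, fun α x hx => by simp [hx], ?_, ?_⟩
  · refine (hae 0 (by simp)).symm.trans (hq0.trans ?_)
    filter_upwards [ae_restrict_mem hX.measurableSet] with x hx
    simp [hx]
  · have h1 : ∀ α ∈ multiIndices n k,
        sqNorm X ((tsupport χ).indicator (q α)) ≤ c * sobSum k Y f := by
      intro α hα
      rw [← sqNorm_congr (hae α (mem_multiIndices.1 hα))]
      have h1 := hqs α (mem_multiIndices.1 hα)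
      simp only [wsq, ENNReal.ofReal_one, one_pow, one_mul] at h1
      exact h1
    calc sobSum k X _ ≤ ∑ _α ∈ multiIndices n k, c * sobSum k Y f := Finset.sum_le_sum h1
      _ = _ := by rw [Finset.sum_const, nsmul_eq_mul, ← mul_assoc]

/-! ### Charts of a Lipschitz domain -/

/-- Near `x`, the open set `Ω` agrees with `V`, which is invariant under translations by the
cone spanned by the ball of radius `3` around `a`. -/
structure Chart (Ω : Set (E n)) (x : E n) (V : Set (E n)) (a : E n) (r : ℝ) : Prop where
  isOpen : IsOpen V
  pos : 0 < r
  inter : V ∩ Metric.ball x r = Ω ∩ Metric.ball x r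
  cone : ∀ y ∈ V, ∀ t : ℝ, 0 < t → ∀ z ∈ Metric.ball a 3, y + t • z ∈ V

theorem exists_chart {Ω : Set (E n)} (hΩ : IsOpen Ω) (hL : HasLipschitzBoundary Ω) {x : E n}
    (hx : x ∈ closure Ω) : ∃ V a r, Chart Ω x V a r := by
  by_cases hxΩ : x ∈ Ω
  · obtain ⟨r, hr, hb⟩ := Metric.isOpen_iff.1 hΩ x hxΩ
    refine ⟨univ, 0, r, isOpen_univ, hr, ?_, fun _ _ _ _ _ _ => mem_univ _⟩
    rw [univ_inter, inter_eq_right.2 hb]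
  · obtain ⟨e, g, K, r, he, hg, hge, hr, hchart⟩ := hL x ⟨hx, fun h => hxΩ (interior_subset h)⟩
    -- For z within 3 of a, moving by tz raises g by at most 3Kt and ⟨e, ·⟩ by at least (3K + 3)t -
    -- 3t = 3Kt, so the strict inequality persists.
    refine ⟨{y | g y < inner ℝ e y}, (3 * (K : ℝ) + 3) • e, r,
      isOpen_lt hg.continuous (by fun_prop), hr, ?_, ?_⟩
    · ext y
      constructor
      · rintro ⟨h1, h2⟩
        exact ⟨(hchart y h2).2 h1, h2⟩
      · rintro ⟨h1, h2⟩
        exact ⟨(hchart y h2).1 h1, h2⟩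
    · intro y hy t ht z hz
      set a := (3 * (K : ℝ) + 3) • e with ha
      have hz' : ‖z - a‖ < 3 := mem_ball_iff_norm.1 hz
      have h1 : g (y + t • z) ≤ g y + K * (t * 3) := by
        have e1 : y + t • z = (y + t • (z - a)) + (t * (3 * K + 3)) • e := by
          rw [ha, smul_sub, smul_smul]; abel
        rw [e1, hge]
        have h2 := hg.dist_le_mul (y + t • (z - a)) y
        rw [Real.dist_eq, dist_eq_norm, add_sub_cancel_left, norm_smul,
          Real.norm_of_nonneg ht.le] at h2
        have h3 := le_abs_self (g (y + t • (z - a)) - g y)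
        have h4 : (K : ℝ) * (t * ‖z - a‖) ≤ K * (t * 3) := by gcongr
        linarith
      have h2 : t * (3 * K) ≤ inner ℝ e (t • z) := by
        rw [inner_smul_right]
        gcongr
        have e1 : z = (z - a) + a := by abel
        rw [e1, inner_add_right, ha, inner_smul_right, real_inner_self_eq_norm_sq, he]
        have h3 := abs_real_inner_le_norm e (z - a)
        rw [he, one_mul] at h3
        have h4 := neg_abs_le (inner ℝ e (z - a))
        rw [ha] at hz' h3 h4
        linarith
      change g (y + t • z) < inner ℝ e (y + t • z)
      rw [inner_add_right]
      have h3 : g y < inner ℝ e y := hy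
      linarith

/-! ### Smoothing on a Lipschitz domain -/

/-- `χ f`, for `f ∈ H^i(Ω)`, has a smooth approximation at each small scale `h`, defined on the
`2 h`-neighbourhood of `Ω`. -/
def Smoothable (i j : ℕ) (Ω : Set (E n)) (χ : E n → ℂ) : Prop :=
  ∃ C : ℝ≥0∞, C ≠ ∞ ∧ ∃ h₀ : ℝ, 0 < h₀ ∧ ∀ h, 0 < h → h ≤ h₀ → ∀ f, Jet i Ω f →
    ∃ F g, Jet i Ω F ∧ F 0 =ᵐ[volume.restrict Ω] (fun x => χ x * f 0 x) ∧
      Jet j (Metric.thickening (2 * h) Ω) g ∧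
      (∀ γ, deg γ ≤ i → wsq h Ω (fun γ x => F γ x - g γ x) γ
        ≤ C * (ENNReal.ofReal h ^ (2 * i) * sobSum i Ω f)) ∧
      ∀ α, i ≤ deg α → deg α ≤ j → wsq h (Metric.thickening (2 * h) Ω) g α
        ≤ C * (ENNReal.ofReal h ^ (2 * i) * sobSum i Ω f)

/-- The approximation of χρf is the one of χ applied to ρf ∈ H^i. Together with sums, this permits
gluing charts. -/
theorem Smoothable.mul {i j : ℕ} {Ω : Set (E n)} (hΩ : IsOpen Ω) {χ ρ : E n → ℂ}
    (h : Smoothable i j Ω χ) (hρ : IsTestFunction univ ρ) :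
    Smoothable i j Ω (fun x => χ x * ρ x) := by
  obtain ⟨C, hC, h₀, hh₀, H⟩ := h
  obtain ⟨C', hC', H'⟩ := Jet.exists_mul_smooth hΩ hΩ hρ.1 hρ.2.1 inter_subset_right i
  refine ⟨C * C', by finiteness, h₀, hh₀, fun h hh hhh f hf => ?_⟩
  obtain ⟨q, hq, -, hq0, hqs⟩ := H' f hf
  obtain ⟨F, g, hF, hF0, hg, h1, h2⟩ := H h hh hhh q hq
  have hb : C * (ENNReal.ofReal h ^ (2 * i) * sobSum i Ω q)
      ≤ C * C' * (ENNReal.ofReal h ^ (2 * i) * sobSum i Ω f) := by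
    calc C * (ENNReal.ofReal h ^ (2 * i) * sobSum i Ω q)
        ≤ C * (ENNReal.ofReal h ^ (2 * i) * (C' * sobSum i Ω f)) := by gcongr
      _ = _ := by ring
  refine ⟨F, g, hF, ?_, hg, fun γ hγ => (h1 γ hγ).trans hb,
    fun α hα hαj => (h2 α hα hαj).trans hb⟩
  filter_upwards [hF0, hq0] with x hx hx'
  rw [hx, hx', mul_assoc]

theorem wsq_add_le {h : ℝ} {V : Set (E n)} {f g : (Fin n → ℕ) → E n → ℂ} {α : Fin n → ℕ}
    (hf : Measurable (f α)) :
    wsq h V (fun α x => f α x + g α x) α ≤ 2 * (wsq h V f α + wsq h V g α) := by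
  unfold wsq
  rw [← mul_add, mul_left_comm]
  gcongr
  exact sqNorm_add_le hf

theorem Smoothable.add {i j : ℕ} {Ω : Set (E n)} {χ ρ : E n → ℂ}
    (h : Smoothable i j Ω χ) (h' : Smoothable i j Ω ρ) :
    Smoothable i j Ω (fun x => χ x + ρ x) := by
  obtain ⟨C, hC, h₀, hh₀, H⟩ := h
  obtain ⟨C', hC', h₁, hh₁, H'⟩ := h'
  refine ⟨2 * (C + C'), by finiteness, min h₀ h₁, lt_min hh₀ hh₁, fun h hh hhh f hf => ?_⟩
  obtain ⟨F, g, hF, hF0, hg, h1, h2⟩ := H h hh (hhh.trans (min_le_left _ _)) f hf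
  obtain ⟨F', g', hF', hF0', hg', h1', h2'⟩ := H' h hh (hhh.trans (min_le_right _ _)) f hf
  refine ⟨_, _, hF.add hF', ?_, hg.add hg', fun γ hγ => ?_, fun α hα hαj => ?_⟩
  · filter_upwards [hF0, hF0'] with x hx hx'
    rw [hx, hx', add_mul]
  · have e : (fun γ x => (F γ x + F' γ x) - (g γ x + g' γ x))
        = fun γ x => (F γ x - g γ x) + (F' γ x - g' γ x) := by
      funext γ x; ring
    rw [e]
    refine (wsq_add_le (f := fun γ x => F γ x - g γ x) ((hF.meas γ).sub (hg.meas γ))).trans ?_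
    rw [mul_assoc 2, add_mul]
    gcongr
    exacts [h1 γ hγ, h1' γ hγ]
  · refine (wsq_add_le (hg.meas α)).trans ?_
    rw [mul_assoc 2, add_mul]
    gcongr
    exacts [h2 α hα hαj, h2' α hα hαj]

theorem approxConst_ne_top (i : ℕ) (a : E n) : approxConst n i a ≠ ∞ := by
  unfold approxConst
  finiteness

theorem smoothConst_ne_top (i j : ℕ) (a : E n) : smoothConst n i j a ≠ ∞ := by
  unfold smoothConst
  refine ENNReal.mul_ne_top (ENNReal.mul_ne_top (by finiteness) ?_) ?_ <;>
  · exact ENNReal.sum_ne_top.2 fun _ _ => by finiteness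

/-- On supp χ the sets Ω and V agree, so χf extends by zero to V, where the translation-invariant
smoothing applies. For small h its result stays in the ball of the chart, and the bounds return to
Ω. -/
theorem Chart.smoothable {Ω V : Set (E n)} {x a : E n} {r : ℝ} (hΩ : IsOpen Ω)
    (hV : Chart Ω x V a r) {χ : E n → ℂ} (hχ : IsTestFunction (Metric.ball x r) χ) (i j : ℕ) :
    Smoothable i j Ω χ := by
  have hsub : ∀ y, y ∈ tsupport χ → (y ∈ V ↔ y ∈ Ω) := by
    intro y hy
    have := congrArg (y ∈ ·) hV.inter
    simpa [hχ.2.2 hy] using this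
  have hUo : IsOpen (Ω ∪ V) := hΩ.union hV.isOpen
  -- The product is formed on Ω ∪ V, so that one and the same jet restricts to Ω and to V.
  obtain ⟨C, hC, H⟩ := Jet.exists_mul_smooth hUo hΩ hχ.1 hχ.2.1 (by
    rintro y ⟨hy, h | h⟩
    · exact h
    · exact (hsub y hy).1 h) i
  obtain ⟨δ, hδ, hδb⟩ := hχ.2.1.isCompact.exists_thickening_subset_open Metric.isOpen_ball hχ.2.2
  -- The reach in units of h: the largest kernel has scale ih and support within ih(‖a‖ + 1) of 0,
  -- and the neighbourhood of Ω adds 2h.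
  set L : ℝ := 2 + i * (‖a‖ + 1) with hL
  have hLpos : 0 < L := by positivity
  refine ⟨(approxConst n i a + smoothConst n i j a) * C,
    ENNReal.mul_ne_top (ENNReal.add_ne_top.2 ⟨approxConst_ne_top i a, smoothConst_ne_top i j a⟩) hC,
    δ / L, by positivity, fun h hh hhh f hf => ?_⟩
  obtain ⟨q, hq, hqT, hq0, hqs⟩ := H f hf
  have hzV : ∀ α y, y ∉ V → q α y = 0 := by
    intro α y hy
    by_cases hyT : y ∈ tsupport χ
    · exact hq.zero α y fun h => hy (h.elim (hsub y hyT).2 id)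
    · exact hqT α y hyT
  have hzΩ : ∀ α y, y ∉ Ω → q α y = 0 := by
    intro α y hy
    by_cases hyT : y ∈ tsupport χ
    · exact hq.zero α y fun h => hy (h.elim id (hsub y hyT).1)
    · exact hqT α y hyT
  have hind : ∀ {U : Set (E n)}, (∀ α y, y ∉ U → q α y = 0) → (fun α => U.indicator (q α)) = q := by
    intro U hU
    funext α y
    by_cases hy : y ∈ U
    · simp [hy]
    · simp [hy, hU α y hy]
  have hqV : Jet i V q := hind hzV ▸ hq.restrict hV.isOpen subset_union_right
  have hqΩ : Jet i Ω q := hind hzΩ ▸ hq.restrict hΩ subset_union_left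
  have hloc := hq.locallyIntegrable (α := 0) (by simp)
  set s := smooth a i h (q 0) with hs
  set W := Metric.thickening (2 * h) Ω with hW
  have hWo : IsOpen W := Metric.isOpen_thickening
  have hΩW : Ω ⊆ W := subset_thickening_self hh
  -- If the smoothed function were nonzero at y, then y' would lie in the chart ball, where Ω and V
  -- coincide.
  have hzero : ∀ y y', y' ∈ Ω → y' ∉ V → dist y y' < 2 * h → ∀ α, s α y = 0 := by
    intro y y' hy' hyV hd α
    refine smooth_eq_zero hh (fun u hu => hqT 0 u fun huT => hyV ?_) α
    have h1 : y' ∈ Metric.ball x r := by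
      refine hδb (Metric.mem_thickening_iff.2 ⟨u, huT, ?_⟩)
      calc dist y' u ≤ dist y' y + dist y u := dist_triangle _ _ _
        _ < 2 * h + i * h * (‖a‖ + 1) := by
            rw [dist_comm y', dist_eq_norm y u]
            linarith
        _ = h * L := by rw [hL]; ring
        _ ≤ δ := (le_div_iff₀ hLpos).1 hhh
    have h2 : y' ∈ Ω ∩ Metric.ball x r := ⟨hy', h1⟩
    rw [← hV.inter] at h2
    exact h2.1
  have hsV : sobSum i V q ≤ C * sobSum i Ω f :=
    (Finset.sum_le_sum fun α _ => sqNorm_mono_set subset_union_right _).trans hqs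
  have hsm : ∀ α, Smooth (s α) := fun α => smooth_smooth hh hloc α
  refine ⟨q, fun α => W.indicator (s α), hqΩ, ae_restrict_of_ae_restrict_of_subset subset_union_left
    hq0, jet_of_partialDeriv hWo hsm
      (fun α => memLp_smooth hh (hq.meas 0) (hq.memLp 0 (by simp)) α)
      (fun α l => partialDeriv_smooth hh hloc α l), fun γ hγ => ?_, fun α hα hαj => ?_⟩
  · have h1 : sqNorm Ω (fun y => q γ y - W.indicator (s γ) y) ≤ sqNorm V (fun y => q γ y - s γ y) := by
      rw [sqNorm_congr_on (g := fun y => q γ y - s γ y) hΩ.measurableSet fun y hy => by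
        simp [hΩW hy]]
      refine sqNorm_le_of_zero hΩ.measurableSet hV.isOpen.measurableSet fun y hy hyV => ?_
      rw [hzV γ y hyV, hzero y y hy hyV (by simpa using hh) γ, sub_zero]
    calc wsq h Ω (fun γ x => q γ x - W.indicator (s γ) x) γ
        ≤ wsq h V (fun γ y => q γ y - s γ y) γ := by unfold wsq; gcongr
      _ ≤ approxConst n i a * (ENNReal.ofReal h ^ (2 * i) * sobSum i V q) :=
          hqV.wsq_sub_smooth_le hV.isOpen hV.cone hh hγ
      _ ≤ approxConst n i a * (ENNReal.ofReal h ^ (2 * i) * (C * sobSum i Ω f)) := by gcongr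
      _ = approxConst n i a * C * (ENNReal.ofReal h ^ (2 * i) * sobSum i Ω f) := by ring
      _ ≤ _ := by gcongr; exact le_self_add
  · have h1 : sqNorm W (W.indicator (s α)) ≤ sqNorm (Metric.thickening (2 * h) V) (s α) := by
      rw [sqNorm_indicator hWo.measurableSet subset_rfl]
      refine sqNorm_le_of_zero hWo.measurableSet Metric.isOpen_thickening.measurableSet
        fun y hy hyV => ?_
      obtain ⟨y', hy', hd⟩ := Metric.mem_thickening_iff.1 hy
      exact hzero y y' hy' (fun h => hyV (Metric.mem_thickening_iff.2 ⟨y', h, hd⟩)) hd α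
    calc wsq h W (fun α => W.indicator (s α)) α
        ≤ wsq h (Metric.thickening (2 * h) V) s α := by unfold wsq; gcongr
      _ ≤ smoothConst n i j a * (ENNReal.ofReal h ^ (2 * i) * sobSum i V q) :=
          hqV.wsq_smooth_le hV.isOpen hV.cone hh hα hαj
      _ ≤ smoothConst n i j a * (ENNReal.ofReal h ^ (2 * i) * (C * sobSum i Ω f)) := by gcongr
      _ = smoothConst n i j a * C * (ENNReal.ofReal h ^ (2 * i) * sobSum i Ω f) := by ring
      _ ≤ _ := by gcongr; exact le_add_self

theorem isTestFunction_univ {χ : E n → ℂ} {U : Set (E n)} (h : IsTestFunction U χ) :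
    IsTestFunction univ χ := ⟨h.1, h.2.1, subset_univ _⟩

/-- Some cutoff function equal to one on a compact set of charts is smoothable. -/
theorem exists_smoothable {Ω K : Set (E n)} (hΩ : IsOpen Ω) (hL : HasLipschitzBoundary Ω)
    (hK : IsCompact K) (hKΩ : K ⊆ closure Ω) (i j : ℕ) :
    ∃ χ, IsTestFunction univ χ ∧ (∀ x ∈ K, χ x = 1) ∧ Smoothable i j Ω χ := by
  refine hK.induction_on (p := fun K => ∃ χ, IsTestFunction univ χ ∧ (∀ x ∈ K, χ x = 1) ∧
    Smoothable i j Ω χ) ?_ ?_ ?_ ?_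
  · refine ⟨fun _ => 0, ⟨contDiff_const, HasCompactSupport.zero, subset_univ _⟩, by simp, 0,
      by simp, 1, one_pos, fun h hh _ f _ => ⟨fun _ _ => 0, fun _ _ => 0, Jet.zero_jet _ _, ?_,
        Jet.zero_jet _ _, ?_, ?_⟩⟩
    · exact Eventually.of_forall fun x => by simp
    · intro γ _; simp [wsq, sqNorm]
    · intro γ _ _; simp [wsq, sqNorm]
  · rintro s t hst ⟨χ, h1, h2, h3⟩
    exact ⟨χ, h1, fun x hx => h2 x (hst hx), h3⟩
  · rintro s t ⟨χ, h1, h2, h3⟩ ⟨ρ, h1', h2', h3'⟩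
    have h4 : IsTestFunction univ fun x => -χ x :=
      ⟨h1.1.neg, h1.2.1.neg, subset_univ _⟩
    -- The function χ + ρ(1 - χ) equals 1 wherever χ or ρ does.
    refine ⟨fun x => χ x + (ρ x + ρ x * -χ x), ⟨h1.1.add (h1'.1.add (h1'.1.mul h4.1)),
      h1.2.1.add (h1'.2.1.add h1'.2.1.mul_right), subset_univ _⟩, ?_,
      h3.add (h3'.add (h3'.mul hΩ h4))⟩
    rintro x (hx | hx)
    · simp [h2 x hx]
    · simp [h2' x hx]
  · intro x hx
    obtain ⟨V, a, r, hV⟩ := exists_chart hΩ hL (hKΩ hx)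
    have hr := hV.pos
    obtain ⟨χ, hχ, h1, -⟩ := exists_cutoff (isCompact_closedBall x (r / 2)) Metric.isOpen_ball
      (Metric.closedBall_subset_ball (by linarith : r / 2 < r))
    exact ⟨Metric.closedBall x (r / 2), mem_nhdsWithin_of_mem_nhds
      (Metric.closedBall_mem_nhds x (by positivity)), χ, isTestFunction_univ hχ,
      fun y hy => h1.self_of_nhdsSet y hy, hV.smoothable hΩ hχ i j⟩

/-- **Smoothing operators** on a bounded Lipschitz domain. -/
theorem exists_smoothing {Ω : Set (E n)} (hΩ : IsOpen Ω) (hΩb : Bornology.IsBounded Ω)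
    (hL : HasLipschitzBoundary Ω) (i j : ℕ) :
    ∃ C : ℝ≥0∞, C ≠ ∞ ∧ ∃ h₀ : ℝ, 0 < h₀ ∧ ∀ h, 0 < h → h ≤ h₀ → ∀ f, Jet i Ω f →
      ∃ g, Jet j (Metric.thickening (2 * h) Ω) g ∧
        (∀ γ, deg γ ≤ i → wsq h Ω (fun γ x => f γ x - g γ x) γ
          ≤ C * (ENNReal.ofReal h ^ (2 * i) * sobSum i Ω f)) ∧
        ∀ α, i ≤ deg α → deg α ≤ j → wsq h (Metric.thickening (2 * h) Ω) g α
          ≤ C * (ENNReal.ofReal h ^ (2 * i) * sobSum i Ω f) := by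
  obtain ⟨χ, -, hχ1, C, hC, h₀, hh₀, H⟩ :=
    exists_smoothable hΩ hL hΩb.isCompact_closure subset_rfl i j
  refine ⟨C, hC, h₀, hh₀, fun h hh hhh f hf => ?_⟩
  obtain ⟨F, g, hF, hF0, hg, h1, h2⟩ := H h hh hhh f hf
  refine ⟨g, hg, fun γ hγ => ?_, h2⟩
  have h3 : F 0 =ᵐ[volume.restrict Ω] f 0 := by
    filter_upwards [hF0, ae_restrict_mem hΩ.measurableSet] with x hx hxΩ
    rw [hx, hχ1 x (subset_closure hxΩ), one_mul]
  have h4 := hF.unique hΩ hf h3 hγ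
  refine le_trans (le_of_eq ?_) (h1 γ hγ)
  unfold wsq
  congr 1
  refine sqNorm_congr ?_
  filter_upwards [h4] with x hx
  rw [hx]

/-! ### Inverse estimates on Lipschitz domains -/

theorem wsq_sub_le {h : ℝ} {V : Set (E n)} {f g : (Fin n → ℕ) → E n → ℂ} {α : Fin n → ℕ}
    (hf : Measurable (f α)) :
    wsq h V (fun α x => f α x - g α x) α ≤ 2 * (wsq h V f α + wsq h V g α) := by
  unfold wsq
  rw [← mul_add, mul_left_comm]
  gcongr
  exact sqNorm_sub_le hf

/-- A smooth approximation at scale `h`, with constant `C`, of the jet `f`. -/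
structure Smoothing (i j : ℕ) (Ω : Set (E n)) (h : ℝ) (C : ℝ≥0∞)
    (f g : (Fin n → ℕ) → E n → ℂ) : Prop where
  jet : Jet j (Metric.thickening (2 * h) Ω) g
  sub_le : ∀ γ, deg γ ≤ i → wsq h Ω (fun γ x => f γ x - g γ x) γ
    ≤ C * (ENNReal.ofReal h ^ (2 * i) * sobSum i Ω f)
  le : ∀ α, i ≤ deg α → deg α ≤ j → wsq h (Metric.thickening (2 * h) Ω) g α
    ≤ C * (ENNReal.ofReal h ^ (2 * i) * sobSum i Ω f)

namespace Family

variable {G : Family n} {Ω : Set (E n)} {m κ i j : ℕ} {σ A B h : ℝ} {Cφ : ℕ → ℝ}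

/-- An active patch may leave Ω, but it has diameter at most h and contains the centre of its ball,
which is in Ω. Hence approximations are built on the 2h-neighbourhood. -/
theorem patch_subset_thickening (hσ : 0 < σ) (hh : 0 < h) (hA : G.AssumptionA Ω σ h)
    {l : Fin G.N} (hl : l ∈ G.active Ω) : G.patch l ⊆ Metric.thickening (2 * h) Ω := by
  intro y hy
  have hc : G.center l ∈ G.star l := Metric.mem_ball_self (hA.radius_pos hσ hh l)
  refine Metric.mem_thickening_iff.2 ⟨G.center l, hA.star_subset l (mem_active.1 hl) hc, ?_⟩
  have h1 := Metric.dist_le_diam_of_mem (hA.bounded l) hy (hA.star_subset_patch l hc)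
  have h2 := hA.diam_le l
  linarith

theorem sum_wsq_patch_le (hσ : 0 < σ) (hh : 0 < h) (hG : G.SatisfiesABCD Ω m κ σ A B Cφ h)
    {g : (Fin n → ℕ) → E n → ℂ} {γ : Fin n → ℕ} (hg : Measurable (g γ)) :
    ∑ l ∈ G.active Ω, wsq h (G.patch l) g γ ≤ κ * wsq h (Metric.thickening (2 * h) Ω) g γ := by
  unfold wsq
  rw [← Finset.mul_sum, mul_left_comm]
  gcongr
  exact sum_setLIntegral_le _ (W := G.patch)
    (fun l _ => (hG.assumptionB.partition.isOpen l).measurableSet)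
    (fun l hl => patch_subset_thickening hσ hh hG.assumptionA hl) (fun _ _ => subset_rfl)
    hG.assumptionB.partition.overlap (hg.enorm.pow_const 2)

theorem sum_wsq_star_le (hG : G.SatisfiesABCD Ω m κ σ A B Cφ h)
    {g : (Fin n → ℕ) → E n → ℂ} {γ : Fin n → ℕ} (hg : Measurable (g γ)) :
    ∑ l ∈ G.active Ω, wsq h (G.star l) g γ ≤ κ * wsq h Ω g γ := by
  unfold wsq
  rw [← Finset.mul_sum, mul_left_comm]
  gcongr
  exact sum_sqNorm_star_le hG hg

/-- The difference between a local contribution and the smooth approximation, on one patch. -/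
theorem exists_wsq_patch_sub_le (hn : 0 < n) (m κ : ℕ) {σ A B : ℝ} (Cφ : ℕ → ℝ) (hσ : 0 < σ)
    (hB : 0 < B) (i j : ℕ) (hij : i ≤ j) (hjm : j ≤ m) : ∃ K : ℝ≥0∞, K ≠ ∞ ∧
    ∀ {G : Family n} {Ω : Set (E n)} {h : ℝ}, 0 < h → G.SatisfiesABCD Ω m κ σ A B Cφ h →
      ∀ {w : E n → ℂ} {v : Fin G.N → E n → ℂ}, (∀ l, v l ∈ G.locSpace l) →
      (∀ᵐ x ∂(volume.restrict Ω), w x = ∑ l, (G.pou l x : ℂ) * v l x) →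
      ∀ {f g : (Fin n → ℕ) → E n → ℂ}, Jet m Ω f → f 0 =ᵐ[volume.restrict Ω] w →
      Jet j (Metric.thickening (2 * h) Ω) g →
      ∀ l ∈ G.active Ω, ∀ {u : (Fin n → ℕ) → E n → ℂ}, Jet m (G.patch l) u →
      u 0 =ᵐ[volume.restrict (G.patch l)] v l → ∀ γ, deg γ ≤ j →
        wsq h (G.patch l) (fun α x => u α x - (G.patch l).indicator (g α) x) γ ≤
          K * (ENNReal.ofReal h ^ (2 * i) * sobSum i (G.star l) f +
            ∑ δ ∈ (multiIndices n j).filter (fun δ => i ≤ deg δ), wsq h (G.patch l) g δ +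
            ∑ δ ∈ multiIndices n i, wsq h (G.star l) (fun α x => f α x - g α x) δ) := by
  obtain ⟨Cp, hCp, hpoin⟩ := exists_poincare_iterate n (ratio σ) i
  set D := ENNReal.ofReal (B * ratio σ ^ m) ^ 2 * ENNReal.ofReal A ^ 2 + 1 with hD
  refine ⟨2 * D + Cp * (1 + (multiIndices n i).card * (2 * D)), by rw [hD]; finiteness, ?_⟩
  intro G Ω h hh hG w v hv hw f g hf hf0 hg l hl u hu hu0 γ hγ
  have hA := hG.assumptionA
  have hV := hG.assumptionB.partition.isOpen l
  have hsub := patch_subset_thickening hσ hh hA hl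
  have hgl : Jet j (G.patch l) (fun α => (G.patch l).indicator (g α)) := hg.restrict hV hsub
  have hd := (hu.mono_order hjm).sub hgl
  set d : (Fin n → ℕ) → E n → ℂ := fun α x => u α x - (G.patch l).indicator (g α) x with hddef
  set a := ENNReal.ofReal h ^ (2 * i) * sobSum i (G.star l) f with ha
  set b := ∑ δ ∈ (multiIndices n j).filter (fun δ => i ≤ deg δ), wsq h (G.patch l) g δ with hb
  set c := ∑ δ ∈ multiIndices n i, wsq h (G.star l) (fun α x => f α x - g α x) δ with hc
  have hD1 : (1 : ℝ≥0∞) ≤ D := le_add_self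
  -- At orders from i on no cancellation is needed: (D) from H^i and (C) bound the local function,
  -- and g is bounded by its own smoothness.
  have htop : ∀ γ, i ≤ deg γ → deg γ ≤ j → wsq h (G.patch l) d γ ≤ 2 * D * (a + b) := by
    intro γ h1 h2
    have e1 := wsq_patch_le hn hσ hB hh hG (hv l) hu hu0 h1 (h2.trans hjm)
    have e2 := sobSum_patch_le hG (hv l) hu hu0 (hij.trans hjm)
    rw [sobSum_star_eq hG hw hf hf0 hl le_rfl hu hu0 (hij.trans hjm)] at e2
    have e3 : wsq h (G.patch l) u γ ≤ D * a := by
      calc wsq h (G.patch l) u γ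
          ≤ ENNReal.ofReal (B * ratio σ ^ m) ^ 2 * (ENNReal.ofReal h ^ (2 * i) *
            (ENNReal.ofReal A ^ 2 * sobSum i (G.star l) f)) := by
            refine e1.trans ?_
            gcongr
        _ = ENNReal.ofReal (B * ratio σ ^ m) ^ 2 * ENNReal.ofReal A ^ 2 * a := by rw [ha]; ring
        _ ≤ D * a := by gcongr; exact le_self_add
    have e4 : wsq h (G.patch l) (fun α => (G.patch l).indicator (g α)) γ ≤ D * b := by
      have e5 : wsq h (G.patch l) (fun α => (G.patch l).indicator (g α)) γ
          = wsq h (G.patch l) g γ := by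
        unfold wsq
        rw [sqNorm_indicator hV.measurableSet subset_rfl]
      rw [e5]
      calc wsq h (G.patch l) g γ ≤ b :=
            Finset.single_le_sum (f := fun δ => wsq h (G.patch l) g δ) (fun _ _ => zero_le)
              (Finset.mem_filter.2 ⟨mem_multiIndices.2 h2, h1⟩)
        _ = 1 * b := (one_mul b).symm
        _ ≤ D * b := by gcongr
    refine (wsq_sub_le (hu.meas γ)).trans ?_
    have e6 : 2 * D * (a + b) = 2 * (D * a + D * b) := by ring
    rw [e6]
    gcongr
  -- On the ball the local function is w, so the difference is the approximation error w - g.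
  have hstar : ∀ δ ∈ multiIndices n i,
      wsq h (G.star l) d δ = wsq h (G.star l) (fun α x => f α x - g α x) δ := by
    intro δ hδ
    unfold wsq
    congr 1
    refine sqNorm_congr ?_
    filter_upwards [jet_ae_eq_star hG hw hf hf0 hl le_rfl hu hu0
      ((mem_multiIndices.1 hδ).trans (hij.trans hjm)),
      ae_restrict_mem Metric.isOpen_ball.measurableSet] with x hx hxs
    simp [hddef, hx, hA.star_subset_patch l hxs]
  by_cases hγi : i ≤ deg γ
  · exact (htop γ hγi hγ).trans (mul_le_mul' le_self_add le_self_add)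
  -- Below order i, iterated Poincaré passes from the error on the ball and the derivatives of order
  -- exactly i to the whole patch.
  · have h1 := hpoin (c := G.center l) hV (hA.convex l) (hA.radius_pos hσ hh l)
      (hA.le_ratio_mul_radius hσ hh l) hh (hA.star_subset_patch l)
      (fun x hx y hy => (Metric.dist_le_diam_of_mem (hA.bounded l) hx hy).trans (hA.diam_le l))
      (hd.mono_order hij) γ (by omega)
    have h2 : ∑ δ ∈ multiIndices n i, wsq h (Metric.ball (G.center l) (G.radius l)) d δ = c :=
      Finset.sum_congr rfl hstar
    have h3 : ∑ δ ∈ (multiIndices n i).filter (fun δ => deg δ = i), wsq h (G.patch l) d δ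
        ≤ (multiIndices n i).card * (2 * D * (a + b)) := by
      calc _ ≤ ∑ _δ ∈ (multiIndices n i).filter (fun δ => deg δ = i), 2 * D * (a + b) :=
            Finset.sum_le_sum fun δ hδ => by
              have := (Finset.mem_filter.1 hδ).2
              exact htop δ (by omega) (by omega)
        _ = ((multiIndices n i).filter (fun δ => deg δ = i)).card * (2 * D * (a + b)) := by
            rw [Finset.sum_const, nsmul_eq_mul]
        _ ≤ _ := by
            gcongr
            exact Finset.filter_subset _ _
    rw [h2] at h1
    calc wsq h (G.patch l) d γ
        ≤ Cp * (c + (multiIndices n i).card * (2 * D * (a + b))) := by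
          refine h1.trans ?_
          gcongr
      _ = Cp * (1 * c + (multiIndices n i).card * (2 * D) * (a + b)) := by ring
      _ ≤ Cp * (1 * (a + b + c) + (multiIndices n i).card * (2 * D) * (a + b + c)) := by
          exact mul_le_mul' le_rfl (add_le_add (mul_le_mul' le_rfl le_add_self)
            (mul_le_mul' le_rfl le_self_add))
      _ = Cp * (1 + (multiIndices n i).card * (2 * D)) * (a + b + c) := by ring
      _ ≤ _ := by
          gcongr
          exact le_add_self

/-- The partition of unity reproduces g, and the cut-off to a patch is invisible because φ_l
vanishes on Ω off it. -/
theorem sum_pou_sub_indicator (hP : G.IsPartition Ω m κ Cφ) {x : E n} (hx : x ∈ Ω)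
    (u : Fin G.N → ℂ) (g : E n → ℂ) :
    ∑ l, (G.pou l x : ℂ) * (u l - (G.patch l).indicator g x)
      = ∑ l, (G.pou l x : ℂ) * u l - g x := by
  have h1 : ∀ l, (G.pou l x : ℂ) * (u l - (G.patch l).indicator g x)
      = (G.pou l x : ℂ) * u l - (G.pou l x : ℂ) * g x := by
    intro l
    by_cases h0 : G.pou l x = 0
    · simp [h0]
    · simp [pou_support_subset hP hx h0, mul_sub]
  simp only [h1, Finset.sum_sub_distrib]
  rw [← Finset.sum_mul]
  have h2 : ∑ l, (G.pou l x : ℂ) = 1 := by exact_mod_cast hP.sum_eq_one x hx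
  rw [h2, one_mul]

/-- The inverse estimate, given smooth approximations at the scale `h`. -/
theorem exists_inverse_estimate (hn : 0 < n) (m κ : ℕ) {σ A B : ℝ} (Cφ : ℕ → ℝ) (hσ : 0 < σ)
    (hB : 0 < B) (i j : ℕ) (hij : i ≤ j) (hjm : j ≤ m) {C : ℝ≥0∞} (hC : C ≠ ∞) :
    ∃ K : ℝ≥0∞, K ≠ ∞ ∧ ∀ {G : Family n} {Ω : Set (E n)} {h : ℝ}, IsOpen Ω →
      Bornology.IsBounded Ω → 0 < h → G.SatisfiesABCD Ω m κ σ A B Cφ h →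
      (∀ f, Jet i Ω f → ∃ g, Smoothing i j Ω h C f g) → ∀ w ∈ G.space Ω,
        sobolevNorm j Ω w ≤ ENNReal.ofReal (rootConst n m K * h ^ ((i : ℤ) - (j : ℤ))) *
          sobolevNorm i Ω w := by
  obtain ⟨K, hK, hloc⟩ := exists_wsq_patch_sub_le (A := A) hn m κ Cφ hσ hB i j hij hjm
  set N := ((multiIndices n j).card : ℝ≥0∞) with hN
  set S : ℝ≥0∞ := N * (K * (κ + N * (κ * C) + N * (κ * C))) with hS
  have hglue := glueConst_ne_top (n := n) (m := m) (κ := κ) (σ := σ) (Cφ := Cφ)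
  -- The factor 2 comes from splitting w = (w - g) + g at orders from i on; the summand 1 covers the
  -- orders below i.
  refine ⟨2 * (glueConst n m κ σ Cφ * S + C) + 1, by rw [hS]; finiteness, ?_⟩
  intro G Ω h hΩ hΩb hh hG hsm w hwS
  obtain ⟨f, hf, hf0, -⟩ := exists_space_jet hn hΩ hΩb hσ hB hh hG hwS
  obtain ⟨v, hv, hw⟩ := hwS
  obtain ⟨u, hu⟩ := exists_patch_jets hG hv
  obtain ⟨g, hg⟩ := hsm f (hf.mono_order (hij.trans hjm))
  have hP := hG.assumptionB.partition
  have hh1 := hG.assumptionA.h_le_one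
  set W := Metric.thickening (2 * h) Ω with hW
  have hΩW : Ω ⊆ W := subset_thickening_self hh
  set e := ENNReal.ofReal h with he
  have he1 : e ≤ 1 := by simpa [he] using hh1
  set Q := e ^ (2 * i) * sobSum i Ω f with hQ
  set d : Fin G.N → (Fin n → ℕ) → E n → ℂ :=
    fun l α x => u l α x - (G.patch l).indicator (g α) x with hd
  obtain ⟨q, hq, hq0, hqb⟩ := exists_glue hn hΩ hΩb hσ hh hG.assumptionA hP hjm (u := d)
    (fun l hl => ((hu l).1.mono_order hjm).sub (hg.jet.restrict (hP.isOpen l)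
      (patch_subset_thickening hσ hh hG.assumptionA hl)))
  have hsum : ∑ l ∈ G.active Ω, ∑ γ ∈ multiIndices n j, wsq h (G.patch l) (d l) γ ≤ S * Q := by
    have h1 : ∑ l ∈ G.active Ω, e ^ (2 * i) * sobSum i (G.star l) f ≤ κ * Q := by
      rw [← Finset.mul_sum, hQ, mul_left_comm]
      gcongr
      exact sum_sobSum_star_le hG hf.meas i
    have h2 : ∑ l ∈ G.active Ω, ∑ δ ∈ (multiIndices n j).filter (fun δ => i ≤ deg δ),
        wsq h (G.patch l) g δ ≤ N * (κ * C) * Q := by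
      rw [Finset.sum_comm]
      calc _ ≤ ∑ _δ ∈ (multiIndices n j).filter (fun δ => i ≤ deg δ), κ * (C * Q) :=
            Finset.sum_le_sum fun δ hδ => by
              obtain ⟨hδ1, hδ2⟩ := Finset.mem_filter.1 hδ
              refine (sum_wsq_patch_le hσ hh hG (hg.jet.meas δ)).trans ?_
              gcongr
              exact hg.le δ hδ2 (mem_multiIndices.1 hδ1)
        _ = ((multiIndices n j).filter (fun δ => i ≤ deg δ)).card * (κ * (C * Q)) := by
            rw [Finset.sum_const, nsmul_eq_mul]
        _ ≤ N * (κ * (C * Q)) := by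
            rw [hN]
            gcongr
            exact Finset.filter_subset _ _
        _ = _ := by ring
    have h3 : ∑ l ∈ G.active Ω, ∑ δ ∈ multiIndices n i,
        wsq h (G.star l) (fun α x => f α x - g α x) δ ≤ N * (κ * C) * Q := by
      rw [Finset.sum_comm]
      calc _ ≤ ∑ _δ ∈ multiIndices n i, κ * (C * Q) :=
            Finset.sum_le_sum fun δ hδ => by
              refine (sum_wsq_star_le hG (g := fun α x => f α x - g α x)
                ((hf.meas δ).sub (hg.jet.meas δ))).trans ?_
              gcongr
              exact hg.sub_le δ (mem_multiIndices.1 hδ)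
        _ = (multiIndices n i).card * (κ * (C * Q)) := by
            rw [Finset.sum_const, nsmul_eq_mul]
        _ ≤ N * (κ * (C * Q)) := by
            rw [hN]
            gcongr
            exact multiIndices_mono hij
        _ = _ := by ring
    calc _ ≤ ∑ l ∈ G.active Ω, ∑ _γ ∈ multiIndices n j,
          K * (e ^ (2 * i) * sobSum i (G.star l) f +
            ∑ δ ∈ (multiIndices n j).filter (fun δ => i ≤ deg δ), wsq h (G.patch l) g δ +
            ∑ δ ∈ multiIndices n i, wsq h (G.star l) (fun α x => f α x - g α x) δ) :=
          Finset.sum_le_sum fun l hl => Finset.sum_le_sum fun γ hγ =>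
            hloc hh hG hv hw hf hf0 hg.jet l hl (hu l).1 (hu l).2 γ (mem_multiIndices.1 hγ)
      _ = N * (K * (∑ l ∈ G.active Ω, e ^ (2 * i) * sobSum i (G.star l) f +
            ∑ l ∈ G.active Ω, ∑ δ ∈ (multiIndices n j).filter (fun δ => i ≤ deg δ),
              wsq h (G.patch l) g δ +
            ∑ l ∈ G.active Ω, ∑ δ ∈ multiIndices n i,
              wsq h (G.star l) (fun α x => f α x - g α x) δ)) := by
          simp only [Finset.sum_const, nsmul_eq_mul]
          rw [← Finset.mul_sum, ← Finset.mul_sum, Finset.sum_add_distrib, Finset.sum_add_distrib]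
      _ ≤ N * (K * (κ * Q + N * (κ * C) * Q + N * (κ * C) * Q)) := by gcongr
      _ = S * Q := by rw [hS]; ring
  -- The glued jet q represents w - g, so adding g recovers w.
  have hqf : (fun x => q 0 x + Ω.indicator (g 0) x) =ᵐ[volume.restrict Ω] f 0 := by
    filter_upwards [hq0, hf0, hw, sum_pou_congr hP hΩ fun l => (hu l).2,
      ae_restrict_mem hΩ.measurableSet] with x h1 h2 h3 h4 hx
    rw [h1, sum_pou_sub_indicator hP hx (fun l => u l 0 x), h4, h2, h3]
    simp [hx]
  have hgΩ := hg.jet.restrict hΩ hΩW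
  have hfj := hf.mono_order hjm
  have hw_mem : sobolevNorm i Ω w ^ 2 = sobSum i Ω f := hf.sobolevNorm_sq hΩ hf0 (hij.trans hjm)
  refine hfj.sobolevNorm_le_of_scaled hΩ hjm hf0 hh (by rw [hS]; finiteness) fun α hα => ?_
  rw [hw_mem]
  change e ^ (2 * j) * sqNorm Ω (f α) ≤ _ * Q
  by_cases hαi : i ≤ deg α
  · calc e ^ (2 * j) * sqNorm Ω (f α) ≤ wsq h Ω f α := by
          unfold wsq
          gcongr ?_ * _
          exact pow_le_pow_of_le_one zero_le he1 (by omega)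
      _ = wsq h Ω (fun α x => q α x + Ω.indicator (g α) x) α := by
          unfold wsq
          rw [sqNorm_congr ((hq.add hgΩ).unique hΩ hfj hqf hα)]
      _ ≤ 2 * (wsq h Ω q α + wsq h Ω (fun α => Ω.indicator (g α)) α) := wsq_add_le (hq.meas α)
      _ ≤ 2 * (glueConst n m κ σ Cφ * (S * Q) + C * Q) := by
          gcongr
          · exact (hqb α hα).trans (by gcongr)
          · refine le_trans ?_ (hg.le α hαi hα)
            unfold wsq
            rw [sqNorm_indicator hΩ.measurableSet subset_rfl]
            gcongr
            exact sqNorm_mono_set hΩW _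
      _ = 2 * (glueConst n m κ σ Cφ * S + C) * Q := by ring
      _ ≤ _ := by gcongr; exact le_self_add
  -- Derivatives of order below i are part of the H^i norm, and h^(2j) ≤ h^(2i).
  · calc e ^ (2 * j) * sqNorm Ω (f α) ≤ e ^ (2 * i) * sobSum i Ω f := by
          gcongr ?_ * ?_
          · exact pow_le_pow_of_le_one zero_le he1 (by omega)
          · exact sqNorm_le_sobSum (by omega)
      _ = 1 * Q := (one_mul Q).symm
      _ ≤ _ := by gcongr; exact le_add_self

/-- The inverse estimate for the dual norms, given smooth approximations at the scale `h`. -/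
theorem dual_inverse_estimate (hΩ : IsOpen Ω) (hh : 0 < h) (hh1 : h ≤ 1) (hij : i ≤ j)
    (hjm : j ≤ m) {C : ℝ≥0∞} (hC : C ≠ ∞) {c : ℝ} (hc : 0 < c)
    (hsm : ∀ f, Jet i Ω f → ∃ g, Smoothing i j Ω h C f g) {w : E n → ℂ}
    (hw : MemSobolev 0 Ω w)
    (hw0 : sobolevNorm 0 Ω w ≤ ENNReal.ofReal (c * h ^ (-(j : ℤ))) * sobolevDualNorm j Ω w) :
    sobolevDualNorm i Ω w ≤ ENNReal.ofReal
      ((c * rootConst n m C + rootConst n m (2 * (1 + C))) * h ^ ((i : ℤ) - (j : ℤ))) *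
        sobolevDualNorm j Ω w := by
  refine iSup₂_le fun φ hφ => iSup_le fun h0 => ?_
  rw [ENNReal.div_le_iff h0 (ne_of_lt hφ)]
  obtain ⟨f, hf, hf0⟩ := hφ.exists_jet hΩ
  -- The test function, not w, is smoothed: φ - g is O(h^i) in L² and is paired with w there, while
  -- g lies in H^j and is paired through the dual norm of order j.
  obtain ⟨g, hg⟩ := hsm f hf
  have hφs : sobolevNorm i Ω φ ^ 2 = sobSum i Ω f := hf.sobolevNorm_sq hΩ hf0 le_rfl
  set W := Metric.thickening (2 * h) Ω with hW
  have hΩW : Ω ⊆ W := subset_thickening_self hh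
  have hgΩ := hg.jet.restrict hΩ hΩW
  set e := ENNReal.ofReal h with he
  have he1 : e ≤ 1 := by simpa [he] using hh1
  set Q := e ^ (2 * i) * sobSum i Ω f with hQ
  have hind : Ω.indicator (g 0) =ᵐ[volume.restrict Ω] g 0 :=
    indicator_ae_eq_restrict hΩ.measurableSet
  have hd := (hf.mono_order (Nat.zero_le i)).sub (hgΩ.mono_order (Nat.zero_le j))
  have hd0 : (fun x => f 0 x - Ω.indicator (g 0) x) =ᵐ[volume.restrict Ω] fun x => φ x - g 0 x := by
    filter_upwards [hf0, hind] with x h1 h2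
    rw [h1, h2]
  have h1 : sobolevNorm 0 Ω (fun x => φ x - g 0 x)
      ≤ ENNReal.ofReal (rootConst n m C * h ^ ((i : ℤ) - ((0 : ℕ) : ℤ))) * sobolevNorm i Ω φ := by
    refine hd.sobolevNorm_le_of_scaled hΩ (Nat.zero_le m) hd0 hh hC fun α hα => ?_
    obtain rfl : α = 0 := deg_eq_zero (by omega)
    have h2 := hg.sub_le 0 (by simp)
    rw [hφs]
    refine le_trans (le_of_eq ?_) h2
    simp only [wsq, mul_zero, pow_zero, one_mul, deg_zero]
    refine sqNorm_congr ?_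
    filter_upwards [hind] with x hx
    rw [hx]
  have h2 : sobolevNorm j Ω (g 0) ≤ ENNReal.ofReal (rootConst n m (2 * (1 + C)) *
      h ^ ((i : ℤ) - (j : ℤ))) * sobolevNorm i Ω φ := by
    refine hgΩ.sobolevNorm_le_of_scaled hΩ hjm hind hh (by finiteness) fun α hα => ?_
    rw [hφs]
    change e ^ (2 * j) * sqNorm Ω (Ω.indicator (g α)) ≤ _ * Q
    rw [sqNorm_indicator hΩ.measurableSet subset_rfl]
    by_cases hαi : i ≤ deg α
    · calc e ^ (2 * j) * sqNorm Ω (g α) ≤ wsq h W g α := by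
            unfold wsq
            gcongr ?_ * ?_
            · exact pow_le_pow_of_le_one zero_le he1 (by omega)
            · exact sqNorm_mono_set hΩW _
        _ ≤ 1 * C * Q := by rw [one_mul]; exact hg.le α hαi hα
        _ ≤ 2 * (1 + C) * Q := by
            gcongr
            · norm_num
            · exact le_add_self
    -- The smoothing bounds g directly only from order i on; below, g is φ minus the error.
    · have e1 : sqNorm Ω (g α) ≤ 2 * (sqNorm Ω (f α) + sqNorm Ω (fun x => f α x - g α x)) := by
        have := sqNorm_sub_le (V := Ω) (f := f α) (g := fun x => f α x - g α x) (hf.meas α)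
        simpa using this
      calc e ^ (2 * j) * sqNorm Ω (g α)
          ≤ e ^ (2 * j) * (2 * (sqNorm Ω (f α) + sqNorm Ω (fun x => f α x - g α x))) := by gcongr
        _ = 2 * (e ^ (2 * j) * sqNorm Ω (f α) +
              e ^ (2 * j) * sqNorm Ω (fun x => f α x - g α x)) := by ring
        _ ≤ 2 * (Q + C * Q) := by
            refine mul_le_mul' le_rfl (add_le_add ?_ ?_)
            · rw [hQ]
              gcongr ?_ * ?_
              · exact pow_le_pow_of_le_one zero_le he1 (by omega)
              · exact sqNorm_le_sobSum (by omega)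
            · refine le_trans ?_ (hg.sub_le α (by omega))
              unfold wsq
              gcongr ?_ * _
              exact pow_le_pow_of_le_one zero_le he1 (by omega)
        _ = _ := by ring
  have hm1 : MemSobolev 0 Ω fun x => φ x - g 0 x := hd.memSobolev hΩ hd0 le_rfl
  have hm2 : MemSobolev j Ω (g 0) := hgΩ.memSobolev hΩ hind le_rfl
  have hint : ∀ {ψ : E n → ℂ}, MemSobolev 0 Ω ψ →
      Integrable (fun x => w x * conj (ψ x)) (volume.restrict Ω) := fun hψ =>
    (hw.memLp hΩ).integrable_mul (hψ.memLp hΩ).star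
  have hsplit : ∫ x in Ω, w x * conj (φ x)
      = (∫ x in Ω, w x * conj (φ x - g 0 x)) + ∫ x in Ω, w x * conj (g 0 x) := by
    rw [← integral_add (hint hm1) (hint (hm2.mono_order (Nat.zero_le j)))]
    congr 1
    funext x
    rw [← mul_add, ← map_add, sub_add_cancel]
  have hzp : h ^ (-(j : ℤ)) * h ^ ((i : ℤ) - ((0 : ℕ) : ℤ)) = h ^ ((i : ℤ) - (j : ℤ)) := by
    rw [← zpow_add₀ hh.ne']
    congr 1
    push_cast
    ring
  set D := sobolevDualNorm j Ω w
  set P := sobolevNorm i Ω φ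
  have hr1 := rootConst_pos (n := n) (m := m) (K := C)
  have hr2 := rootConst_pos (n := n) (m := m) (K := 2 * (1 + C))
  have hz : 0 < h ^ ((i : ℤ) - (j : ℤ)) := by positivity
  calc ‖∫ x in Ω, w x * conj (φ x)‖ₑ
      ≤ ‖∫ x in Ω, w x * conj (φ x - g 0 x)‖ₑ + ‖∫ x in Ω, w x * conj (g 0 x)‖ₑ := by
        rw [hsplit]
        exact enorm_add_le _ _
    _ ≤ sobolevNorm 0 Ω w * sobolevNorm 0 Ω (fun x => φ x - g 0 x) + D * sobolevNorm j Ω (g 0) :=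
        add_le_add (enorm_pairing_le hΩ hw hm1) (enorm_pairing_le_dual hΩ hw hm2)
    _ ≤ (ENNReal.ofReal (c * h ^ (-(j : ℤ))) * D) *
          (ENNReal.ofReal (rootConst n m C * h ^ ((i : ℤ) - ((0 : ℕ) : ℤ))) * P) +
        D * (ENNReal.ofReal (rootConst n m (2 * (1 + C)) * h ^ ((i : ℤ) - (j : ℤ))) * P) := by
        gcongr
    _ = (ENNReal.ofReal (c * h ^ (-(j : ℤ))) *
          ENNReal.ofReal (rootConst n m C * h ^ ((i : ℤ) - ((0 : ℕ) : ℤ))) +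
        ENNReal.ofReal (rootConst n m (2 * (1 + C)) * h ^ ((i : ℤ) - (j : ℤ)))) * D * P := by ring
    _ = _ := by
        rw [← ENNReal.ofReal_mul (by positivity), ← ENNReal.ofReal_add (by positivity)
          (by positivity)]
        congr 3
        rw [mul_mul_mul_comm, hzp]
        ring

/-- Both inverse estimates for one pair of orders on a Lipschitz domain. -/
theorem inverse_estimate_lipschitz (hn : 0 < n) (m κ : ℕ) {σ A B : ℝ} (Cφ : ℕ → ℝ) (hσ : 0 < σ)
    (hB : 0 < B) (hΩ : IsOpen Ω) (hΩb : Bornology.IsBounded Ω) (hL : HasLipschitzBoundary Ω)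
    (i j : ℕ) (hij : i ≤ j) (hjm : j ≤ m) :
    ∃ C : ℝ, 0 < C ∧ ∀ h : ℝ, 0 < h → ∀ G : Family n, G.SatisfiesABCD Ω m κ σ A B Cφ h →
      ∀ w ∈ G.space Ω,
        sobolevNorm j Ω w ≤
          ENNReal.ofReal (C * h ^ ((i : ℤ) - (j : ℤ))) * sobolevNorm i Ω w ∧
        sobolevDualNorm i Ω w ≤
          ENNReal.ofReal (C * h ^ ((i : ℤ) - (j : ℤ))) * sobolevDualNorm j Ω w := by
  obtain ⟨C, hC, h₀, hh₀, hsm⟩ := exists_smoothing hΩ hΩb hL i j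
  obtain ⟨K, hK, hinv⟩ := exists_inverse_estimate (A := A) hn m κ Cφ hσ hB i j hij hjm hC
  set c := rootConst n m (invConst n m κ σ A B Cφ) with hc
  have hc0 : 0 < c := rootConst_pos
  set r := rootConst n m K
  set r' := c * rootConst n m C + rootConst n m (2 * (1 + C)) with hr'
  have hr0 : 0 < r := rootConst_pos
  have hr0' : 0 < r' := add_pos (mul_pos hc0 rootConst_pos) rootConst_pos
  -- For h > h₀, where smoothing is not available, h^(-j) = h^(-i) h^(i-j) ≤ h₀^(-i) h^(i-j), so the
  -- estimates relative to L² suffice.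
  set b := c * (h₀ ^ i)⁻¹ with hb
  have hb0 : 0 < b := by positivity
  refine ⟨r + r' + b, by positivity, fun h hh G hG w hw => ?_⟩
  have hz : 0 < h ^ ((i : ℤ) - (j : ℤ)) := by positivity
  obtain ⟨hmem, hzero⟩ := inverse_estimate_zero hn hΩ hΩb hσ hB hh hG hw
  have hmem0 := hmem.mono_order (Nat.zero_le m)
  obtain ⟨hz1, hz2⟩ := hzero j hjm
  have hmono : ∀ {s : ℝ} {x : ℝ≥0∞}, s ≤ r + r' + b →
      ENNReal.ofReal (s * h ^ ((i : ℤ) - (j : ℤ))) * x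
        ≤ ENNReal.ofReal ((r + r' + b) * h ^ ((i : ℤ) - (j : ℤ))) * x := by
    intro s x hs
    gcongr
  rcases le_or_gt h h₀ with hle | hgt
  · have hsm' : ∀ f, Jet i Ω f → ∃ g, Smoothing i j Ω h C f g := fun f hf => by
      obtain ⟨g, h1, h2, h3⟩ := hsm h hh hle f hf
      exact ⟨g, h1, h2, h3⟩
    exact ⟨(hinv hΩ hΩb hh hG hsm' w hw).trans (hmono (by linarith)),
      (dual_inverse_estimate hΩ hh hG.assumptionA.h_le_one hij hjm hC hc0 hsm' hmem0 hz2).trans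
        (hmono (by linarith))⟩
  · have hcoef : c * h ^ (-(j : ℤ)) ≤ b * h ^ ((i : ℤ) - (j : ℤ)) := by
      have e1 : h ^ (-(j : ℤ)) = (h ^ i)⁻¹ * h ^ ((i : ℤ) - (j : ℤ)) := by
        rw [← zpow_natCast, ← zpow_neg, ← zpow_add₀ hh.ne']
        congr 1
        ring
      rw [e1, hb, ← mul_assoc]
      gcongr
    have hcoef' := ENNReal.ofReal_le_ofReal hcoef
    constructor
    · calc sobolevNorm j Ω w ≤ _ := hz1
        _ ≤ ENNReal.ofReal (b * h ^ ((i : ℤ) - (j : ℤ))) * sobolevNorm i Ω w :=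
            mul_le_mul' hcoef' (sobolevNorm_mono_order (Nat.zero_le i) Ω w)
        _ ≤ _ := hmono (by linarith)
    · calc sobolevDualNorm i Ω w ≤ sobolevNorm 0 Ω w := sobolevDualNorm_le hΩ hmem0
        _ ≤ _ := hz2
        _ ≤ ENNReal.ofReal (b * h ^ ((i : ℤ) - (j : ℤ))) * sobolevDualNorm j Ω w :=
            mul_le_mul' hcoef' le_rfl
        _ ≤ _ := hmono (by linarith)

end Family

end GFEM

/-! ### One constant for all pairs of orders. -/

theorem mainTheorem10 (n : ℕ) (hn : 0 < n) (m κ : ℕ) (σ A B : ℝ) (Cφ : ℕ → ℝ)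
    (hσ : 0 < σ) (hA : 0 < A) (hB : 0 < B) :
    -- the case `i = 0`, with a constant that does not depend on the domain
    (∃ C : ℝ, 0 < C ∧ ∀ Ω : Set (GFEM.E n), IsOpen Ω → Bornology.IsBounded Ω →
      ∀ h : ℝ, 0 < h → ∀ G : GFEM.Family n, G.SatisfiesABCD Ω m κ σ A B Cφ h →
      ∀ w ∈ G.space Ω,
        GFEM.MemSobolev m Ω w ∧
        ∀ j : ℕ, j ≤ m →
          GFEM.sobolevNorm j Ω w ≤
            ENNReal.ofReal (C * h ^ (-(j : ℤ))) * GFEM.sobolevNorm 0 Ω w ∧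
          GFEM.sobolevNorm 0 Ω w ≤
            ENNReal.ofReal (C * h ^ (-(j : ℤ))) * GFEM.sobolevDualNorm j Ω w) ∧
    -- the general case `0 ≤ i ≤ j ≤ m` on a Lipschitz domain
    (∀ Ω : Set (GFEM.E n), IsOpen Ω → Bornology.IsBounded Ω → GFEM.HasLipschitzBoundary Ω →
      ∃ C : ℝ, 0 < C ∧
      ∀ h : ℝ, 0 < h → ∀ G : GFEM.Family n, G.SatisfiesABCD Ω m κ σ A B Cφ h →
      ∀ w ∈ G.space Ω, ∀ i j : ℕ, i ≤ j → j ≤ m →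
        GFEM.sobolevNorm j Ω w ≤
          ENNReal.ofReal (C * h ^ ((i : ℤ) - (j : ℤ))) * GFEM.sobolevNorm i Ω w ∧
        GFEM.sobolevDualNorm i Ω w ≤
          ENNReal.ofReal (C * h ^ ((i : ℤ) - (j : ℤ))) * GFEM.sobolevDualNorm j Ω w) := by
  refine ⟨⟨GFEM.rootConst n m (GFEM.Family.invConst n m κ σ A B Cφ), GFEM.rootConst_pos,
    fun Ω hΩ hΩb h hh G hG w hw =>
      GFEM.Family.inverse_estimate_zero hn hΩ hΩb hσ hB hh hG hw⟩,
    fun Ω hΩ hΩb hL => ?_⟩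
  choose! C hC H using fun i j => GFEM.Family.inverse_estimate_lipschitz (A := A) hn m κ Cφ hσ hB
    hΩ hΩb hL i j
  -- The chosen constants are known to be positive only for i ≤ j ≤ m, so the sum that dominates
  -- them runs over these pairs alone.
  have hC0 : ∀ p ∈ (Finset.range (m + 1) ×ˢ Finset.range (m + 1)).filter (fun p => p.1 ≤ p.2),
      0 < C p.1 p.2 := by
    intro p hp
    simp only [Finset.mem_filter, Finset.mem_product, Finset.mem_range] at hp
    exact hC p.1 p.2 hp.2 (by omega)
  refine ⟨∑ p ∈ (Finset.range (m + 1) ×ˢ Finset.range (m + 1)).filter (fun p => p.1 ≤ p.2),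
    C p.1 p.2, Finset.sum_pos hC0 ⟨(0, 0), by simp⟩, fun h hh G hG w hw i j hij hjm => ?_⟩
  have hle := Finset.single_le_sum (f := fun p : ℕ × ℕ => C p.1 p.2) (fun p hp => (hC0 p hp).le)
    (show (i, j) ∈ (Finset.range (m + 1) ×ˢ Finset.range (m + 1)).filter (fun p => p.1 ≤ p.2) by
      simp only [Finset.mem_filter, Finset.mem_product, Finset.mem_range]
      omega)
  have hz : 0 < h ^ ((i : ℤ) - (j : ℤ)) := by positivity
  have hco := ENNReal.ofReal_le_ofReal (mul_le_mul_of_nonneg_right hle hz.le)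
  obtain ⟨h1, h2⟩ := H i j hij hjm h hh G hG w hw
  exact ⟨h1.trans (mul_le_mul' hco le_rfl), h2.trans (mul_le_mul' hco le_rfl)⟩
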